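/- **Conventions.** Manifolds are smooth, Hausdorff and finite-dimensional; all objects on them are smooth. Let $M$ have dimension $n+1$. Torsion-free affine connections $\nabla,\nabla'$ on $M$ are *projectively equivalent* if there is a 1-form $\Upsilon$ with $\nabla'_vY=\nabla_vY+\Upsilon(v)Y+\Upsilon(Y)v$; the class $[\nabla]$ is a *projective structure*. Write $R(u,v)w=\nabla_u\nabla_vw-\nabla_v\nabla_uw-\nabla_{[u,v]}w$, $\mathrm{Ric}(v,w)=\mathrm{tr}\,(u\mapsto R(u,v)w)$ and $n(n+2)\,P(v,w)=(n+1)\,\mathrm{Ric}(v,w)+\mathrm{Ric}(w,v)$. Let $\mathcal E(1)$ be the positive $(2n+4)$-th root of the (canonically oriented) line bundle $(\Lambda^{n+1}TM)^{\otimes2}$, with the connections induced by those on $TM$. The *cotractor bundle* $\mathcal T^*=J^1\mathcal E(1)$ is the bundle of 1-jets of sections of $\mathcal E(1)$, and the *tractor bundle* $\mathcal T$ is its dual. Each $\nabla'\in[\nabla]$ gives a splitting $\mathcal T^*\cong (T^*M\otimes\mathcal E(1))\oplus\mathcal E(1)$, $j^1\sigma\mapsto(\nabla'\sigma,\sigma)$,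 in which the *tractor connection* is $$\nabla^{\mathcal T}_v(\mu,\sigma)=\bigl(\nabla'_v\mu+P'(v,\cdot)\,\sigma,\ \nabla'_v\sigma-\mu(v)\bigr);$$ it does not depend on the choice of $\nabla'\in[\nabla]$. The bundle $\mathcal T$ carries the dual connection, and "parallel" refers to the induced connections on $S^2\mathcal T^*$ and $\mathrm{End}\,\mathcal T$. For a vector field $\xi$, the section $L^{\mathcal A}(\xi)$ of $\mathrm{End}\,\mathcal T$ is the transpose of the endomorphism of $\mathcal T^*$ given in the splitting determined by $\nabla'$ by $(\mu,\sigma)\mapsto(\mu\circ\varphi+\sigma\nu,\ \mu(\xi)+c\,\sigma)$, where, with $\delta=\mathrm{div}\,\xi=\mathrm{tr}(\nabla'\xi)$, $$\varphi=\nabla'\xi-\tfrac{\delta}{n+2}\,\mathrm{id},\qquad \nu(v)=-\tfrac1{n+2}\,d\delta(v)-P'(v,\xi),\qquad c=-\tfrac{\delta}{n+2}.$$ Let $p\ge1$ and $q\ge0$. A *3-Sasaki manifold of signature $(4p-1,4q)$* is a manifold with a pseudo-Riemannian metric $g$ of that signature, with Levi-Civita connection $\nabla$, and three Killing fields $i,j,k$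 which are pairwise orthogonal, satisfy $[i,j]=-2k$, $[j,k]=-2i$, $[k,i]=-2j$, and are each Sasaki: every $\xi\in\{i,j,k\}$ satisfies $$g(\xi,\xi)=1,\qquad \nabla_a\nabla_b\xi^c=-g_{ab}\xi^c+\delta^c{}_a\,\xi_b .$$ The *projective structure induced by* it is $[\nabla]$. **Theorem.** Let $(M,g,(i,j,k))$ be a 3-Sasaki manifold of signature $(4p-1,4q)$, with Levi-Civita connection $\nabla$. Then the tractor bundle $\mathcal T$ of $(M,[\nabla])$ carries a parallel tractor hyperkähler structure of signature $(4p,4q)$. That is, there are * a parallel section $h$ of $S^2\mathcal T^*$ which is at each point a non-degenerate inner product of signature $(4p,4q)$, and * parallel sections $\mathbb I,\mathbb J,\mathbb K$ of $\mathrm{End}\,\mathcal T$ with $\mathbb I^2=\mathbb J^2=\mathbb K^2=-\mathrm{id}_{\mathcal T}$, each of them $h$-Hermitian (that is, $h(\mathbb Is,\mathbb It)=h(s,t)$ for all $s,t$, and likewise for $\mathbb J$ and $\mathbb K$), such that $\mathbb I\mathbb J\mathbb K=-\mathrm{id}_{\mathcal T}$. Moreover $\mathbb I=L^{\mathcal A}(i)$,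 $\mathbb J=L^{\mathcal A}(j)$ and $\mathbb K=L^{\mathcal A}(k)$, where $L^{\mathcal A}$ may be computed from any connection in $[\nabla]$. -/

import Mathlib

open Bundle Manifold Topology
open scoped ContDiff

noncomputable section

namespace ProjectiveTractor

/-! ### Linear algebra -/

/-- The linear map which takes the same values as `f` on a basis of `V`. By `linearize_eq` this is
`f` itself whenever `f` is linear; it is only ever applied to functions which are linear for the
smooth data at hand. -/
def linearize {V W : Type*} [AddCommGroup V] [Module ℝ V] [FiniteDimensional ℝ V]
    [AddCommGroup W] [Module ℝ W] (f : V → W) : V →ₗ[ℝ] W :=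
  (Module.finBasis ℝ V).constr ℝ fun i => f (Module.finBasis ℝ V i)

theorem linearize_eq {V W : Type*} [AddCommGroup V] [Module ℝ V] [FiniteDimensional ℝ V]
    [AddCommGroup W] [Module ℝ W] (f : V → W) (g : V →ₗ[ℝ] W) (h : ∀ v, f v = g v) :
    linearize f = g := by
  refine (Module.finBasis ℝ V).ext fun i => ?_
  rw [linearize, Module.Basis.constr_basis, h]

/-- `B` is an inner product (symmetric, non-degenerate, possibly indefinite) of signature
`(r, s)`: `r` is the maximal dimension of a positive definite subspace and `s` the maximal
dimension of a negative definite one. -/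
structure IsInnerProduct {V : Type*} [AddCommGroup V] [Module ℝ V]
    (B : LinearMap.BilinForm ℝ V) (r s : ℕ) : Prop where
  symm : ∀ v w, B v w = B w v
  nondegenerate : ∀ v, (∀ w, B v w = 0) → v = 0
  sigPos_eq : sigPos B.toQuadraticMap = r
  sigNeg_eq : sigNeg B.toQuadraticMap = s

/-! ### The line bundle `E(1)` -/

section Density

variable (E : Type*) [NormedAddCommGroup E] [NormedSpace ℝ E] [FiniteDimensional ℝ E]

theorem contDiff_det : ContDiff ℝ ∞ fun f : E →L[ℝ] E => f.det := by
  have h : ∀ f : E →L[ℝ] E, f.det =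
      (LinearMap.toMatrix (Module.finBasis ℝ E) (Module.finBasis ℝ E) (f : E →ₗ[ℝ] E)).det := by
    intro f
    exact (LinearMap.det_toMatrix _ _).symm
  simp_rw [h, Matrix.det_apply]
  refine ContDiff.sum fun σ _ => ContDiff.const_smul _ (contDiff_prod fun i _ => ?_)
  let L : (E →L[ℝ] E) →ₗ[ℝ] ℝ :=
    { toFun := fun f => LinearMap.toMatrix (Module.finBasis ℝ E) (Module.finBasis ℝ E)
        (f : E →ₗ[ℝ] E) (σ i) i
      map_add' := by intro a b; simp
      map_smul' := by intro a b; simp }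
  exact (LinearMap.toContinuousLinearMap L).contDiff

variable (M : Type*) [TopologicalSpace M] [ChartedSpace E M] [IsManifold 𝓘(ℝ, E) ∞ M]

/-- The transition function of `E(1)` from the chart `i` to the chart `j`. Writing `A` for the
transition function of `TM` and `N = dim M`, that of `K = (Λ^N TM)^{⊗ 2}` is `(det A)^2 > 0`, and
that of its oriented root `E(1) = K^{1/(2N+2)}` is `((det A)^2)^{1/(2N+2)}`. -/
def densityFactor (i j : atlas E M) (x : M) : ℝ :=
  (((tangentBundleCore 𝓘(ℝ, E) M).coordChange i j x).det ^ 2) ^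
    (1 / (2 * (Module.finrank ℝ E : ℝ) + 2))

set_option linter.unusedSectionVars false in
theorem tangent_det_ne_zero (i j : atlas E M) {x : M} (hi : x ∈ i.1.source) (hj : x ∈ j.1.source) :
    ((tangentBundleCore 𝓘(ℝ, E) M).coordChange i j x).det ≠ 0 := by
  set A := (tangentBundleCore 𝓘(ℝ, E) M).coordChange i j x
  set B := (tangentBundleCore 𝓘(ℝ, E) M).coordChange j i x
  have h : ((B : E →ₗ[ℝ] E) ∘ₗ (A : E →ₗ[ℝ] E)) = LinearMap.id := by
    ext v
    have := (tangentBundleCore 𝓘(ℝ, E) M).coordChange_comp i j i x ⟨⟨hi, hj⟩, hi⟩ v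
    rw [(tangentBundleCore 𝓘(ℝ, E) M).coordChange_self i x hi v] at this
    exact this
  have h2 := congrArg LinearMap.det h
  rw [LinearMap.det_comp, LinearMap.det_id] at h2
  intro h0
  have : LinearMap.det (A : E →ₗ[ℝ] E) = 0 := h0
  rw [this, mul_zero] at h2
  exact zero_ne_one h2

theorem contMDiffOn_densityFactor (i j : atlas E M) :
    ContMDiffOn 𝓘(ℝ, E) 𝓘(ℝ, ℝ) ∞ (densityFactor E M i j) (i.1.source ∩ j.1.source) := by
  have : IsManifold 𝓘(ℝ, E) (∞ + 1) M := by
    have h : (∞ + 1 : WithTop ℕ∞) = ∞ := rfl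
    rw [h]; infer_instance
  have : (tangentBundleCore 𝓘(ℝ, E) M).IsContMDiff 𝓘(ℝ, E) ∞ := tangentBundleCore.isContMDiff
  have h1 := (tangentBundleCore 𝓘(ℝ, E) M).contMDiffOn_coordChange (n := ∞) 𝓘(ℝ, E) i j
  have h2 : ContMDiffOn 𝓘(ℝ, E) 𝓘(ℝ, ℝ) ∞
      (fun x => ((tangentBundleCore 𝓘(ℝ, E) M).coordChange i j x).det)
      (i.1.source ∩ j.1.source) :=
    (contDiff_det E).contMDiff.comp_contMDiffOn h1
  intro x hx
  have h3 : ContDiffAt ℝ ∞ (fun d : ℝ => (d ^ 2) ^ (1 / (2 * (Module.finrank ℝ E : ℝ) + 2)))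
      (((tangentBundleCore 𝓘(ℝ, E) M).coordChange i j x).det) := by
    refine ContDiffAt.rpow_const_of_ne (contDiffAt_id.pow 2) ?_
    exact pow_ne_zero 2 (tangent_det_ne_zero E M i j hx.1 hx.2)
  exact h3.contMDiffAt.comp_contMDiffWithinAt x (h2 x hx)

/-- The real line bundle `E(1)`, over the atlas of `M`. -/
def densityCore : VectorBundleCore ℝ M ℝ (atlas E M) where
  baseSet i := i.1.source
  isOpen_baseSet i := i.1.open_source
  indexAt := achart E
  mem_baseSet_at := mem_chart_source E
  coordChange i j x := densityFactor E M i j x • ContinuousLinearMap.id ℝ ℝ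
  coordChange_self i x hx v := by
    have h : (((tangentBundleCore 𝓘(ℝ, E) M).coordChange i i x) : E →L[ℝ] E)
        = ContinuousLinearMap.id ℝ E := by
      ext v
      exact (tangentBundleCore 𝓘(ℝ, E) M).coordChange_self i x hx v
    have h' : densityFactor E M i i x = 1 := by
      rw [densityFactor, h]
      simp [ContinuousLinearMap.det]
    simp [h']
  continuousOn_coordChange i j :=
    ((contMDiffOn_densityFactor E M i j).continuousOn).smul continuousOn_const
  coordChange_comp i j k x hx v := by
    obtain ⟨⟨hi, hj⟩, hk⟩ := hx
    have h : ((tangentBundleCore 𝓘(ℝ, E) M).coordChange i k x).det =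
        ((tangentBundleCore 𝓘(ℝ, E) M).coordChange j k x).det *
        ((tangentBundleCore 𝓘(ℝ, E) M).coordChange i j x).det := by
      have : (((tangentBundleCore 𝓘(ℝ, E) M).coordChange i k x : E →L[ℝ] E) : E →ₗ[ℝ] E) =
          (((tangentBundleCore 𝓘(ℝ, E) M).coordChange j k x : E →L[ℝ] E) : E →ₗ[ℝ] E) ∘ₗ
          (((tangentBundleCore 𝓘(ℝ, E) M).coordChange i j x : E →L[ℝ] E) : E →ₗ[ℝ] E) := by
        ext v
        exact ((tangentBundleCore 𝓘(ℝ, E) M).coordChange_comp i j k x ⟨⟨hi, hj⟩, hk⟩ v).symm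
      rw [ContinuousLinearMap.det, this, LinearMap.det_comp]
    have h' : densityFactor E M i k x = densityFactor E M j k x * densityFactor E M i j x := by
      rw [densityFactor, h, mul_pow, Real.mul_rpow (sq_nonneg _) (sq_nonneg _)]
      rfl
    simp [h', mul_assoc]

instance : (densityCore E M).IsContMDiff 𝓘(ℝ, E) ∞ where
  contMDiffOn_coordChange i j :=
    (contMDiffOn_densityFactor E M i j).smul contMDiffOn_const

variable {M}

/-- The fibre of `E(1)` at `x`; Mathlib makes these the fibres of a smooth line bundle. -/
abbrev Density (x : M) : Type := (densityCore E M).Fiber x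

/-- The identification of `ℝ` with the fibre of `E(1)` at `x` by means of the chart at `x`. -/
def densityUnit (x : M) : ℝ ≃ₗ[ℝ] Density E x := LinearEquiv.refl ℝ ℝ

instance instFiniteDimensionalTangent (x : M) : FiniteDimensional ℝ (TangentSpace 𝓘(ℝ, E) x) :=
  inferInstanceAs (FiniteDimensional ℝ E)

instance instFiniteDimensionalDensity (x : M) : FiniteDimensional ℝ (Density E x) :=
  inferInstanceAs (FiniteDimensional ℝ ℝ)

/-- `σ` is a smooth section of `E(1)` over `U`. -/
def SmoothDensityOn (σ : Π y : M, Density E y) (U : Set M) : Prop :=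
  ContMDiffOn 𝓘(ℝ, E) (𝓘(ℝ, E).prod 𝓘(ℝ, ℝ)) ∞ (fun y => TotalSpace.mk' ℝ y (σ y)) U

/-- The section `σ` of `E(1)` written as a function, in the trivialisation by the chart at `x`. -/
def localRep (x : M) (σ : Π y : M, Density E y) (y : M) : ℝ :=
  (trivializationAt ℝ (Density E : M → Type) x ⟨y, σ y⟩).2

variable {E}

theorem localRep_add (x : M) (σ τ : Π y : M, Density E y) {y : M} (hy : y ∈ (chartAt E x).source) :
    localRep E x (σ + τ) y = localRep E x σ y + localRep E x τ y :=
  ((trivializationAt ℝ (Density E : M → Type) x).linear ℝ hy).map_add (σ y) (τ y)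

theorem localRep_smul (x : M) (f : M → ℝ) (σ : Π y : M, Density E y) {y : M}
    (hy : y ∈ (chartAt E x).source) :
    localRep E x (f • σ) y = f y * localRep E x σ y :=
  ((trivializationAt ℝ (Density E : M → Type) x).linear ℝ hy).map_smul (f y) (σ y)

theorem localRep_self (x : M) (σ : Π y : M, Density E y) :
    densityUnit E x (localRep E x σ x) = σ x :=
  (densityCore E M).coordChange_self (achart E x) x (mem_chart_source E x) (σ x)

theorem SmoothDensityOn.mdifferentiableAt_localRep {σ : Π y : M, Density E y} {U : Set M}
    (h : SmoothDensityOn E σ U) (hU : IsOpen U) {x : M} (hx : x ∈ U) :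
    MDifferentiableAt 𝓘(ℝ, E) 𝓘(ℝ, ℝ) (localRep E x σ) x := by
  have h1 := h.contMDiffAt (hU.mem_nhds hx)
  rw [contMDiffAt_section] at h1
  exact h1.mdifferentiableAt (by simp)

set_option linter.unusedSectionVars false in
theorem mvfderiv_congr {f g : M → ℝ} {x : M} (h : f =ᶠ[𝓝 x] g) :
    mvfderiv 𝓘(ℝ, E) f x = mvfderiv 𝓘(ℝ, E) g x := by
  ext v
  exact congrArg (fun L : E →L[ℝ] ℝ => L v) h.mfderiv_eq

end Density

/-! ### The bundle of 1-jets of sections of `E(1)`, and its dual -/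

section Jets

variable (E : Type*) [NormedAddCommGroup E] [NormedSpace ℝ E] [FiniteDimensional ℝ E]
variable {M : Type*} [TopologicalSpace M] [ChartedSpace E M] [IsManifold 𝓘(ℝ, E) ∞ M]

/-- The sections of `E(1)` which are smooth on a neighbourhood of `x`. -/
def smoothNear (x : M) : Submodule ℝ (Π y : M, Density E y) where
  carrier := {σ | ∃ U, IsOpen U ∧ x ∈ U ∧ SmoothDensityOn E σ U}
  add_mem' := by
    rintro σ τ ⟨U, hU, hxU, hσ⟩ ⟨V, hV, hxV, hτ⟩
    exact ⟨U ∩ V, hU.inter hV, ⟨hxU, hxV⟩, ContMDiffOn.add_section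
      (ContMDiffOn.mono hσ Set.inter_subset_left) (ContMDiffOn.mono hτ Set.inter_subset_right)⟩
  zero_mem' := ⟨Set.univ, isOpen_univ, Set.mem_univ x,
    (contMDiff_zeroSection ℝ (Density E : M → Type)).contMDiffOn⟩
  smul_mem' := by
    rintro c σ ⟨U, hU, hxU, hσ⟩
    exact ⟨U, hU, hxU, ContMDiffOn.const_smul_section hσ⟩

theorem mdifferentiableAt_of_smoothNear {x : M} (σ : smoothNear E x) :
    MDifferentiableAt 𝓘(ℝ, E) 𝓘(ℝ, ℝ) (localRep E x σ.1) x := by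
  obtain ⟨σ, U, hU, hx, hσ⟩ := σ
  exact hσ.mdifferentiableAt_localRep hU hx

/-- The derivative at `x` and the value at `x` of a section of `E(1)`, the derivative being taken
in the trivialisation by the chart at `x`. -/
def jetCoord (x : M) :
    smoothNear E x →ₗ[ℝ] (TangentSpace 𝓘(ℝ, E) x →ₗ[ℝ] Density E x) × Density E x where
  toFun σ := ((densityUnit E x).toLinearMap ∘ₗ
    (mvfderiv 𝓘(ℝ, E) (localRep E x σ.1) x).toLinearMap, σ.1 x)
  map_add' σ τ := by
    have h : localRep E x (σ.1 + τ.1) =ᶠ[𝓝 x] localRep E x σ.1 + localRep E x τ.1 := by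
      filter_upwards [(chartAt E x).open_source.mem_nhds (mem_chart_source E x)] with y hy
      exact localRep_add x _ _ hy
    have h2 : mvfderiv 𝓘(ℝ, E) (localRep E x (σ.1 + τ.1)) x =
        mvfderiv 𝓘(ℝ, E) (localRep E x σ.1) x + mvfderiv 𝓘(ℝ, E) (localRep E x τ.1) x := by
      rw [← mvfderiv_add (mdifferentiableAt_of_smoothNear E σ)
        (mdifferentiableAt_of_smoothNear E τ)]
      exact ProjectiveTractor.mvfderiv_congr h
    refine Prod.ext ?_ rfl
    ext v
    exact congrArg (fun L => densityUnit E x (L v)) h2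
  map_smul' c σ := by
    have h : localRep E x (c • σ.1) =ᶠ[𝓝 x] fun y => c • localRep E x σ.1 y := by
      filter_upwards [(chartAt E x).open_source.mem_nhds (mem_chart_source E x)] with y hy
      exact localRep_smul x (fun _ => c) _ hy
    have h2 : mvfderiv 𝓘(ℝ, E) (localRep E x (c • σ.1)) x =
        c • mvfderiv 𝓘(ℝ, E) (localRep E x σ.1) x := by
      have h3 := mvfderiv_fun_smul (I := 𝓘(ℝ, E)) (a := fun _ : M => c)
        mdifferentiableAt_const (mdifferentiableAt_of_smoothNear E σ)
      rw [mvfderiv_const] at h3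
      rw [ProjectiveTractor.mvfderiv_congr h, h3]
      ext v
      simp
    refine Prod.ext ?_ rfl
    ext v
    exact congrArg (fun L => densityUnit E x (L v)) h2

theorem jetCoord_surjective (x : M) : Function.Surjective (jetCoord E x) := by
  rintro ⟨p, s⟩
  let p' : E →L[ℝ] ℝ := LinearMap.toContinuousLinearMap ((densityUnit E x).symm.toLinearMap ∘ₗ p)
  let a : E → ℝ := fun z => (densityUnit E x).symm s + p' (z - extChartAt 𝓘(ℝ, E) x x)
  have ha : ContDiff ℝ ∞ a :=
    contDiff_const.add (p'.contDiff.comp (contDiff_id.sub contDiff_const))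
  have hda : HasFDerivAt a p' (extChartAt 𝓘(ℝ, E) x x) := by
    have h1 : HasFDerivAt (fun z => z - extChartAt 𝓘(ℝ, E) x x) (ContinuousLinearMap.id ℝ E)
      (extChartAt 𝓘(ℝ, E) x x) := (hasFDerivAt_id _).sub_const _
    exact (p'.hasFDerivAt.comp _ h1).const_add _
  let f : M → ℝ := a ∘ extChartAt 𝓘(ℝ, E) x
  let e : Π y : M, Density E y := FiberBundle.extend ℝ (densityUnit E x 1)
  have hf : ContMDiffOn 𝓘(ℝ, E) 𝓘(ℝ, ℝ) ∞ f (chartAt E x).source :=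
    ha.contMDiff.comp_contMDiffOn contMDiffOn_extChartAt
  obtain ⟨W, hW, he⟩ :=
    FiberBundle.exists_contMDiffOn_extend (k := ∞) 𝓘(ℝ, E) ℝ (densityUnit E x 1)
  obtain ⟨U, hUW, hU, hxU⟩ := mem_nhds_iff.1 hW
  have hsm : SmoothDensityOn E (f • e) (U ∩ (chartAt E x).source) :=
    ContMDiffOn.smul_section (hf.mono Set.inter_subset_right)
      (ContMDiffOn.mono he (Set.inter_subset_left.trans hUW))
  have he1 : ∀ y ∈ (chartAt E x).source, localRep E x e y = 1 := by
    intro y hy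
    have h0 := congrArg Prod.snd
      ((trivializationAt ℝ (Density E : M → Type) x).apply_mk_symm (b := y) hy
        (trivializationAt ℝ (Density E : M → Type) x ⟨x, densityUnit E x 1⟩).2)
    have h1 : localRep E x e y =
        (trivializationAt ℝ (Density E : M → Type) x ⟨x, densityUnit E x 1⟩).2 := h0
    rw [h1]
    exact (densityCore E M).coordChange_self (achart E x) x (mem_chart_source E x) 1
  have hrep : localRep E x (f • e) =ᶠ[𝓝 x] f := by
    filter_upwards [(chartAt E x).open_source.mem_nhds (mem_chart_source E x)] with y hy
    rw [localRep_smul x f e hy, he1 y hy, mul_one]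
  have hval : (f • e) x = s := by
    rw [← localRep_self x (f • e), hrep.eq_of_nhds]
    simp [f, a]
  have hder : mvfderiv 𝓘(ℝ, E) (localRep E x (f • e)) x = p' := by
    rw [ProjectiveTractor.mvfderiv_congr hrep]
    have h1 := mfderiv_comp x (hda.hasMFDerivAt.mdifferentiableAt)
      (mdifferentiableAt_extChartAt (I := 𝓘(ℝ, E)) (mem_chart_source E x))
    rw [mfderiv_extChartAt_self, hda.hasMFDerivAt.mfderiv] at h1
    ext v
    exact congrArg (fun L : E →L[ℝ] ℝ => L v) h1
  refine ⟨⟨f • e, _, hU.inter (chartAt E x).open_source, ⟨hxU, mem_chart_source E x⟩, hsm⟩, ?_⟩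
  refine Prod.ext ?_ hval
  ext v
  have h1 := congrArg (fun L : E →L[ℝ] ℝ => densityUnit E x (L v)) hder
  exact h1.trans ((densityUnit E x).apply_symm_apply (p v))

/-- The fibre at `x` of the cotractor bundle `T* = J¹E(1)`: smooth sections of `E(1)` near `x`
modulo those whose 1-jet at `x` vanishes. -/
abbrev Cotractor (x : M) := smoothNear E x ⧸ LinearMap.ker (jetCoord E x)

/-- A 1-jet at `x` amounts to a derivative and a value, by means of the chart at `x`. -/
def jetEquiv (x : M) :
    Cotractor E x ≃ₗ[ℝ] (TangentSpace 𝓘(ℝ, E) x →ₗ[ℝ] Density E x) × Density E x :=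
  (jetCoord E x).quotKerEquivOfSurjective (jetCoord_surjective E x)

instance instFiniteDimensionalCotractor (x : M) : FiniteDimensional ℝ (Cotractor E x) :=
  (jetEquiv E x).symm.finiteDimensional

open scoped Classical in
/-- The 1-jet `j¹σ(x)` of a section `σ` of `E(1)` which is smooth near `x`. -/
def jet (σ : Π y : M, Density E y) (x : M) : Cotractor E x :=
  if h : σ ∈ smoothNear E x then Submodule.Quotient.mk ⟨σ, h⟩ else 0

/-- A local section of `E(1)`, smooth near `x`, with a given 1-jet at `x`. -/
def representative {x : M} (a : Cotractor E x) : Π y : M, Density E y :=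
  (Function.surjInv (Submodule.mkQ_surjective (LinearMap.ker (jetCoord E x))) a).1

/-- The fibre at `x` of the tractor bundle `T`, the dual of `T* = J¹E(1)`. -/
abbrev Tractor (x : M) := Module.Dual ℝ (Cotractor E x)

/-- `t` is a smooth section over `U` of the tractor bundle: its pairing with (the 1-jet of) each
smooth local section of `E(1)` is smooth. -/
def SmoothTractorOn (t : Π y : M, Tractor E y) (U : Set M) : Prop :=
  ∀ V, IsOpen V → V ⊆ U → ∀ σ : Π y : M, Density E y, SmoothDensityOn E σ V →
    ContMDiffOn 𝓘(ℝ, E) 𝓘(ℝ, ℝ) ∞ (fun y => t y (jet E σ y)) V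

end Jets

/-! ### Affine connections and projective structures -/

section Connections

variable (E : Type*) [NormedAddCommGroup E] [NormedSpace ℝ E] [FiniteDimensional ℝ E]
variable (M : Type*) [TopologicalSpace M] [ChartedSpace E M] [IsManifold 𝓘(ℝ, E) ∞ M]

/-- A smooth torsion-free affine connection on `M`. -/
structure AffineConnection where
  /-- The covariant derivative: `toCov Y x v` is `(∇_v Y)(x)`. -/
  toCov : CovariantDerivative 𝓘(ℝ, E) E (TangentSpace 𝓘(ℝ, E) : M → Type _)
  smooth : CovariantDerivative.ContMDiffCovariantDerivative toCov ∞
  torsion_eq_zero : toCov.torsion = 0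

variable {E M}

/-- `∇.D Y x v` is `(∇_v Y)(x)`. -/
def AffineConnection.D (nabla : AffineConnection E M) (Y : Π x : M, TangentSpace 𝓘(ℝ, E) x)
    (x : M) : TangentSpace 𝓘(ℝ, E) x →L[ℝ] TangentSpace 𝓘(ℝ, E) x :=
  nabla.toCov Y x

/-- The vector field `Y` is differentiable at `x`. -/
def DiffFieldAt (Y : Π x : M, TangentSpace 𝓘(ℝ, E) x) (x : M) : Prop :=
  MDifferentiableAt 𝓘(ℝ, E) (𝓘(ℝ, E).prod 𝓘(ℝ, E)) (fun y => TotalSpace.mk' E y (Y y)) x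

/-- `Y` is a smooth vector field. -/
def SmoothField (Y : Π x : M, TangentSpace 𝓘(ℝ, E) x) : Prop :=
  ContMDiff 𝓘(ℝ, E) (𝓘(ℝ, E).prod 𝓘(ℝ, E)) ∞ (fun y => TotalSpace.mk' E y (Y y))

/-- Projective equivalence of torsion-free affine connections: for a 1-form `Υ`,
`∇'_v Y = ∇_v Y + Υ(v) Y + Υ(Y) v`. -/
def ProjectivelyEquivalent (nabla nabla' : AffineConnection E M) : Prop :=
  ∃ Υ : Π x : M, TangentSpace 𝓘(ℝ, E) x →L[ℝ] ℝ,
    ContMDiff 𝓘(ℝ, E) (𝓘(ℝ, E).prod 𝓘(ℝ, E →L[ℝ] ℝ)) ∞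
      (fun x => TotalSpace.mk' (E →L[ℝ] ℝ) x (Υ x)) ∧
    ∀ (x : M) (Y : Π y : M, TangentSpace 𝓘(ℝ, E) y), DiffFieldAt Y x →
      ∀ v : TangentSpace 𝓘(ℝ, E) x,
        nabla'.D Y x v = nabla.D Y x v + Υ x v • Y x + Υ x (Y x) • v

/-- The projective structure `[∇]` induced by `∇`. -/
def projectiveClass (nabla : AffineConnection E M) : Set (AffineConnection E M) :=
  {nabla' | ProjectivelyEquivalent nabla nabla'}

/-- A vector field which extends the tangent vector `v` (smooth near its base point). -/
def extendField {x : M} (v : TangentSpace 𝓘(ℝ, E) x) : Π y : M, TangentSpace 𝓘(ℝ, E) y :=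
  FiberBundle.extend E v

variable (nabla : AffineConnection E M)

/-- The curvature, `R(u,v)w = ∇_u ∇_v w - ∇_v ∇_u w - ∇_{[u,v]} w`. -/
def curvature (x : M) (u v w : TangentSpace 𝓘(ℝ, E) x) : TangentSpace 𝓘(ℝ, E) x :=
  nabla.D (fun y => nabla.D (extendField w) y (extendField v y)) x u
    - nabla.D (fun y => nabla.D (extendField w) y (extendField u y)) x v
    - nabla.D (extendField w) x
        (VectorField.mlieBracket 𝓘(ℝ, E) (extendField u) (extendField v) x)

/-- The Ricci tensor, `Ric(v,w) = tr (u ↦ R(u,v)w)`. -/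
def ricci (x : M) : TangentSpace 𝓘(ℝ, E) x →ₗ[ℝ] TangentSpace 𝓘(ℝ, E) x →ₗ[ℝ] ℝ :=
  linearize fun v => linearize fun w =>
    LinearMap.trace ℝ (TangentSpace 𝓘(ℝ, E) x) (linearize fun u => curvature nabla x u v w)

/-- The projective Schouten tensor: for `dim M = N = n + 1`,
`P(v,w) = ((n + 1) Ric(v,w) + Ric(w,v)) / (n (n + 2))`. -/
def schouten (x : M) : TangentSpace 𝓘(ℝ, E) x →ₗ[ℝ] TangentSpace 𝓘(ℝ, E) x →ₗ[ℝ] ℝ :=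
  (1 / (((Module.finrank ℝ E : ℝ) - 1) * ((Module.finrank ℝ E : ℝ) + 1))) •
    ((Module.finrank ℝ E : ℝ) • ricci nabla x + (ricci nabla x).flip)

/-- The 1-form `v ↦ tr (u ↦ ∇_v u)`, tangent vectors `u` at `x` being extended by constants in the
chart at `x`: the trace of the connection form of `∇`. -/
def connectionTrace (x : M) : TangentSpace 𝓘(ℝ, E) x →ₗ[ℝ] ℝ :=
  LinearMap.trace ℝ (TangentSpace 𝓘(ℝ, E) x) ∘ₗ
    (linearize fun u : TangentSpace 𝓘(ℝ, E) x =>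
      (nabla.D (extendField u) x).toLinearMap).flip

/-- The connection induced by `∇` on `E(1)`. The frame of `E(1) = (Λ^N TM)^{2/(2N+2)}` given by a
frame of `TM` has connection form `1/(N+1)` times the trace of the connection form of `TM`. -/
def densityD (σ : Π y : M, Density E y) (x : M) : TangentSpace 𝓘(ℝ, E) x →ₗ[ℝ] Density E x :=
  (densityUnit E x).toLinearMap ∘ₗ (mvfderiv 𝓘(ℝ, E) (localRep E x σ) x).toLinearMap
    + (1 / ((Module.finrank ℝ E : ℝ) + 1)) • (connectionTrace nabla x).smulRight (σ x)

/-- Passing from the derivative in the chart at `x` to the covariant derivative. -/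
def shear (x : M) :
    ((TangentSpace 𝓘(ℝ, E) x →ₗ[ℝ] Density E x) × Density E x) ≃ₗ[ℝ]
      (TangentSpace 𝓘(ℝ, E) x →ₗ[ℝ] Density E x) × Density E x where
  toFun a := (a.1 +
    (1 / ((Module.finrank ℝ E : ℝ) + 1)) • (connectionTrace nabla x).smulRight a.2, a.2)
  invFun a := (a.1 -
    (1 / ((Module.finrank ℝ E : ℝ) + 1)) • (connectionTrace nabla x).smulRight a.2, a.2)
  map_add' a b := by
    refine Prod.ext ?_ rfl
    ext v
    simp [smul_add]
    abel
  map_smul' c a := by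
    refine Prod.ext ?_ rfl
    ext v
    simp only [Prod.smul_fst, Prod.smul_snd, RingHom.id_apply, LinearMap.add_apply,
      LinearMap.smul_apply, LinearMap.smulRight_apply]
    module
  left_inv a := by simp
  right_inv a := by simp

/-- The splitting `T* ≅ T*M(1) ⊕ E(1)` determined by `∇`, `j¹σ ↦ (∇σ, σ)`. Here
`T*M(1) = Hom(TM, E(1))`. -/
def splitting (x : M) :
    Cotractor E x ≃ₗ[ℝ] (TangentSpace 𝓘(ℝ, E) x →ₗ[ℝ] Density E x) × Density E x :=
  (jetEquiv E x).trans (shear nabla x)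

theorem splitting_jet {σ : Π y : M, Density E y} {x : M} (h : σ ∈ smoothNear E x) :
    splitting nabla x (jet E σ x) = (densityD nabla σ x, σ x) := by
  rw [jet, dif_pos h]
  rfl

/-- The tractor connection on sections `s = (μ, σ)` of `T*`, in the splitting determined by `∇`:
`∇^T_v (μ, σ) = (∇_v μ + P(v,·) σ, ∇_v σ - μ(v))`,
where `(∇_v μ)(u) = ∇_v (μ(u)) - μ(∇_v u)`. -/
def cotractorD (s : Π y : M, Cotractor E y) (x : M) (v : TangentSpace 𝓘(ℝ, E) x) :
    Cotractor E x :=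
  (splitting nabla x).symm
    ((linearize fun u : TangentSpace 𝓘(ℝ, E) x =>
        densityD nabla (fun y => (splitting nabla y (s y)).1 (extendField u y)) x v
          - (splitting nabla x (s x)).1 (nabla.D (extendField u) x v))
      + (schouten nabla x v).smulRight (splitting nabla x (s x)).2,
     densityD nabla (fun y => (splitting nabla y (s y)).2) x v - (splitting nabla x (s x)).1 v)

/-- The tractor connection on sections `t` of `T`, dual to that on `T*`:
`(∇^T_v t)(s) = v · (t(s)) - t(∇^T_v s)` for sections `s` of `T*`. -/
def tractorD (t : Π y : M, Tractor E y) (x : M) (v : TangentSpace 𝓘(ℝ, E) x) : Tractor E x :=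
  linearize fun a : Cotractor E x =>
    mvfderiv 𝓘(ℝ, E) (fun y => t y (jet E (representative E a) y)) x v
      - t x (cotractorD nabla (jet E (representative E a)) x v)

/-- The endomorphism of `T` with block matrix `(φ, ξ; ν, c)` in the splitting determined by `∇`.
It is written as the transpose of the endomorphism `(μ, σ) ↦ (μ ∘ φ + ν σ, μ(ξ) + c σ)` of `T*`. -/
def blockEnd (x : M) (φ : Module.End ℝ (TangentSpace 𝓘(ℝ, E) x)) (ξ : TangentSpace 𝓘(ℝ, E) x)
    (ν : Module.Dual ℝ (TangentSpace 𝓘(ℝ, E) x)) (c : ℝ) : Module.End ℝ (Tractor E x) :=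
  LinearMap.dualMap
    ((splitting nabla x).symm.toLinearMap ∘ₗ
      ({ toFun := fun a => (a.1 ∘ₗ φ + ν.smulRight a.2, a.1 ξ + c • a.2)
         map_add' := by
          intro a b
          refine Prod.ext ?_ ?_
          · ext v
            simp [smul_add]
            abel
          · simp [smul_add]
            abel
         map_smul' := by
          intro r a
          refine Prod.ext ?_ ?_
          · ext v
            simp only [Prod.smul_fst, Prod.smul_snd, RingHom.id_apply, LinearMap.add_apply,
              LinearMap.smul_apply, LinearMap.smulRight_apply, LinearMap.comp_apply]
            module
          · simp only [Prod.smul_fst, Prod.smul_snd, RingHom.id_apply, LinearMap.smul_apply]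
            module } :
        ((TangentSpace 𝓘(ℝ, E) x →ₗ[ℝ] Density E x) × Density E x) →ₗ[ℝ]
          (TangentSpace 𝓘(ℝ, E) x →ₗ[ℝ] Density E x) × Density E x) ∘ₗ
      (splitting nabla x).toLinearMap)

/-- The divergence `∇_c ξ^c`. -/
def divergence (ξ : Π y : M, TangentSpace 𝓘(ℝ, E) y) (x : M) : ℝ :=
  LinearMap.trace ℝ (TangentSpace 𝓘(ℝ, E) x) (nabla.D ξ x).toLinearMap

/-- The splitting operator `L^A` from vector fields to sections of the adjoint tractor bundle: for
`dim M = N = n + 1`, in the splitting determined by `∇`, the matrix of `L^A(ξ)` has the blocks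
`φ = ∇ξ - (1/(n+2)) (div ξ) id`, `ξ`, `ν(v) = - (1/(n+2)) v · (div ξ) - P(v, ξ)`,
`c = - (1/(n+2)) div ξ`. -/
def splittingOperator (ξ : Π y : M, TangentSpace 𝓘(ℝ, E) y) (x : M) :
    Module.End ℝ (Tractor E x) :=
  blockEnd nabla x
    ((nabla.D ξ x).toLinearMap
      - ((1 / ((Module.finrank ℝ E : ℝ) + 1)) * divergence nabla ξ x) • LinearMap.id)
    (ξ x)
    (-((1 / ((Module.finrank ℝ E : ℝ) + 1)) •
        (mvfderiv 𝓘(ℝ, E) (divergence nabla ξ) x).toLinearMap)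
      - (schouten nabla x).flip (ξ x))
    (-((1 / ((Module.finrank ℝ E : ℝ) + 1)) * divergence nabla ξ x))

/-! ### Parallel tensors on the tractor bundle -/

/-- `h` is a smooth section of `S²T*`, pointwise an inner product of signature `(r, s)`, which is
parallel for the tractor connection of the projective structure `pc`, that is, for the tractor
connection computed from any connection of `pc`. -/
structure IsParallelTractorMetric (pc : Set (AffineConnection E M))
    (h : Π x : M, LinearMap.BilinForm ℝ (Tractor E x)) (r s : ℕ) : Prop where
  innerProduct : ∀ x, IsInnerProduct (h x) r s
  smooth : ∀ U, IsOpen U → ∀ t t' : Π y : M, Tractor E y,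
    SmoothTractorOn E t U → SmoothTractorOn E t' U →
      ContMDiffOn 𝓘(ℝ, E) 𝓘(ℝ, ℝ) ∞ (fun y => h y (t y) (t' y)) U
  parallel : ∀ nabla ∈ pc, ∀ U, IsOpen U → ∀ t t' : Π y : M, Tractor E y,
    SmoothTractorOn E t U → SmoothTractorOn E t' U → ∀ x ∈ U, ∀ v : TangentSpace 𝓘(ℝ, E) x,
      mvfderiv 𝓘(ℝ, E) (fun y => h y (t y) (t' y)) x v =
        h x (tractorD nabla t x v) (t' x) + h x (t x) (tractorD nabla t' x v)

/-- `J` is a smooth section of `End T` with `J² = -id` which is parallel for the tractor connection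
of the projective structure `pc`. -/
structure IsParallelTractorComplexStructure (pc : Set (AffineConnection E M))
    (J : Π x : M, Module.End ℝ (Tractor E x)) : Prop where
  sq : ∀ x, J x * J x = -1
  smooth : ∀ U, IsOpen U → ∀ t : Π y : M, Tractor E y,
    SmoothTractorOn E t U → SmoothTractorOn E (fun y => J y (t y)) U
  parallel : ∀ nabla ∈ pc, ∀ U, IsOpen U → ∀ t : Π y : M, Tractor E y,
    SmoothTractorOn E t U → ∀ x ∈ U, ∀ v : TangentSpace 𝓘(ℝ, E) x,
      tractorD nabla (fun y => J y (t y)) x v = J x (tractorD nabla t x v)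

/-- `h` is Hermitian with respect to `J`. -/
def IsHermitian (h : Π x : M, LinearMap.BilinForm ℝ (Tractor E x))
    (J : Π x : M, Module.End ℝ (Tractor E x)) : Prop :=
  ∀ x t t', h x (J x t) (J x t') = h x t t'

end Connections

/-! ### 3-Sasaki structures -/

section Sasaki

variable (E : Type*) [NormedAddCommGroup E] [NormedSpace ℝ E] [FiniteDimensional ℝ E]
variable (M : Type*) [TopologicalSpace M] [ChartedSpace E M] [IsManifold 𝓘(ℝ, E) ∞ M]

/-- A smooth pseudo-Riemannian metric of signature `(r, s)`. -/
structure PseudoRiemannianMetric (r s : ℕ) where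
  /-- The inner product on the tangent space at `x`. -/
  inner (x : M) : TangentSpace 𝓘(ℝ, E) x →L[ℝ] TangentSpace 𝓘(ℝ, E) x →L[ℝ] ℝ
  contMDiff : ContMDiff 𝓘(ℝ, E) (𝓘(ℝ, E).prod 𝓘(ℝ, E →L[ℝ] E →L[ℝ] ℝ)) ∞
    (fun x => TotalSpace.mk' (E →L[ℝ] E →L[ℝ] ℝ) x (inner x))
  innerProduct (x : M) : IsInnerProduct
    (LinearMap.mk₂ ℝ (fun v w => inner x v w) (by simp) (by simp) (by simp) (by simp) :
      LinearMap.BilinForm ℝ (TangentSpace 𝓘(ℝ, E) x)) r s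

variable {E M} {r s : ℕ} (g : PseudoRiemannianMetric E M r s) (nabla : AffineConnection E M)

/-- The torsion-free connection `∇` is the Levi-Civita connection of `g`: `∇g = 0`. -/
def IsLeviCivita : Prop :=
  ∀ (x : M) (Y Z : Π y : M, TangentSpace 𝓘(ℝ, E) y), DiffFieldAt Y x → DiffFieldAt Z x →
    ∀ v : TangentSpace 𝓘(ℝ, E) x,
      mvfderiv 𝓘(ℝ, E) (fun y => g.inner y (Y y) (Z y)) x v =
        g.inner x (nabla.D Y x v) (Z x) + g.inner x (Y x) (nabla.D Z x v)

/-- `ξ` is a Killing field of `g`: `ξ` is smooth and the Lie derivative of `g` along `ξ` is `0`. -/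
structure IsKilling (ξ : Π y : M, TangentSpace 𝓘(ℝ, E) y) : Prop where
  smooth : SmoothField ξ
  lieDerivative_eq_zero : ∀ (x : M) (Y Z : Π y : M, TangentSpace 𝓘(ℝ, E) y),
    DiffFieldAt Y x → DiffFieldAt Z x →
      mvfderiv 𝓘(ℝ, E) (fun y => g.inner y (Y y) (Z y)) x (ξ x) =
        g.inner x (VectorField.mlieBracket 𝓘(ℝ, E) ξ Y x) (Z x)
          + g.inner x (Y x) (VectorField.mlieBracket 𝓘(ℝ, E) ξ Z x)

/-- `(g, k)` is a Sasaki structure, `∇` being the Levi-Civita connection of `g`: `k` is a Killing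
field with `g(k,k) = 1` and `∇_a ∇_b k^c = - g_{ab} k^c + δ^c_a k_b`. The second covariant
derivative is `(∇²k)(v,Y) = ∇_v (∇_Y k) - ∇_{∇_v Y} k`. -/
structure IsSasaki (k : Π y : M, TangentSpace 𝓘(ℝ, E) y) : Prop extends IsKilling g k where
  unit : ∀ x, g.inner x (k x) (k x) = 1
  second_derivative : ∀ (x : M) (Y : Π y : M, TangentSpace 𝓘(ℝ, E) y), DiffFieldAt Y x →
    ∀ v : TangentSpace 𝓘(ℝ, E) x,
      nabla.D (fun y => nabla.D k y (Y y)) x v - nabla.D k x (nabla.D Y x v) =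
        -(g.inner x v (Y x)) • k x + g.inner x (k x) (Y x) • v

/-- `(g, (i, j, k))` is a 3-Sasaki structure, `∇` being the Levi-Civita connection of `g`. -/
structure IsThreeSasaki (i j k : Π y : M, TangentSpace 𝓘(ℝ, E) y) : Prop where
  leviCivita : IsLeviCivita g nabla
  sasaki_i : IsSasaki g nabla i
  sasaki_j : IsSasaki g nabla j
  sasaki_k : IsSasaki g nabla k
  orthogonal_ij : ∀ x, g.inner x (i x) (j x) = 0
  orthogonal_jk : ∀ x, g.inner x (j x) (k x) = 0
  orthogonal_ki : ∀ x, g.inner x (k x) (i x) = 0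
  bracket_ij : ∀ x, VectorField.mlieBracket 𝓘(ℝ, E) i j x = -(2 : ℝ) • k x
  bracket_jk : ∀ x, VectorField.mlieBracket 𝓘(ℝ, E) j k x = -(2 : ℝ) • i x
  bracket_ki : ∀ x, VectorField.mlieBracket 𝓘(ℝ, E) k i x = -(2 : ℝ) • j x

end Sasaki

end ProjectiveTractor

end

open ProjectiveTractor

/-! The tractor data of a 3-Sasaki manifold are those of its metric cone, which is hyperkähler. The
proof writes this out on $M$, where the cone is the bundle $TM\oplus\mathbb R$, without constructing
the cone.

The density $|\det g|^{-1/(2N+2)}$, $N=\dim M$, is parallel for the Levi-Civita connection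
(`densityD_metricDensity`). Trivialising $\mathcal E(1)$ by it turns tractors into pairs $(X,\rho)$;
such a pair acts on the 1-jet of $f$ times the density as $Xf+\rho f$ (`pairTractor_jet`). The
tractor connection becomes $\nabla_v(X,\rho)=(\nabla_vX+\rho v,\;d\rho(v)-P(v,X))$
(`tractorD_pairTractor`). When $P=g$ this is the Levi-Civita connection of the cone along $M$, and
$h=g\oplus1$ is parallel because the two cross terms cancel.

That $P=g$ is the Einstein equation $\mathrm{Ric}=(N-1)g$ (`IsThreeSasaki.ricci_eq`), the
counterpart of the Ricci-flatness of a hyperkähler metric. Let $W$ be the curvature minus that of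
constant curvature 1. The Sasaki equation makes $W$ kill $i,j,k$ (`IsSasaki.curvature_apply`) and
commute with $\nabla i,\nabla j,\nabla k$ (`IsSasaki.curvature_D`). These satisfy the quaternion
relations up to multiples of $i,j,k$ (`IsThreeSasaki.D_i_D_j`). Skew traces and the Bianchi identity
then force the Ricci trace of $W$ to vanish (`trace_curvature_eq_zero`).

For a Sasaki field, $L^{\mathcal A}(\xi)(X,\rho)=(\nabla_X\xi+\rho\xi,\,-g(\xi,X))$. That it is
parallel is the Sasaki equation together with the skewness of $\nabla\xi$; that it squares to
$-\mathrm{id}$ and is Hermitian follows from $(\nabla\xi)^2=-\mathrm{id}+\xi^\flat\otimes\xi$,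
$\nabla_\xi\xi=0$ and $g(\xi,\xi)=1$. The quaternion relations give $\mathbb I\mathbb J=\mathbb K$.

Since parallelism and $L^{\mathcal A}$ are demanded for every connection in $[\nabla]$, the effect
of $\Upsilon$ on $P$, on densities and on the splitting is computed, and all terms in $\Upsilon$
cancel. -/

noncomputable section

namespace ProjectiveTractor

/-! ### Germs of smooth fields and functions, and Lie brackets. -/

section Smoothness

set_option linter.unusedSectionVars false

variable {E : Type*} [NormedAddCommGroup E] [NormedSpace ℝ E] [FiniteDimensional ℝ E]
variable {M : Type*} [TopologicalSpace M] [ChartedSpace E M] [IsManifold 𝓘(ℝ, E) ∞ M]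

/-- `Y` is smooth on a neighbourhood of `x`. -/
def SmoothFieldNear (Y : Π y : M, TangentSpace 𝓘(ℝ, E) y) (x : M) : Prop :=
  ∀ᶠ z in 𝓝 x, ContMDiffAt 𝓘(ℝ, E) (𝓘(ℝ, E).prod 𝓘(ℝ, E)) ∞ (fun y => TotalSpace.mk' E y (Y y)) z

variable (E) in
/-- `f` is smooth on a neighbourhood of `x`. -/
def SmoothFunNear (f : M → ℝ) (x : M) : Prop :=
  ∀ᶠ z in 𝓝 x, ContMDiffAt 𝓘(ℝ, E) 𝓘(ℝ, ℝ) ∞ f z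

instance isManifold_succ : IsManifold 𝓘(ℝ, E) (∞ + 1) M :=
  inferInstanceAs (IsManifold 𝓘(ℝ, E) ∞ M)

instance isManifold_minSmoothness_two : IsManifold 𝓘(ℝ, E) (minSmoothness ℝ 2) M := by
  rw [minSmoothness_of_isRCLikeNormedField]
  exact IsManifold.of_le (n := ∞) (WithTop.coe_le_coe.2 le_top)

instance isManifold_minSmoothness_three : IsManifold 𝓘(ℝ, E) (minSmoothness ℝ 3) M := by
  rw [minSmoothness_of_isRCLikeNormedField]
  exact IsManifold.of_le (n := ∞) (WithTop.coe_le_coe.2 le_top)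

variable {x : M} {Y Z : Π y : M, TangentSpace 𝓘(ℝ, E) y} {f h : M → ℝ}

theorem SmoothFieldNear.contMDiffAt (hY : SmoothFieldNear Y x) :
    ContMDiffAt 𝓘(ℝ, E) (𝓘(ℝ, E).prod 𝓘(ℝ, E)) ∞ (fun y => TotalSpace.mk' E y (Y y)) x :=
  hY.self_of_nhds

theorem SmoothFunNear.contMDiffAt (hf : SmoothFunNear E f x) :
    ContMDiffAt 𝓘(ℝ, E) 𝓘(ℝ, ℝ) ∞ f x :=
  hf.self_of_nhds

theorem SmoothFieldNear.eventually (hY : SmoothFieldNear Y x) :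
    ∀ᶠ y in 𝓝 x, SmoothFieldNear Y y :=
  eventually_eventually_nhds.2 hY

theorem SmoothFunNear.eventually (hf : SmoothFunNear E f x) :
    ∀ᶠ y in 𝓝 x, SmoothFunNear E f y :=
  eventually_eventually_nhds.2 hf

theorem SmoothFieldNear.diff (hY : SmoothFieldNear Y x) : DiffFieldAt Y x :=
  hY.contMDiffAt.mdifferentiableAt (by simp)

theorem SmoothFunNear.diff (hf : SmoothFunNear E f x) :
    MDifferentiableAt 𝓘(ℝ, E) 𝓘(ℝ, ℝ) f x :=
  hf.contMDiffAt.mdifferentiableAt (by simp)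

theorem SmoothFunNear.congr (hf : SmoothFunNear E f x) (hh : h =ᶠ[𝓝 x] f) :
    SmoothFunNear E h x := by
  filter_upwards [hf, hh.eventuallyEq_nhds] with y hy hy'
  exact hy.congr_of_eventuallyEq hy'

theorem SmoothField.near (hY : SmoothField Y) (x : M) : SmoothFieldNear Y x :=
  Filter.Eventually.of_forall fun y => hY y

theorem SmoothFieldNear.add (hY : SmoothFieldNear Y x) (hZ : SmoothFieldNear Z x) :
    SmoothFieldNear (Y + Z) x := by
  filter_upwards [hY, hZ] with y h1 h2 using h1.add_section h2

theorem SmoothFunNear.smul_field (hf : SmoothFunNear E f x) (hY : SmoothFieldNear Y x) :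
    SmoothFieldNear (f • Y) x := by
  filter_upwards [hf, hY] with y h1 h2 using h1.smul_section h2

theorem SmoothFieldNear.const_smul (c : ℝ) (hY : SmoothFieldNear Y x) :
    SmoothFieldNear (c • Y) x := by
  filter_upwards [hY] with y h2 using h2.const_smul_section

theorem SmoothFieldNear.sum {ι : Type*} {s : Finset ι} {t : ι → Π y : M, TangentSpace 𝓘(ℝ, E) y}
    (h : ∀ i ∈ s, SmoothFieldNear (t i) x) : SmoothFieldNear (fun y => ∑ i ∈ s, t i y) x := by
  filter_upwards [(Filter.eventually_all_finset s).2 h] with y hy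
  exact ContMDiffAt.sum_section hy

theorem SmoothFunNear.add (hf : SmoothFunNear E f x) (hh : SmoothFunNear E h x) :
    SmoothFunNear E (f + h) x := by
  filter_upwards [hf, hh] with y h1 h2 using h1.add h2

theorem SmoothFunNear.mul (hf : SmoothFunNear E f x) (hh : SmoothFunNear E h x) :
    SmoothFunNear E (f * h) x := by
  filter_upwards [hf, hh] with y h1 h2 using h1.mul h2

variable (E) in
theorem smoothFunNear_const (c : ℝ) (x : M) : SmoothFunNear E (fun _ => c) x :=
  Filter.Eventually.of_forall fun _ => contMDiffAt_const

theorem SmoothFieldNear.mlieBracket (hY : SmoothFieldNear Y x)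
    (hZ : SmoothFieldNear Z x) :
    SmoothFieldNear (VectorField.mlieBracket 𝓘(ℝ, E) Y Z) x := by
  have : CompleteSpace E := FiniteDimensional.complete ℝ E
  filter_upwards [hY, hZ] with y h1 h2
  have : IsManifold 𝓘(ℝ, E) (((⊤ : ℕ∞) : ℕ∞ω) + 1) M := isManifold_succ
  refine ContMDiffAt.mlieBracket_vectorField (m := ⊤) (n := ⊤) h1 h2 ?_
  rw [minSmoothness_of_isRCLikeNormedField]
  rfl

/-- The derivative of a smooth function along a smooth vector field is smooth. -/
theorem SmoothFunNear.mvfderiv_apply (hf : SmoothFunNear E f x) (hY : SmoothFieldNear Y x) :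
    SmoothFunNear E (fun y => mvfderiv 𝓘(ℝ, E) f y (Y y)) x := by
  filter_upwards [hf, hY] with y h1 h2
  have h3 := h1.mfderiv_const (m := ∞) (by rfl)
  have h4 := ContMDiffAt.clm_apply_of_inCoordinates (F₁ := E) (F₂ := ℝ)
    (E₁ := (TangentSpace 𝓘(ℝ, E) : M → Type _)) (E₂ := (TangentSpace 𝓘(ℝ, ℝ) : ℝ → Type _))
    (b₁ := id) (b₂ := f) (ϕ := fun y => mfderiv 𝓘(ℝ, E) 𝓘(ℝ, ℝ) f y) (v := Y) h3 h2 h1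
  exact (contMDiff_snd_tangentBundle_modelSpace ℝ 𝓘(ℝ, ℝ)).contMDiffAt.comp y h4

theorem smoothFieldNear_extendField (v : TangentSpace 𝓘(ℝ, E) x) :
    SmoothFieldNear (extendField v) x := by
  obtain ⟨s, hs, h⟩ := FiberBundle.exists_contMDiffOn_extend (k := ∞) 𝓘(ℝ, E) E v
  filter_upwards [eventually_mem_nhds_iff.2 hs] with y hy
  exact h.contMDiffAt hy

@[simp]
theorem extendField_self (v : TangentSpace 𝓘(ℝ, E) x) : extendField v x = v :=
  FiberBundle.extend_apply_self E v

/-- A smooth local vector field agrees near the point with a global one. -/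
theorem SmoothFieldNear.exists_smoothField [T2Space M] (hY : SmoothFieldNear Y x) :
    ∃ Y', SmoothField Y' ∧ Y' =ᶠ[𝓝 x] Y := by
  obtain ⟨U, hU, hUo, hxU⟩ := eventually_nhds_iff.1 hY
  obtain ⟨ψ, hψ, hψU⟩ := (SmoothBumpFunction.nhds_basis_tsupport (I := 𝓘(ℝ, E)) x).mem_iff.1
    (hUo.mem_nhds hxU)
  refine ⟨(ψ : M → ℝ) • Y, ?_, ?_⟩
  · exact ContMDiffOn.smul_section_of_tsupport ψ.contMDiff.contMDiffOn hUo hψU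
      fun y hy => (hU y hy).contMDiffWithinAt
  · filter_upwards [ψ.eventuallyEq_one] with y hy
    rw [Pi.smul_apply', hy, Pi.one_apply, one_smul]

theorem jacobi_mlieBracket {U V W : Π y : M, TangentSpace 𝓘(ℝ, E) y} (hU : SmoothFieldNear U x)
    (hV : SmoothFieldNear V x) (hW : SmoothFieldNear W x) :
    VectorField.mlieBracket 𝓘(ℝ, E) U (VectorField.mlieBracket 𝓘(ℝ, E) V W) x =
      VectorField.mlieBracket 𝓘(ℝ, E) (VectorField.mlieBracket 𝓘(ℝ, E) U V) W x
        + VectorField.mlieBracket 𝓘(ℝ, E) V (VectorField.mlieBracket 𝓘(ℝ, E) U W) x := by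
  have : CompleteSpace E := FiniteDimensional.complete ℝ E
  have two : minSmoothness ℝ 2 ≤ ∞ := by
    rw [minSmoothness_of_isRCLikeNormedField]
    exact WithTop.coe_le_coe.2 le_top
  exact VectorField.leibniz_identity_mlieBracket_apply (hU.contMDiffAt.of_le two)
    (hV.contMDiffAt.of_le two) (hW.contMDiffAt.of_le two)

/-- Vector fields acting on functions: `[U, V] f = U (V f) - V (U f)`. -/
theorem mvfderiv_mlieBracket {U V : Π y : M, TangentSpace 𝓘(ℝ, E) y} (hU : SmoothFieldNear U x)
    (hV : SmoothFieldNear V x) (hf : SmoothFunNear E f x) :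
    mvfderiv 𝓘(ℝ, E) f x (VectorField.mlieBracket 𝓘(ℝ, E) U V x) =
      mvfderiv 𝓘(ℝ, E) (fun y => mvfderiv 𝓘(ℝ, E) f y (V y)) x (U x)
        - mvfderiv 𝓘(ℝ, E) (fun y => mvfderiv 𝓘(ℝ, E) f y (U y)) x (V x) := by
  have : CompleteSpace E := FiniteDimensional.complete ℝ E
  -- The argument below needs a field that does not vanish at the point, so dimension zero is
  -- separate.
  rcases subsingleton_or_nontrivial E with hE | hE
  · have h0 : ∀ w : TangentSpace 𝓘(ℝ, E) x, w = 0 := fun w => hE.elim w 0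
    rw [h0 (VectorField.mlieBracket 𝓘(ℝ, E) U V x), h0 (V x), h0 (U x)]
    simp
  obtain ⟨w, hw⟩ := exists_ne (0 : E)
  let W : Π y : M, TangentSpace 𝓘(ℝ, E) y := extendField (x := x) w
  have hW : SmoothFieldNear W x := smoothFieldNear_extendField (x := x) w
  have hWx : W x = w := extendField_self (x := x) w
  -- The Jacobi identity for `f • W` and for `W` are compared. After the Leibniz rule only the
  -- multiple of `W` by $U(Vf)-V(Uf)-[U,V]f$ survives, and `W` is nonzero at `x`.
  have J1 := jacobi_mlieBracket hU hV (hf.smul_field hW)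
  have J2 := jacobi_mlieBracket hU hV hW
  have key : ∀ A : Π y : M, TangentSpace 𝓘(ℝ, E) y,
      VectorField.mlieBracket 𝓘(ℝ, E) A (f • W) =ᶠ[𝓝 x]
        (fun y => mvfderiv 𝓘(ℝ, E) f y (A y)) • W + f • VectorField.mlieBracket 𝓘(ℝ, E) A W := by
    intro A
    filter_upwards [hf.eventually, hW.eventually] with y h1 h2
    exact VectorField.mlieBracket_smul_right h1.diff h2.diff
  have key2 : ∀ A B : Π y : M, TangentSpace 𝓘(ℝ, E) y, SmoothFieldNear A x → SmoothFieldNear B x →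
      VectorField.mlieBracket 𝓘(ℝ, E) B (VectorField.mlieBracket 𝓘(ℝ, E) A (f • W)) x =
        mvfderiv 𝓘(ℝ, E) (fun y => mvfderiv 𝓘(ℝ, E) f y (A y)) x (B x) • W x
        + mvfderiv 𝓘(ℝ, E) f x (A x) • VectorField.mlieBracket 𝓘(ℝ, E) B W x
        + (mvfderiv 𝓘(ℝ, E) f x (B x) • VectorField.mlieBracket 𝓘(ℝ, E) A W x
        + f x • VectorField.mlieBracket 𝓘(ℝ, E) B (VectorField.mlieBracket 𝓘(ℝ, E) A W) x) := by
    intro A B hA hB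
    rw [Filter.EventuallyEq.mlieBracket_vectorField_eq (Filter.EventuallyEq.refl _ B) (key A),
      VectorField.mlieBracket_add_right ((hf.mvfderiv_apply hA).smul_field hW).diff
        (hf.smul_field (hA.mlieBracket hW)).diff,
      VectorField.mlieBracket_smul_right (hf.mvfderiv_apply hA).diff hW.diff,
      VectorField.mlieBracket_smul_right hf.diff (hA.mlieBracket hW).diff]
  rw [key2 V U hV hU, key2 U V hU hV, VectorField.mlieBracket_smul_right hf.diff hW.diff, J2] at J1
  have J3 : (mvfderiv 𝓘(ℝ, E) (fun y => mvfderiv 𝓘(ℝ, E) f y (V y)) x (U x)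
        - mvfderiv 𝓘(ℝ, E) (fun y => mvfderiv 𝓘(ℝ, E) f y (U y)) x (V x)
        - mvfderiv 𝓘(ℝ, E) f x (VectorField.mlieBracket 𝓘(ℝ, E) U V x)) • W x = 0 := by
    linear_combination (norm := module) J1
  rw [hWx] at J3
  have J4 := (smul_eq_zero.1 J3).resolve_right hw
  linarith

end Smoothness

/-! ### Operations linear over smooth functions depend only on values at the point. -/

section Tensorial

set_option linter.unusedSectionVars false

variable {E : Type*} [NormedAddCommGroup E] [NormedSpace ℝ E] [FiniteDimensional ℝ E]
variable {M : Type*} [TopologicalSpace M] [ChartedSpace E M] [IsManifold 𝓘(ℝ, E) ∞ M]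
variable {x : M} {A : Type*} [AddCommGroup A] [Module ℝ A]

/-- An operation on vector fields smooth near `x` which is local and linear over functions smooth
near `x`. -/
structure SmoothTensorialAt (Φ : (Π y : M, TangentSpace 𝓘(ℝ, E) y) → A) (x : M) : Prop where
  add : ∀ Y Z, SmoothFieldNear Y x → SmoothFieldNear Z x → Φ (Y + Z) = Φ Y + Φ Z
  smul : ∀ (f : M → ℝ) (Y), SmoothFunNear E f x → SmoothFieldNear Y x → Φ (f • Y) = f x • Φ Y
  congr : ∀ Y Z, SmoothFieldNear Y x → SmoothFieldNear Z x → Y =ᶠ[𝓝 x] Z → Φ Y = Φ Z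

namespace SmoothTensorialAt

variable {Φ : (Π y : M, TangentSpace 𝓘(ℝ, E) y) → A}

theorem zero (hΦ : SmoothTensorialAt Φ x) : Φ 0 = 0 := by
  have h0 : SmoothFieldNear (0 : Π y : M, TangentSpace 𝓘(ℝ, E) y) x :=
    Filter.Eventually.of_forall fun y => contMDiff_zeroSection ℝ (TangentSpace 𝓘(ℝ, E)) y
  have := hΦ.smul (fun _ => 0) 0 (smoothFunNear_const E 0 x) h0
  rw [zero_smul] at this
  rw [← this]
  congr 1
  funext y
  exact (smul_zero _).symm

theorem sum (hΦ : SmoothTensorialAt Φ x)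
    {ι : Type*} (s : Finset ι) (t : ι → Π y : M, TangentSpace 𝓘(ℝ, E) y)
    (h : ∀ i ∈ s, SmoothFieldNear (t i) x) : Φ (fun y => ∑ i ∈ s, t i y) = ∑ i ∈ s, Φ (t i) := by
  classical
  induction s using Finset.induction_on with
  | empty => exact hΦ.zero
  | insert i s hi ih =>
    have h1 : (fun y => ∑ i ∈ insert i s, t i y) = t i + fun y => ∑ i ∈ s, t i y := by
      funext y
      exact Finset.sum_insert hi
    rw [h1, hΦ.add _ _ (h i (s.mem_insert_self i))
      (SmoothFieldNear.sum fun j hj => h j (Finset.mem_insert_of_mem hj)), Finset.sum_insert hi,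
      ih fun j hj => h j (Finset.mem_insert_of_mem hj)]

/-- A tensorial operation depends only on the value of the field. -/
theorem eq_of_eq (hΦ : SmoothTensorialAt Φ x)
    {Y Z : Π y : M, TangentSpace 𝓘(ℝ, E) y} (hY : SmoothFieldNear Y x)
    (hZ : SmoothFieldNear Z x) (h : Y x = Z x) : Φ Y = Φ Z := by
  let e := trivializationAt E (TangentSpace 𝓘(ℝ, E) : M → Type _) x
  have hx : x ∈ e.baseSet := FiberBundle.mem_baseSet_trivializationAt' x
  let b := Module.finBasis ℝ E
  have hfr : ∀ i, SmoothFieldNear (e.localFrame b i) x := fun i => by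
    filter_upwards [e.open_baseSet.mem_nhds hx] with y hy
    exact contMDiffAt_localFrame_of_mem ∞ e b i hy
  -- In a local frame the operation passes through the smooth coefficients, so only their values at
  -- `x` count.
  have key : ∀ Y : Π y : M, TangentSpace 𝓘(ℝ, E) y, SmoothFieldNear Y x →
      Φ Y = ∑ i, e.localFrameCoeff 𝓘(ℝ, E) b i x (Y x) • Φ (e.localFrame b i) := by
    intro Y hY
    have hco : ∀ i, SmoothFunNear E (fun y => e.localFrameCoeff 𝓘(ℝ, E) b i y (Y y)) x := by
      intro i
      filter_upwards [hY, e.open_baseSet.mem_nhds hx] with y hy hy'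
      exact contMDiffAt_localFrameCoeff b hy' hy i
    have hterm : ∀ i ∈ Finset.univ, SmoothFieldNear
        ((fun y => e.localFrameCoeff 𝓘(ℝ, E) b i y (Y y)) • e.localFrame b i) x :=
      fun i _ => (hco i).smul_field (hfr i)
    rw [hΦ.congr Y _ hY (SmoothFieldNear.sum hterm)
      (e.eventually_eq_localFrame_sum_coeff_smul b hx), hΦ.sum _ _ hterm]
    exact Finset.sum_congr rfl fun i _ => hΦ.smul _ _ (hco i) (hfr i)
  rw [key Y hY, key Z hZ, h]

/-- The linear map on the tangent space given by a tensorial operation. -/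
def hom (hΦ : SmoothTensorialAt Φ x) : TangentSpace 𝓘(ℝ, E) x →ₗ[ℝ] A where
  toFun v := Φ (extendField v)
  map_add' v w := by
    rw [← hΦ.add _ _ (smoothFieldNear_extendField v) (smoothFieldNear_extendField w)]
    exact hΦ.eq_of_eq (smoothFieldNear_extendField _)
      ((smoothFieldNear_extendField v).add (smoothFieldNear_extendField w)) (by simp)
  map_smul' c v := by
    rw [RingHom.id_apply, ← hΦ.smul (fun _ => c) _ (smoothFunNear_const E c x)
      (smoothFieldNear_extendField v)]
    exact hΦ.eq_of_eq (smoothFieldNear_extendField _)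
      ((smoothFunNear_const E c x).smul_field (smoothFieldNear_extendField v)) (by simp)

theorem hom_apply (hΦ : SmoothTensorialAt Φ x)
    {Y : Π y : M, TangentSpace 𝓘(ℝ, E) y} (hY : SmoothFieldNear Y x) :
    hΦ.hom (Y x) = Φ Y :=
  hΦ.eq_of_eq (smoothFieldNear_extendField _) hY (extendField_self _)

end SmoothTensorialAt

end Tensorial

/-! ### Covariant derivatives, curvature and the Ricci tensor. -/

section Calculus

set_option linter.unusedSectionVars false

variable {E : Type*} [NormedAddCommGroup E] [NormedSpace ℝ E] [FiniteDimensional ℝ E]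
variable {M : Type*} [TopologicalSpace M] [ChartedSpace E M] [IsManifold 𝓘(ℝ, E) ∞ M]
variable (nabla : AffineConnection E M)
variable {x : M} {Y Z W : Π y : M, TangentSpace 𝓘(ℝ, E) y} {f : M → ℝ}

namespace AffineConnection

theorem D_add (hY : DiffFieldAt Y x) (hZ : DiffFieldAt Z x) :
    nabla.D (Y + Z) x = nabla.D Y x + nabla.D Z x :=
  nabla.toCov.isCovariantDerivativeOnUniv.add hY hZ

theorem D_smul (hf : MDifferentiableAt 𝓘(ℝ, E) 𝓘(ℝ, ℝ) f x) (hY : DiffFieldAt Y x)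
    (v : TangentSpace 𝓘(ℝ, E) x) :
    nabla.D (f • Y) x v = f x • nabla.D Y x v + mvfderiv 𝓘(ℝ, E) f x v • Y x :=
  congrArg (fun L : TangentSpace 𝓘(ℝ, E) x →L[ℝ] TangentSpace 𝓘(ℝ, E) x => L v)
    (nabla.toCov.isCovariantDerivativeOnUniv.leibniz hY hf)

theorem D_const_smul (c : ℝ) (hY : DiffFieldAt Y x) :
    nabla.D (c • Y) x = c • nabla.D Y x :=
  nabla.toCov.isCovariantDerivativeOnUniv.smul_const c hY

theorem D_congr (hY : DiffFieldAt Y x) (hZ : DiffFieldAt Z x) (h : Y =ᶠ[𝓝 x] Z) :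
    nabla.D Y x = nabla.D Z x :=
  nabla.toCov.isCovariantDerivativeOnUniv.congr_of_eventuallyEq hY hZ Filter.univ_mem h

/-- Smoothness of the connection is applied to global fields, so the local field is first replaced
by a global one that agrees with it near the point; the bump function for this uses the Hausdorff
property. -/
theorem D_smooth [T2Space M] (hY : SmoothFieldNear Y x) (hZ : SmoothFieldNear Z x) :
    SmoothFieldNear (fun y => nabla.D Y y (Z y)) x := by
  filter_upwards [hY.eventually, hZ] with y h1 h2
  obtain ⟨Y', hY', hYY'⟩ := h1.exists_smoothField
  have h3 := nabla.smooth.contMDiff.contMDiff (σ := Y') hY'.contMDiffOn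
  have h4 := (contMDiffOn_univ.1 h3).contMDiffAt (x := y)
  refine (h4.clm_bundle_apply h2).congr_of_eventuallyEq ?_
  filter_upwards [h1.eventually, hYY'.eventuallyEq_nhds] with z h5 h6
  have h7 := nabla.D_congr (hY'.near z).diff h5.diff h6
  change TotalSpace.mk' E z (nabla.D Y z (Z z)) = TotalSpace.mk' E z (nabla.D Y' z (Z z))
  rw [h7]

theorem torsion_free (hY : DiffFieldAt Y x) (hZ : DiffFieldAt Z x) :
    VectorField.mlieBracket 𝓘(ℝ, E) Y Z x = nabla.D Z x (Y x) - nabla.D Y x (Z x) :=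
  ((CovariantDerivative.torsion_eq_zero_iff _).1 nabla.torsion_eq_zero hY hZ).symm

end AffineConnection

/-- The 1-form `Υ` takes vector fields smooth near `x` to functions smooth near `x`. -/
def SmoothFormNear (Υ : Π y : M, TangentSpace 𝓘(ℝ, E) y →L[ℝ] ℝ) (x : M) : Prop :=
  ∀ V : Π y : M, TangentSpace 𝓘(ℝ, E) y, SmoothFieldNear V x →
    SmoothFunNear E (fun y => Υ y (V y)) x

theorem SmoothFunNear.smoothFormNear (hf : SmoothFunNear E f x) :
    SmoothFormNear (fun y => mvfderiv 𝓘(ℝ, E) f y) x :=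
  fun _ hV => hf.mvfderiv_apply hV

theorem smoothFormNear_of_contMDiff {Υ : Π y : M, TangentSpace 𝓘(ℝ, E) y →L[ℝ] ℝ}
    (h : ContMDiff 𝓘(ℝ, E) (𝓘(ℝ, E).prod 𝓘(ℝ, E →L[ℝ] ℝ)) ∞
      (fun x => TotalSpace.mk' (E →L[ℝ] ℝ) x (Υ x))) (x : M) : SmoothFormNear Υ x := by
  intro V hV
  filter_upwards [hV] with y hy
  have h1 := (h y).clm_bundle_apply (E₂ := Bundle.Trivial M ℝ) (F₂ := ℝ) hy
  rw [contMDiffAt_section] at h1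
  exact h1

/-- The covariant derivative `(∇_u Υ)(v)` of a 1-form. -/
def oneFormD (Υ : Π y : M, TangentSpace 𝓘(ℝ, E) y →L[ℝ] ℝ) (x : M)
    (u v : TangentSpace 𝓘(ℝ, E) x) : ℝ :=
  mvfderiv 𝓘(ℝ, E) (fun y => Υ y (extendField v y)) x u - Υ x (nabla.D (extendField v) x u)

theorem smoothTensorialAt_oneFormD {Υ : Π y : M, TangentSpace 𝓘(ℝ, E) y →L[ℝ] ℝ}
    (hΥ : SmoothFormNear Υ x) :
    SmoothTensorialAt (fun V => mvfderiv 𝓘(ℝ, E) (fun y => Υ y (V y)) x - (Υ x).comp (nabla.D V x))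
      x where
  add Y Z hY hZ := by
    have h : (fun y => Υ y ((Y + Z) y)) = (fun y => Υ y (Y y)) + fun y => Υ y (Z y) := by
      funext y
      exact map_add _ _ _
    rw [h, mvfderiv_add (hΥ Y hY).diff (hΥ Z hZ).diff, nabla.D_add hY.diff hZ.diff]
    ext v
    simp
    ring
  smul f Y hf hY := by
    have h : (fun y => Υ y ((f • Y) y)) = f * fun y => Υ y (Y y) := by
      funext y
      exact map_smul _ _ _
    rw [h, mvfderiv_mul hf.diff (hΥ Y hY).diff]
    ext v
    simp [nabla.D_smul hf.diff hY.diff]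
    ring
  congr Y Z hY hZ h := by
    have h1 : (fun y => Υ y (Y y)) =ᶠ[𝓝 x] fun y => Υ y (Z y) := by
      filter_upwards [h] with y hy
      rw [hy]
    rw [ProjectiveTractor.mvfderiv_congr h1, nabla.D_congr hY.diff hZ.diff h]

variable {nabla} in
theorem oneFormD_eq {Υ : Π y : M, TangentSpace 𝓘(ℝ, E) y →L[ℝ] ℝ} (hΥ : SmoothFormNear Υ x)
    (hY : SmoothFieldNear Y x) (u : TangentSpace 𝓘(ℝ, E) x) :
    oneFormD nabla Υ x u (Y x) =
      mvfderiv 𝓘(ℝ, E) (fun y => Υ y (Y y)) x u - Υ x (nabla.D Y x u) :=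
  congrArg (fun L : TangentSpace 𝓘(ℝ, E) x →L[ℝ] ℝ => L u)
    ((smoothTensorialAt_oneFormD nabla hΥ).hom_apply hY)

/-- The covariant derivative of a smooth 1-form as a bilinear map. -/
def oneFormDHom {Υ : Π y : M, TangentSpace 𝓘(ℝ, E) y →L[ℝ] ℝ} (hΥ : SmoothFormNear Υ x) :
    TangentSpace 𝓘(ℝ, E) x →ₗ[ℝ] TangentSpace 𝓘(ℝ, E) x →ₗ[ℝ] ℝ :=
  ((ContinuousLinearMap.coeLM ℝ).comp (smoothTensorialAt_oneFormD nabla hΥ).hom).flip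

theorem oneFormDHom_apply {Υ : Π y : M, TangentSpace 𝓘(ℝ, E) y →L[ℝ] ℝ}
    (hΥ : SmoothFormNear Υ x) (u v : TangentSpace 𝓘(ℝ, E) x) :
    oneFormDHom nabla hΥ u v = oneFormD nabla Υ x u v :=
  rfl

/-- The Hessian of a function for a torsion-free connection is symmetric. -/
theorem hessian_symm (hf : SmoothFunNear E f x) (u v : TangentSpace 𝓘(ℝ, E) x) :
    oneFormD nabla (fun y => mvfderiv 𝓘(ℝ, E) f y) x u v =
      oneFormD nabla (fun y => mvfderiv 𝓘(ℝ, E) f y) x v u := by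
  have hU := smoothFieldNear_extendField u
  have hV := smoothFieldNear_extendField v
  have h := mvfderiv_mlieBracket hU hV hf
  rw [nabla.torsion_free hU.diff hV.diff, map_sub] at h
  simp only [extendField_self] at h
  simp only [oneFormD]
  linarith

/-- The second covariant derivative `∇_u (∇_V W) - ∇_{∇_u V} W` of a vector field `W`. -/
def secondD (W : Π y : M, TangentSpace 𝓘(ℝ, E) y) (x : M) (u v : TangentSpace 𝓘(ℝ, E) x) :
    TangentSpace 𝓘(ℝ, E) x :=
  nabla.D (fun y => nabla.D W y (extendField v y)) x u - nabla.D W x (nabla.D (extendField v) x u)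

variable [T2Space M]

theorem smoothTensorialAt_secondD (hW : SmoothFieldNear W x) :
    SmoothTensorialAt (fun V => nabla.D (fun y => nabla.D W y (V y)) x
      - (nabla.D W x).comp (nabla.D V x)) x where
  add Y Z hY hZ := by
    have h : (fun y => nabla.D W y ((Y + Z) y)) =
        (fun y => nabla.D W y (Y y)) + fun y => nabla.D W y (Z y) := by
      funext y
      exact map_add _ _ _
    rw [h, nabla.D_add (nabla.D_smooth hW hY).diff (nabla.D_smooth hW hZ).diff,
      nabla.D_add hY.diff hZ.diff]
    ext v
    simp
    abel
  smul f Y hf hY := by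
    have h : (fun y => nabla.D W y ((f • Y) y)) = f • fun y => nabla.D W y (Y y) := by
      funext y
      exact map_smul _ _ _
    rw [h]
    ext v
    simp [nabla.D_smul hf.diff hY.diff, nabla.D_smul hf.diff (nabla.D_smooth hW hY).diff]
    module
  congr Y Z hY hZ h := by
    have h1 : (fun y => nabla.D W y (Y y)) =ᶠ[𝓝 x] fun y => nabla.D W y (Z y) := by
      filter_upwards [h] with y hy
      rw [hy]
    rw [nabla.D_congr (nabla.D_smooth hW hY).diff (nabla.D_smooth hW hZ).diff h1,
      nabla.D_congr hY.diff hZ.diff h]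

variable {nabla} in
theorem secondD_eq (hW : SmoothFieldNear W x) (hY : SmoothFieldNear Y x)
    (u : TangentSpace 𝓘(ℝ, E) x) :
    secondD nabla W x u (Y x) =
      nabla.D (fun y => nabla.D W y (Y y)) x u - nabla.D W x (nabla.D Y x u) :=
  congrArg (fun L : TangentSpace 𝓘(ℝ, E) x →L[ℝ] TangentSpace 𝓘(ℝ, E) x => L u)
    ((smoothTensorialAt_secondD nabla hW).hom_apply hY)

/-- The second covariant derivative of a smooth vector field as a bilinear map. -/
def secondDHom (hW : SmoothFieldNear W x) :
    TangentSpace 𝓘(ℝ, E) x →ₗ[ℝ] TangentSpace 𝓘(ℝ, E) x →ₗ[ℝ] TangentSpace 𝓘(ℝ, E) x :=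
  ((ContinuousLinearMap.coeLM ℝ).comp (smoothTensorialAt_secondD nabla hW).hom).flip

theorem secondDHom_apply (hW : SmoothFieldNear W x) (u v : TangentSpace 𝓘(ℝ, E) x) :
    secondDHom nabla hW u v = secondD nabla W x u v :=
  rfl

/-- Multiplying the field by `f` adds to the second derivative first order terms symmetric in `u`,
`v` and the Hessian of `f`, which is symmetric too. Antisymmetrising removes both. -/
theorem smoothTensorialAt_curvature (u v : TangentSpace 𝓘(ℝ, E) x) :
    SmoothTensorialAt (fun W => secondD nabla W x u v - secondD nabla W x v u) x where
  add Y Z hY hZ := by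
    have h : ∀ V, SmoothFieldNear V x → nabla.D (fun y => nabla.D (Y + Z) y (V y)) x =
        nabla.D (fun y => nabla.D Y y (V y)) x + nabla.D (fun y => nabla.D Z y (V y)) x := by
      intro V hV
      have h1 := nabla.D_smooth hY hV
      have h2 := nabla.D_smooth hZ hV
      rw [← nabla.D_add h1.diff h2.diff]
      refine nabla.D_congr (nabla.D_smooth (hY.add hZ) hV).diff (h1.add h2).diff ?_
      filter_upwards [hY.eventually, hZ.eventually] with y h3 h4
      rw [nabla.D_add h3.diff h4.diff]
      rfl
    simp only [secondD, h _ (smoothFieldNear_extendField _), nabla.D_add hY.diff hZ.diff,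
      _root_.add_apply]
    abel
  smul f Y hf hY := by
    have h : ∀ v u : TangentSpace 𝓘(ℝ, E) x, secondD nabla (f • Y) x u v =
        f x • secondD nabla Y x u v + mvfderiv 𝓘(ℝ, E) f x u • nabla.D Y x v
          + mvfderiv 𝓘(ℝ, E) f x v • nabla.D Y x u
          + oneFormD nabla (fun y => mvfderiv 𝓘(ℝ, E) f y) x u v • Y x := by
      intro v u
      have hV := smoothFieldNear_extendField v
      have h1 := nabla.D_smooth hY hV
      have h2 := hf.mvfderiv_apply hV
      have h3 : nabla.D (fun y => nabla.D (f • Y) y (extendField v y)) x =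
          nabla.D ((f • fun y => nabla.D Y y (extendField v y)) +
            (fun y => mvfderiv 𝓘(ℝ, E) f y (extendField v y)) • Y) x := by
        refine nabla.D_congr (nabla.D_smooth (hf.smul_field hY) hV).diff
          ((hf.smul_field h1).add (h2.smul_field hY)).diff ?_
        filter_upwards [hY.eventually, hf.eventually] with y h3 h4
        rw [nabla.D_smul h4.diff h3.diff]
        rfl
      rw [secondD, h3, nabla.D_add (hf.smul_field h1).diff (h2.smul_field hY).diff,
        _root_.add_apply, nabla.D_smul hf.diff h1.diff,
        nabla.D_smul h2.diff hY.diff, nabla.D_smul hf.diff hY.diff, secondD, oneFormD]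
      simp only [extendField_self]
      module
    simp only [h, hessian_symm nabla hf v u]
    module
  congr Y Z hY hZ h := by
    have h1 : ∀ V, SmoothFieldNear V x → nabla.D (fun y => nabla.D Y y (V y)) x =
        nabla.D (fun y => nabla.D Z y (V y)) x := by
      intro V hV
      refine nabla.D_congr (nabla.D_smooth hY hV).diff (nabla.D_smooth hZ hV).diff ?_
      filter_upwards [hY.eventually, hZ.eventually, h.eventuallyEq_nhds] with y h1 h2 h3
      rw [nabla.D_congr h1.diff h2.diff h3]
    simp only [secondD, h1 _ (smoothFieldNear_extendField _), nabla.D_congr hY.diff hZ.diff h]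

/-- Absence of torsion splits the bracket term of the curvature into the correction terms of the two
second derivatives. -/
theorem curvature_eq_extendField (u v w : TangentSpace 𝓘(ℝ, E) x) :
    curvature nabla x u v w =
      secondD nabla (extendField w) x u v - secondD nabla (extendField w) x v u := by
  rw [curvature, nabla.torsion_free (smoothFieldNear_extendField u).diff
    (smoothFieldNear_extendField v).diff, map_sub, secondD, secondD]
  simp only [extendField_self]
  abel

/-- The Ricci identity. -/
theorem curvature_eq (hW : SmoothFieldNear W x) (u v : TangentSpace 𝓘(ℝ, E) x) :
    curvature nabla x u v (W x) = secondD nabla W x u v - secondD nabla W x v u := by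
  rw [curvature_eq_extendField]
  exact (smoothTensorialAt_curvature nabla u v).hom_apply hW

theorem curvature_eq_bracket {U V : Π y : M, TangentSpace 𝓘(ℝ, E) y} (hU : SmoothFieldNear U x)
    (hV : SmoothFieldNear V x) (hW : SmoothFieldNear W x) :
    curvature nabla x (U x) (V x) (W x) = nabla.D (fun y => nabla.D W y (V y)) x (U x)
      - nabla.D (fun y => nabla.D W y (U y)) x (V x)
      - nabla.D W x (VectorField.mlieBracket 𝓘(ℝ, E) U V x) := by
  rw [curvature_eq nabla hW, secondD_eq hW hV, secondD_eq hW hU, nabla.torsion_free hU.diff hV.diff,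
    map_sub]
  abel

theorem curvature_add_left (u u' v w : TangentSpace 𝓘(ℝ, E) x) :
    curvature nabla x (u + u') v w = curvature nabla x u v w + curvature nabla x u' v w := by
  simp only [curvature_eq_extendField, ← secondDHom_apply nabla (smoothFieldNear_extendField w),
    map_add, LinearMap.add_apply]
  abel

theorem curvature_smul_left (c : ℝ) (u v w : TangentSpace 𝓘(ℝ, E) x) :
    curvature nabla x (c • u) v w = c • curvature nabla x u v w := by
  simp only [curvature_eq_extendField, ← secondDHom_apply nabla (smoothFieldNear_extendField w),
    map_smul, LinearMap.smul_apply, smul_sub]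

theorem curvature_swap (u v w : TangentSpace 𝓘(ℝ, E) x) :
    curvature nabla x v u w = -curvature nabla x u v w := by
  simp only [curvature_eq_extendField]
  abel

theorem curvature_add_right (u v w w' : TangentSpace 𝓘(ℝ, E) x) :
    curvature nabla x u v (w + w') = curvature nabla x u v w + curvature nabla x u v w' := by
  simp only [curvature_eq_extendField]
  exact (smoothTensorialAt_curvature nabla u v).hom.map_add w w'

theorem curvature_smul_right (c : ℝ) (u v w : TangentSpace 𝓘(ℝ, E) x) :
    curvature nabla x u v (c • w) = c • curvature nabla x u v w := by
  simp only [curvature_eq_extendField]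
  exact (smoothTensorialAt_curvature nabla u v).hom.map_smul c w

/-- The first Bianchi identity. -/
theorem curvature_bianchi (u v w : TangentSpace 𝓘(ℝ, E) x) :
    curvature nabla x u v w + curvature nabla x v w u + curvature nabla x w u v = 0 := by
  have hU := smoothFieldNear_extendField u
  have hV := smoothFieldNear_extendField v
  have hW := smoothFieldNear_extendField w
  -- Absence of torsion, used twice, turns a double bracket into second derivatives; the cyclic sum
  -- of curvatures is then the Jacobi identity.
  have h1 : ∀ A B C : Π y : M, TangentSpace 𝓘(ℝ, E) y, SmoothFieldNear A x →
      SmoothFieldNear B x → SmoothFieldNear C x →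
      VectorField.mlieBracket 𝓘(ℝ, E) A (VectorField.mlieBracket 𝓘(ℝ, E) B C) x =
        nabla.D (fun y => nabla.D C y (B y)) x (A x) - nabla.D (fun y => nabla.D B y (C y)) x (A x)
          - nabla.D A x (VectorField.mlieBracket 𝓘(ℝ, E) B C x) := by
    intro A B C hA hB hC
    have h2 : nabla.D (fun y => nabla.D C y (B y)) x = nabla.D
        ((fun y => nabla.D B y (C y)) + VectorField.mlieBracket 𝓘(ℝ, E) B C) x := by
      refine nabla.D_congr (nabla.D_smooth hC hB).diff
        ((nabla.D_smooth hB hC).add (hB.mlieBracket hC)).diff ?_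
      filter_upwards [hB.eventually, hC.eventually] with y h3 h4
      rw [Pi.add_apply, nabla.torsion_free h3.diff h4.diff]
      abel
    rw [nabla.torsion_free hA.diff (hB.mlieBracket hC).diff, h2,
      nabla.D_add (nabla.D_smooth hB hC).diff (hB.mlieBracket hC).diff, _root_.add_apply]
    abel
  have e1 := curvature_eq_bracket nabla hU hV hW
  have e2 := curvature_eq_bracket nabla hV hW hU
  have e3 := curvature_eq_bracket nabla hW hU hV
  have f1 := h1 _ _ _ hU hV hW
  have f2 := h1 _ _ _ hV hW hU
  have f3 := h1 _ _ _ hW hU hV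
  have J := jacobi_mlieBracket hU hV hW
  rw [VectorField.mlieBracket_swap_apply (V := VectorField.mlieBracket 𝓘(ℝ, E) _ _),
    VectorField.mlieBracket_swap (V := extendField u) (W := extendField w)] at J
  have h5 : VectorField.mlieBracket 𝓘(ℝ, E) (extendField v)
      (-VectorField.mlieBracket 𝓘(ℝ, E) (extendField w) (extendField u)) x =
      -VectorField.mlieBracket 𝓘(ℝ, E) (extendField v)
        (VectorField.mlieBracket 𝓘(ℝ, E) (extendField w) (extendField u)) x := by
    have := VectorField.mlieBracket_const_smul_right (I := 𝓘(ℝ, E)) (c := (-1 : ℝ))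
      (V := extendField v) (hW.mlieBracket hU).diff
    rwa [neg_one_smul, neg_one_smul] at this
  rw [h5, f1, f2, f3] at J
  simp only [extendField_self] at e1 e2 e3 J
  rw [e1, e2, e3]
  linear_combination (norm := module) J

/-- The curvature as a trilinear map. -/
def curvatureHom (x : M) : TangentSpace 𝓘(ℝ, E) x →ₗ[ℝ] TangentSpace 𝓘(ℝ, E) x →ₗ[ℝ]
    Module.End ℝ (TangentSpace 𝓘(ℝ, E) x) :=
  LinearMap.mk₂ ℝ (fun u v =>
    { toFun := curvature nabla x u v
      map_add' := curvature_add_right nabla u v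
      map_smul' := fun c w => curvature_smul_right nabla c u v w })
    (fun u u' v => LinearMap.ext fun w => curvature_add_left nabla u u' v w)
    (fun c u v => LinearMap.ext fun w => curvature_smul_left nabla c u v w)
    (fun u v v' => LinearMap.ext fun w => by
      change curvature nabla x u (v + v') w = curvature nabla x u v w + curvature nabla x u v' w
      rw [curvature_swap nabla (v + v') u, curvature_swap nabla v u, curvature_swap nabla v' u,
        curvature_add_left, neg_add])
    (fun c u v => LinearMap.ext fun w => by
      change curvature nabla x u (c • v) w = c • curvature nabla x u v w
      rw [curvature_swap nabla (c • v) u, curvature_swap nabla v u, curvature_smul_left, smul_neg])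

/-- The endomorphism `u ↦ R(u, v) w`. -/
def ricciEnd (v w : TangentSpace 𝓘(ℝ, E) x) : Module.End ℝ (TangentSpace 𝓘(ℝ, E) x) :=
  ((curvatureHom nabla x).flip v).flip w

theorem ricciEnd_apply (u v w : TangentSpace 𝓘(ℝ, E) x) :
    ricciEnd nabla v w u = curvature nabla x u v w :=
  rfl

/-- The trace is already bilinear in `v` and `w`, so each `linearize` in the definition may be
dropped. -/
theorem ricci_apply (v w : TangentSpace 𝓘(ℝ, E) x) :
    ricci nabla x v w = LinearMap.trace ℝ (TangentSpace 𝓘(ℝ, E) x) (ricciEnd nabla v w) := by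
  let B : TangentSpace 𝓘(ℝ, E) x →ₗ[ℝ] TangentSpace 𝓘(ℝ, E) x →ₗ[ℝ] ℝ :=
    LinearMap.mk₂ ℝ
      (fun v w => LinearMap.trace ℝ (TangentSpace 𝓘(ℝ, E) x) (ricciEnd nabla v w))
      (fun v v' w => by
        rw [← map_add]
        exact congrArg _ (LinearMap.ext fun u => by simp [ricciEnd]))
      (fun c v w => by
        rw [← map_smul]
        exact congrArg _ (LinearMap.ext fun u => by simp [ricciEnd]))
      (fun v w w' => by simp only [ricciEnd, map_add])
      (fun c v w => by simp only [ricciEnd, map_smul])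
  have h : ricci nabla x = B := by
    refine linearize_eq _ _ fun v => linearize_eq _ _ fun w => ?_
    rw [linearize_eq (fun u => curvature nabla x u v w) (ricciEnd nabla v w) fun u => rfl]
    rfl
  rw [h]
  rfl

end Calculus

/-! ### The algebra behind Ricci-flatness of hyperkähler metrics. -/

section LinearAlgebra

variable {V : Type*} [AddCommGroup V] [Module ℝ V]

/-- An endomorphism which is skew for a non-degenerate form has trace `0`. -/
theorem trace_eq_zero_of_skew [FiniteDimensional ℝ V] (B : V →ₗ[ℝ] V →ₗ[ℝ] ℝ)
    (hB : ∀ v, (∀ w, B v w = 0) → v = 0)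
    (A : Module.End ℝ V) (hA : ∀ v w, B (A v) w = -B v (A w)) : LinearMap.trace ℝ V A = 0 := by
  have hinj : Function.Injective B := by
    rw [injective_iff_map_eq_zero]
    intro v hv
    exact hB v fun w => by rw [hv]; rfl
  let e : V ≃ₗ[ℝ] Module.Dual ℝ V :=
    LinearEquiv.ofInjectiveOfFinrankEq B hinj Subspace.dual_finrank_eq.symm
  have he : ∀ v w, e v w = B v w := fun v w => rfl
  let T : Module.End ℝ (Module.Dual ℝ V) := Module.Dual.transpose (R := ℝ) A
  have hT : LinearMap.trace ℝ (Module.Dual ℝ V) T = LinearMap.trace ℝ V A :=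
    LinearMap.trace_transpose' A
  -- Through the form, `A` is conjugate to minus its transpose, and a transpose has the same trace.
  have h1 : e.conj A + T = 0 := by
    ext f w
    obtain ⟨v, rfl⟩ := e.surjective f
    simp [T, LinearEquiv.conj_apply, Module.Dual.transpose_apply, he, hA]
  have h2 := congrArg (LinearMap.trace ℝ (Module.Dual ℝ V)) h1
  rw [map_add, LinearMap.trace_conj', hT, map_zero] at h2
  linarith

/-- An algebraic curvature operator of vanishing trace which kills `ξ₁, ξ₂, ξ₃` and commutes with
`φ₁, φ₂, φ₃`, where the `φₐ` satisfy the quaternion relations up to the `ξₐ`, is Ricci flat. -/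
theorem trace_curvature_eq_zero (W : V →ₗ[ℝ] V →ₗ[ℝ] Module.End ℝ V)
    (hskew : ∀ u v, W v u = -W u v) (hbianchi : ∀ u v w, W u v w + W v w u + W w u v = 0)
    (htrace : ∀ u v, LinearMap.trace ℝ V (W u v) = 0)
    (φ : Fin 3 → Module.End ℝ V) (ξ : Fin 3 → V) (hξ : ∀ a u v, W u v (ξ a) = 0)
    (hcomm : ∀ a u v w, W u v (φ a w) = φ a (W u v w))
    (hpos : ∀ a w, ∃ c : ℝ, φ a (φ (a + 1) w) = φ (a + 2) w + c • ξ a)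
    (hneg : ∀ a w, ∃ c : ℝ, φ (a + 1) (φ a w) = -φ (a + 2) w + c • ξ (a + 1))
    (hsq : ∀ a w, ∃ c : ℝ, φ a (φ a w) = -w + c • ξ a) (v w : V) :
    LinearMap.trace ℝ V ((W.flip v).flip w) = 0 := by
  let Ric : V → V → ℝ := fun v w => LinearMap.trace ℝ V ((W.flip v).flip w)
  have hRadd : ∀ v w w', Ric v (w + w') = Ric v w + Ric v w' := fun v w w' => by
    simp only [Ric, map_add]
  have hRneg : ∀ v w, Ric v (-w) = -Ric v w := fun v w => by simp only [Ric, map_neg]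
  have hRξ : ∀ a v (c : ℝ), Ric v (c • ξ a) = 0 := fun a v c => by
    have : (W.flip v).flip (c • ξ a) = 0 := by
      ext u
      simp [hξ]
    simp only [Ric, this, map_zero]
  have htr : ∀ a u v, LinearMap.trace ℝ V (W u v * φ a) = 0 := by
    intro a u v
    -- Indices are modulo 3, so every `φ a` is a product `φ b φ (b + 1)` up to a multiple of a `ξ`,
    -- which `W` kills.
    obtain ⟨b, rfl⟩ : ∃ b, a = b + 2 := ⟨a + 1, by fin_cases a <;> rfl⟩
    have h1 : W u v * φ b * φ (b + 1) = W u v * φ (b + 2) := by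
      ext w
      obtain ⟨c, hc⟩ := hpos b w
      simp only [Module.End.mul_apply, hc, map_add, map_smul, hξ, smul_zero, add_zero]
    have h2 : W u v * (φ (b + 1) * φ b) = -(W u v * φ (b + 2)) := by
      ext w
      obtain ⟨c, hc⟩ := hneg b w
      simp only [Module.End.mul_apply, hc, map_add, map_smul, hξ, smul_zero, add_zero, map_neg,
        LinearMap.neg_apply]
    have h3 : φ b * W u v = W u v * φ b := by
      ext w
      exact (hcomm b u v w).symm
    -- Cyclicity of the trace and commutation with `φ b` exchange the two orders of the product,
    -- which differ by a sign. The trace is therefore its own negative.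
    have h4 := LinearMap.trace_mul_comm ℝ (W u v * φ (b + 1)) (φ b)
    rw [← mul_assoc, h3, h1, mul_assoc, h2, map_neg] at h4
    linarith
  have hsymm : ∀ v w, Ric v w = Ric w v := by
    intro v w
    -- The Bianchi identity makes the antisymmetric part of the Ricci trace equal to the trace of `W
    -- v w`, which is zero.
    have h1 : W v w = (W.flip w).flip v - (W.flip v).flip w := by
      ext u
      have := hbianchi u v w
      rw [hskew u w] at this
      simp only [LinearMap.sub_apply, LinearMap.flip_apply, LinearMap.neg_apply] at this ⊢
      linear_combination (norm := module) this
    have h2 := htrace v w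
    rw [h1, map_sub] at h2
    simp only [Ric]
    linarith
  have hφ : ∀ a v w, Ric w (φ a v) = Ric v (φ a w) := by
    intro a v w
    -- The same argument with `φ a` inserted uses the vanishing of `htr`.
    have h1 : W v w * φ a = (W.flip w).flip v * φ a - (W.flip v).flip w * φ a := by
      ext u
      have := hbianchi (φ a u) v w
      rw [hskew (φ a u) w] at this
      simp only [LinearMap.sub_apply, LinearMap.flip_apply, LinearMap.neg_apply,
        Module.End.mul_apply] at this ⊢
      linear_combination (norm := module) this
    have h2 : ∀ v w, LinearMap.trace ℝ V ((W.flip w).flip v * φ a) = Ric w (φ a v) := by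
      intro v w
      rw [LinearMap.trace_mul_comm]
      refine congrArg _ (LinearMap.ext fun u => ?_)
      simp only [LinearMap.flip_apply, Module.End.mul_apply, hcomm]
    have h3 := htr a v w
    rw [h1, map_sub, h2, h2] at h3
    linarith
  -- Writing `φ 2` as `φ 0 φ 1` and moving both factors to the other argument reverses their order,
  -- which costs a sign. By `hφ` for `φ 2` itself, moving it costs none.
  have hzero : ∀ v w, Ric v (φ 2 w) = 0 := by
    intro v w
    obtain ⟨c, hc⟩ := hpos 0 w
    obtain ⟨d, hd⟩ := hneg 0 v
    have h1 : Ric v (φ 0 (φ 1 w)) = Ric v (φ 2 w) := by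
      rw [show φ 0 (φ 1 w) = φ 2 w + c • ξ 0 from hc, hRadd, hRξ, add_zero]
    have h2 : Ric w (φ 1 (φ 0 v)) = -Ric w (φ 2 v) := by
      rw [show φ 1 (φ 0 v) = -φ 2 v + d • ξ 1 from hd, hRadd, hRξ, add_zero, hRneg]
    rw [hφ 0, hsymm, hφ 1] at h1
    have h3 := hφ 2 v w
    linarith
  obtain ⟨c, hc⟩ := hsq 2 w
  have h1 := hzero v (φ 2 w)
  rw [hc, hRadd, hRξ, add_zero, hRneg] at h1
  exact neg_eq_zero.1 h1

end LinearAlgebra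

/-! ### Levi-Civita connections, Killing fields and Sasaki fields. -/

section Metric

set_option linter.unusedSectionVars false

variable {E : Type*} [NormedAddCommGroup E] [NormedSpace ℝ E] [FiniteDimensional ℝ E]
variable {M : Type*} [TopologicalSpace M] [ChartedSpace E M] [IsManifold 𝓘(ℝ, E) ∞ M]
variable {r s : ℕ} {g : PseudoRiemannianMetric E M r s} {nabla : AffineConnection E M}
variable {x : M} {Y Z W : Π y : M, TangentSpace 𝓘(ℝ, E) y} {f : M → ℝ}

namespace PseudoRiemannianMetric

theorem inner_symm (u v : TangentSpace 𝓘(ℝ, E) x) : g.inner x u v = g.inner x v u :=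
  (g.innerProduct x).symm u v

theorem eq_zero_of_inner (u : TangentSpace 𝓘(ℝ, E) x) (h : ∀ v, g.inner x u v = 0) : u = 0 :=
  (g.innerProduct x).nondegenerate u h

variable (g) in
/-- The metric as a bilinear form. -/
def form (x : M) : LinearMap.BilinForm ℝ (TangentSpace 𝓘(ℝ, E) x) :=
  LinearMap.mk₂ ℝ (fun v w => g.inner x v w) (by simp) (by simp) (by simp) (by simp)

@[simp]
theorem form_apply (u v : TangentSpace 𝓘(ℝ, E) x) : g.form x u v = g.inner x u v :=
  rfl

theorem inner_smooth (hY : SmoothFieldNear Y x) (hZ : SmoothFieldNear Z x) :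
    SmoothFunNear E (fun y => g.inner y (Y y) (Z y)) x := by
  filter_upwards [hY, hZ] with y h1 h2
  have h3 := ((g.contMDiff y).clm_bundle_apply₂ (F₁ := E) (F₂ := E) (F₃ := ℝ)
    (E₃ := Bundle.Trivial M ℝ) h1 h2)
  rw [contMDiffAt_section] at h3
  exact h3

end PseudoRiemannianMetric

open PseudoRiemannianMetric

theorem IsLeviCivita.mvfderiv_inner (hg : IsLeviCivita g nabla) (hY : SmoothFieldNear Y x)
    (hZ : SmoothFieldNear Z x) (v : TangentSpace 𝓘(ℝ, E) x) :
    mvfderiv 𝓘(ℝ, E) (fun y => g.inner y (Y y) (Z y)) x v =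
      g.inner x (nabla.D Y x v) (Z x) + g.inner x (Y x) (nabla.D Z x v) :=
  hg x Y Z hY.diff hZ.diff v

variable [T2Space M]

/-- The curvature of the Levi-Civita connection is skew. -/
theorem IsLeviCivita.inner_curvature_self (hg : IsLeviCivita g nabla)
    (u v w : TangentSpace 𝓘(ℝ, E) x) : g.inner x (curvature nabla x u v w) w = 0 := by
  have hW := smoothFieldNear_extendField w
  have hf : SmoothFunNear E (fun y => g.inner y (extendField w y) (extendField w y)) x :=
    g.inner_smooth hW hW
  -- This is the Hessian of $g(w,w)$ for an extension of `w`. Since the Hessian and the product of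
  -- first derivatives are symmetric, antisymmetrising leaves only $2g(R(u,v)w,w)=0$.
  have key : ∀ u v : TangentSpace 𝓘(ℝ, E) x,
      oneFormD nabla (fun y => mvfderiv 𝓘(ℝ, E)
        (fun y => g.inner y (extendField w y) (extendField w y)) y) x u v =
      2 * g.inner x (secondD nabla (extendField w) x u v) w
        + 2 * g.inner x (nabla.D (extendField w) x u) (nabla.D (extendField w) x v) := by
    intro u v
    have hV := smoothFieldNear_extendField v
    have hDV := nabla.D_smooth hW hV
    have h1 : (fun y => mvfderiv 𝓘(ℝ, E)
        (fun y => g.inner y (extendField w y) (extendField w y)) y (extendField v y)) =ᶠ[𝓝 x]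
        (fun y => g.inner y (nabla.D (extendField w) y (extendField v y)) (extendField w y))
        + (fun y => g.inner y (nabla.D (extendField w) y (extendField v y)) (extendField w y)) := by
      filter_upwards [hW.eventually] with y hy
      rw [hg.mvfderiv_inner hy hy, g.inner_symm (extendField w y)]
      rfl
    have h2 := (g.inner_smooth hDV hW).diff
    rw [oneFormD, ProjectiveTractor.mvfderiv_congr h1, mvfderiv_add h2 h2, _root_.add_apply,
      hg.mvfderiv_inner hDV hW, hg.mvfderiv_inner hW hW, secondD, map_sub]
    simp only [extendField_self, _root_.sub_apply]
    rw [g.inner_symm w, g.inner_symm (nabla.D (extendField w) x v)]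
    ring
  have h := hessian_symm nabla hf u v
  rw [key, key, g.inner_symm (nabla.D (extendField w) x v)] at h
  rw [curvature_eq_extendField, map_sub, _root_.sub_apply]
  linarith

theorem IsLeviCivita.inner_curvature (hg : IsLeviCivita g nabla)
    (u v w z : TangentSpace 𝓘(ℝ, E) x) :
    g.inner x (curvature nabla x u v w) z = -g.inner x w (curvature nabla x u v z) := by
  have h := hg.inner_curvature_self u v (w + z)
  rw [curvature_add_right] at h
  simp only [map_add, _root_.add_apply, hg.inner_curvature_self] at h
  rw [g.inner_symm w]
  linarith

variable {ξ η : Π y : M, TangentSpace 𝓘(ℝ, E) y}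

/-- Expressing the brackets by the torsion-free connection cancels $\nabla_\xi g=0$ from the Lie
derivative of $g$; what remains is the symmetric part of $\nabla\xi$. -/
theorem IsKilling.skew (h : IsKilling g ξ) (hg : IsLeviCivita g nabla)
    (u v : TangentSpace 𝓘(ℝ, E) x) :
    g.inner x (nabla.D ξ x u) v = -g.inner x u (nabla.D ξ x v) := by
  have hU := smoothFieldNear_extendField u
  have hV := smoothFieldNear_extendField v
  have hξ := h.smooth.near x
  have h1 := h.lieDerivative_eq_zero x _ _ hU.diff hV.diff
  rw [hg.mvfderiv_inner hU hV, nabla.torsion_free hξ.diff hU.diff,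
    nabla.torsion_free hξ.diff hV.diff] at h1
  simp only [extendField_self, map_sub, _root_.sub_apply] at h1
  linarith

theorem IsKilling.divergence_eq_zero (h : IsKilling g ξ) (hg : IsLeviCivita g nabla)
    (x : M) :
    divergence nabla ξ x = 0 :=
  trace_eq_zero_of_skew (g.form x) (g.innerProduct x).nondegenerate _ fun v w => h.skew hg v w

namespace IsSasaki

theorem near (h : IsSasaki g nabla ξ) (x : M) : SmoothFieldNear ξ x :=
  h.smooth.near x

theorem inner_D (h : IsSasaki g nabla ξ) (hg : IsLeviCivita g nabla)
    (v : TangentSpace 𝓘(ℝ, E) x) : g.inner x (ξ x) (nabla.D ξ x v) = 0 := by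
  have h1 := hg.mvfderiv_inner (h.near x) (h.near x) v
  have h2 : (fun y => g.inner y (ξ y) (ξ y)) = fun _ => 1 := funext h.unit
  rw [h2, mvfderiv_const, g.inner_symm] at h1
  simp only [_root_.zero_apply] at h1
  linarith

theorem D_self (h : IsSasaki g nabla ξ) (hg : IsLeviCivita g nabla) (x : M) :
    nabla.D ξ x (ξ x) = 0 := by
  refine g.eq_zero_of_inner _ fun v => ?_
  rw [h.toIsKilling.skew hg, h.inner_D hg, neg_zero]

theorem D_D_apply (h : IsSasaki g nabla ξ) (hY : SmoothFieldNear Y x)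
    (v : TangentSpace 𝓘(ℝ, E) x) :
    nabla.D (fun y => nabla.D ξ y (Y y)) x v =
      nabla.D ξ x (nabla.D Y x v) - g.inner x v (Y x) • ξ x + g.inner x (ξ x) (Y x) • v := by
  have h1 := h.second_derivative x Y hY.diff v
  linear_combination (norm := module) h1

theorem secondD (h : IsSasaki g nabla ξ) (u v : TangentSpace 𝓘(ℝ, E) x) :
    secondD nabla ξ x u v = -(g.inner x u v) • ξ x + g.inner x (ξ x) v • u := by
  have h1 := h.second_derivative x _ (smoothFieldNear_extendField v).diff u
  simp only [extendField_self] at h1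
  exact h1

/-- By the Ricci identity this is the Sasaki equation antisymmetrised. On `ξ` the curvature agrees
with that of constant curvature 1. -/
theorem curvature_apply (h : IsSasaki g nabla ξ) (u v : TangentSpace 𝓘(ℝ, E) x) :
    curvature nabla x u v (ξ x) = g.inner x v (ξ x) • u - g.inner x u (ξ x) • v := by
  rw [curvature_eq nabla (h.near x), h.secondD, h.secondD, g.inner_symm v u, g.inner_symm v,
    g.inner_symm u (ξ x)]
  module

/-- Differentiate $\nabla_\xi\xi=0$ and use the Sasaki equation. -/
theorem D_comp_self (h : IsSasaki g nabla ξ) (hg : IsLeviCivita g nabla)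
    (v : TangentSpace 𝓘(ℝ, E) x) :
    nabla.D ξ x (nabla.D ξ x v) = -v + g.inner x (ξ x) v • ξ x := by
  have h1 := h.D_D_apply (h.near x) v
  have h2 : (fun y => nabla.D ξ y (ξ y)) = (0 : ℝ) • ξ := by
    funext y
    rw [h.D_self hg y]
    exact (zero_smul ℝ (ξ y)).symm
  rw [h2, nabla.D_const_smul _ (h.near x).diff, h.unit, zero_smul, g.inner_symm v,
    _root_.zero_apply] at h1
  linear_combination (norm := module) -h1

/-- The curvature commutes with `∇ξ` up to the curvature of constant curvature `1`. -/
theorem curvature_D (h : IsSasaki g nabla ξ) (hg : IsLeviCivita g nabla)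
    (u v w : TangentSpace 𝓘(ℝ, E) x) :
    curvature nabla x u v (nabla.D ξ x w) - nabla.D ξ x (curvature nabla x u v w) =
      -g.inner x v w • nabla.D ξ x u + g.inner x u w • nabla.D ξ x v
        + g.inner x (nabla.D ξ x u) w • v - g.inner x (nabla.D ξ x v) w • u := by
  have hξ := h.near x
  have hY := smoothFieldNear_extendField w
  have hZ := nabla.D_smooth hξ hY
  -- The Sasaki equation gives the derivative of $\nabla_Y\xi$, where $Y$ extends `w`; it is
  -- differentiated once more. The terms containing $\nabla Y$ are symmetric in `u`, `v` and
  -- disappear from the curvature.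
  have key : ∀ u v : TangentSpace 𝓘(ℝ, E) x,
      ProjectiveTractor.secondD nabla (fun y => nabla.D ξ y (extendField w y)) x u v =
      nabla.D ξ x (ProjectiveTractor.secondD nabla (extendField w) x u v)
      - (g.inner x u (nabla.D (extendField w) x v) +
        g.inner x v (nabla.D (extendField w) x u)) • ξ x
      + g.inner x (ξ x) (nabla.D (extendField w) x v) • u
      + g.inner x (ξ x) (nabla.D (extendField w) x u) • v
      - g.inner x v w • nabla.D ξ x u + g.inner x (nabla.D ξ x u) w • v := by
    intro u v
    have hV := smoothFieldNear_extendField v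
    have hDYV := nabla.D_smooth hY hV
    have hp := nabla.D_smooth hξ hDYV
    have hq := (g.inner_smooth hV hY)
    have hr := (g.inner_smooth hξ hY)
    have h1 : nabla.D (fun y => nabla.D (fun y => nabla.D ξ y (extendField w y)) y
          (extendField v y)) x =
        nabla.D ((fun y => nabla.D ξ y (nabla.D (extendField w) y (extendField v y)))
          + ((-1 : ℝ) • ((fun y => g.inner y (extendField v y) (extendField w y)) • ξ)
          + (fun y => g.inner y (ξ y) (extendField w y)) • extendField v)) x := by
      refine nabla.D_congr (nabla.D_smooth hZ hV).diff
        (hp.add (((hq.smul_field hξ).const_smul (-1)).add (hr.smul_field hV))).diff ?_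
      filter_upwards [hY.eventually] with y hy
      rw [h.D_D_apply hy]
      change _ = _ + ((-1 : ℝ) • (g.inner y (extendField v y) (extendField w y) • ξ y)
        + g.inner y (ξ y) (extendField w y) • extendField v y)
      module
    rw [ProjectiveTractor.secondD, h1, nabla.D_add hp.diff
        (((hq.smul_field hξ).const_smul (-1)).add (hr.smul_field hV)).diff,
      nabla.D_add ((hq.smul_field hξ).const_smul (-1)).diff (hr.smul_field hV).diff,
      nabla.D_const_smul _ (hq.smul_field hξ).diff, _root_.add_apply, _root_.add_apply,
      _root_.smul_apply, nabla.D_smul hq.diff hξ.diff, nabla.D_smul hr.diff hV.diff,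
      h.D_D_apply hDYV, hg.mvfderiv_inner hV hY, hg.mvfderiv_inner hξ hY, h.D_D_apply hY,
      ProjectiveTractor.secondD, map_sub]
    simp only [extendField_self]
    module
  have h2 := curvature_eq nabla hZ u v
  rw [key, key] at h2
  simp only [extendField_self] at h2
  rw [h2, curvature_eq_extendField, map_sub]
  module

/-- For orthogonal Sasaki fields `ξ, η` with `[ξ, η] = -2ζ`, `∇_η ξ = ζ`. -/
theorem D_apply_of_bracket {ζ : Π y : M, TangentSpace 𝓘(ℝ, E) y} (h : IsSasaki g nabla ξ)
    (hη : IsSasaki g nabla η) (hg : IsLeviCivita g nabla)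
    (horth : ∀ x, g.inner x (ξ x) (η x) = 0)
    (hbr : ∀ x, VectorField.mlieBracket 𝓘(ℝ, E) ξ η x = -(2 : ℝ) • ζ x) (x : M) :
    nabla.D ξ x (η x) = ζ x ∧ nabla.D η x (ξ x) = -ζ x := by
  -- Differentiating $g(\xi,\eta)=0$ and using skewness gives the sum; the bracket gives the
  -- difference.
  have h1 : nabla.D ξ x (η x) + nabla.D η x (ξ x) = 0 := by
    refine g.eq_zero_of_inner _ fun v => ?_
    have h2 := hg.mvfderiv_inner (h.near x) (hη.near x) v
    rw [show (fun y => g.inner y (ξ y) (η y)) = fun _ => 0 from funext horth, mvfderiv_const,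
      _root_.zero_apply, h.toIsKilling.skew hg, g.inner_symm (ξ x), hη.toIsKilling.skew hg] at h2
    rw [map_add, _root_.add_apply, h.toIsKilling.skew hg, hη.toIsKilling.skew hg,
      g.inner_symm (η x), g.inner_symm (ξ x), h.toIsKilling.skew hg, hη.toIsKilling.skew hg]
    linarith
  have h2 := hbr x
  rw [nabla.torsion_free (h.near x).diff (hη.near x).diff] at h2
  constructor
  · linear_combination (norm := module) (1 / 2 : ℝ) • h1 - (1 / 2 : ℝ) • h2
  · linear_combination (norm := module) (1 / 2 : ℝ) • h1 + (1 / 2 : ℝ) • h2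

/-- Differentiate $\nabla_\eta\xi=c\,\zeta$ by the Sasaki equation; orthogonality removes the term
in $g(\xi,\eta)$. With $c=\pm1$ this yields the quaternion relations. -/
theorem D_comp_of_apply {ζ : Π y : M, TangentSpace 𝓘(ℝ, E) y} (h : IsSasaki g nabla ξ)
    (hη : IsSasaki g nabla η) (hζ : SmoothField ζ) (c : ℝ)
    (horth : ∀ x, g.inner x (ξ x) (η x) = 0) (hD : ∀ x, nabla.D ξ x (η x) = c • ζ x)
    (v : TangentSpace 𝓘(ℝ, E) x) :
    nabla.D ξ x (nabla.D η x v) = c • nabla.D ζ x v + g.inner x (η x) v • ξ x := by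
  have h1 := h.D_D_apply (hη.near x) v
  rw [show (fun y => nabla.D ξ y (η y)) = c • ζ from funext hD,
    nabla.D_const_smul _ (hζ.near x).diff, horth, g.inner_symm v, _root_.smul_apply] at h1
  linear_combination (norm := module) -h1

end IsSasaki

end Metric

/-! ### Signature of an inner product enlarged by a positive line. -/

section Signature

variable {V V' : Type*} [AddCommGroup V] [Module ℝ V] [FiniteDimensional ℝ V]
  [AddCommGroup V'] [Module ℝ V'] [FiniteDimensional ℝ V']

theorem sigPos_add_sigNeg_of_nondegenerate {B : LinearMap.BilinForm ℝ V}
    (hs : ∀ v w, B v w = B w v) (hn : ∀ v, (∀ w, B v w = 0) → v = 0) :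
    sigPos B.toQuadraticMap + sigNeg B.toQuadraticMap = Module.finrank ℝ V := by
  have h := QuadraticForm.sigPos_add_sigNeg_add_radical (Q := B.toQuadraticMap)
  have hr : B.toQuadraticMap.radical = ⊥ := by
    rw [Submodule.eq_bot_iff]
    intro v hv
    refine hn v fun w => ?_
    have h1 := congrArg (fun L => L w) (QuadraticMap.radical_le_ker_polarBilin hv)
    have h2 : B (v + w) (v + w) - B v v - B w w = 0 := h1
    simp only [map_add, LinearMap.add_apply, hs w v] at h2
    linarith
  rwa [hr, finrank_bot, add_zero] at h

theorem IsInnerProduct.add_eq_finrank {B : LinearMap.BilinForm ℝ V} {r s : ℕ}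
    (h : IsInnerProduct B r s) : r + s = Module.finrank ℝ V := by
  rw [← sigPos_add_sigNeg_of_nondegenerate h.symm h.nondegenerate, h.sigPos_eq, h.sigNeg_eq]

/-- Adding a positive line to an inner product space. -/
theorem IsInnerProduct.prod_line {B : LinearMap.BilinForm ℝ V} {r s : ℕ} (h : IsInnerProduct B r s)
    (e : V' ≃ₗ[ℝ] V × ℝ) (B' : LinearMap.BilinForm ℝ V')
    (hB : ∀ a b, B' a b = B (e a).1 (e b).1 + (e a).2 * (e b).2) :
    IsInnerProduct B' (r + 1) s := by
  have hs : ∀ v w, B' v w = B' w v := fun v w => by rw [hB, hB, h.symm, mul_comm]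
  have hn : ∀ v, (∀ w, B' v w = 0) → v = 0 := by
    intro v hv
    have h1 : (e v).1 = 0 := h.nondegenerate _ fun w => by
      have := hv (e.symm (w, 0))
      simpa [hB] using this
    have h2 : (e v).2 = 0 := by
      have := hv (e.symm (0, 1))
      simpa [hB] using this
    exact e.map_eq_zero_iff.1 (Prod.ext h1 h2)
  have hsum := sigPos_add_sigNeg_of_nondegenerate hs hn
  have hdim : Module.finrank ℝ V' = r + s + 1 := by
    rw [e.finrank_eq, Module.finrank_prod, Module.finrank_self, h.add_eq_finrank]
  have hpos : r + 1 ≤ sigPos B'.toQuadraticMap := by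
    obtain ⟨P, hP, hP'⟩ := exists_finrank_eq_sigPos_and_posDef B.toQuadraticMap
    let F : P × ℝ →ₗ[ℝ] V' := e.symm.toLinearMap ∘ₗ P.subtype.prodMap LinearMap.id
    have hF : ∀ a, e (F a) = (↑a.1, a.2) := fun a => e.apply_symm_apply _
    have hinj : Function.Injective F := by
      intro a b hab
      have h1 := congrArg e hab
      rw [hF, hF] at h1
      exact Prod.ext (Subtype.ext (congrArg Prod.fst h1)) (congrArg (fun c : V × ℝ => c.2) h1)
    have h1 : Module.finrank ℝ (LinearMap.range F) = r + 1 := by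
      rw [LinearMap.finrank_range_of_inj hinj, Module.finrank_prod, Module.finrank_self, hP,
        h.sigPos_eq]
    rw [← h1]
    refine le_sigPos_of_posDef _ ?_
    rintro ⟨_, ⟨a, rfl⟩⟩ hne
    change 0 < B' (F a) (F a)
    rw [hB, hF]
    rcases eq_or_ne a.1 0 with h2 | h2
    · have h3 : a.2 ≠ 0 := fun h3 => hne (Subtype.ext
        ((congrArg F (Prod.ext h2 h3 : a = 0)).trans (map_zero F)))
      simpa [h2] using h3
    · have h3 : 0 < B (a.1 : V) (a.1 : V) := hP' a.1 h2
      exact add_pos_of_pos_of_nonneg h3 (mul_self_nonneg _)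
  have hneg : s ≤ sigNeg B'.toQuadraticMap := by
    obtain ⟨P, hP, hP'⟩ := exists_finrank_eq_sigNeg_and_negDef B.toQuadraticMap
    let F : P →ₗ[ℝ] V' := e.symm.toLinearMap ∘ₗ LinearMap.inl ℝ V ℝ ∘ₗ P.subtype
    have hF : ∀ a, e (F a) = (↑a, 0) := fun a => e.apply_symm_apply _
    have hinj : Function.Injective F := by
      intro a b hab
      have h1 := congrArg e hab
      rw [hF, hF] at h1
      exact Subtype.ext (congrArg Prod.fst h1)
    have h1 : Module.finrank ℝ (LinearMap.range F) = s := by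
      rw [LinearMap.finrank_range_of_inj hinj, hP, h.sigNeg_eq]
    rw [← h1]
    refine le_sigNeg_of_negDef _ ?_
    rintro ⟨_, ⟨a, rfl⟩⟩ hne
    change 0 < -(B' (F a) (F a))
    rw [hB, hF]
    have h2 : a ≠ 0 := fun h3 => hne (Subtype.ext ((congrArg F h3).trans (map_zero F)))
    have h3 : 0 < -(B (a : V) (a : V)) := hP' a h2
    simpa using h3
  -- The two lower bounds `r + 1` and `s` add up to the dimension, so both are equalities.
  exact ⟨hs, hn, by omega, by omega⟩

end Signature

/-! ### Quaternion relations and the Einstein equation. -/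

section ThreeSasaki

set_option linter.unusedSectionVars false

variable {E : Type*} [NormedAddCommGroup E] [NormedSpace ℝ E] [FiniteDimensional ℝ E]
variable {M : Type*} [TopologicalSpace M] [ChartedSpace E M] [IsManifold 𝓘(ℝ, E) ∞ M]
variable {r s : ℕ} {g : PseudoRiemannianMetric E M r s} {nabla : AffineConnection E M}
variable {x : M} {i j k : Π y : M, TangentSpace 𝓘(ℝ, E) y}

open PseudoRiemannianMetric

namespace IsThreeSasaki

/-- By this symmetry the relations need only be proved for the pair `i`, `j`. -/
theorem cyclic (h : IsThreeSasaki g nabla i j k) : IsThreeSasaki g nabla j k i :=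
  ⟨h.leviCivita, h.sasaki_j, h.sasaki_k, h.sasaki_i, h.orthogonal_jk, h.orthogonal_ki,
    h.orthogonal_ij, h.bracket_jk, h.bracket_ki, h.bracket_ij⟩

variable [T2Space M]

theorem D_i_j (h : IsThreeSasaki g nabla i j k) (x : M) : nabla.D i x (j x) = k x :=
  (h.sasaki_i.D_apply_of_bracket h.sasaki_j h.leviCivita h.orthogonal_ij h.bracket_ij x).1

theorem D_j_i (h : IsThreeSasaki g nabla i j k) (x : M) : nabla.D j x (i x) = -k x :=
  (h.sasaki_i.D_apply_of_bracket h.sasaki_j h.leviCivita h.orthogonal_ij h.bracket_ij x).2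

theorem D_i_D_j (h : IsThreeSasaki g nabla i j k) (v : TangentSpace 𝓘(ℝ, E) x) :
    nabla.D i x (nabla.D j x v) = nabla.D k x v + g.inner x (j x) v • i x := by
  rw [h.sasaki_i.D_comp_of_apply h.sasaki_j h.sasaki_k.smooth 1 h.orthogonal_ij
    (fun x => by rw [h.D_i_j, one_smul]), one_smul]

theorem D_j_D_i (h : IsThreeSasaki g nabla i j k) (v : TangentSpace 𝓘(ℝ, E) x) :
    nabla.D j x (nabla.D i x v) = -nabla.D k x v + g.inner x (i x) v • j x := by
  rw [h.sasaki_j.D_comp_of_apply h.sasaki_i h.sasaki_k.smooth (-1)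
    (fun x => by rw [g.inner_symm, h.orthogonal_ij])
    (fun x => by rw [h.D_j_i, neg_one_smul]), neg_one_smul]

end IsThreeSasaki

/-- The curvature of constant sectional curvature `1`. -/
def constantCurvature (g : PseudoRiemannianMetric E M r s) (x : M) :
    TangentSpace 𝓘(ℝ, E) x →ₗ[ℝ] TangentSpace 𝓘(ℝ, E) x →ₗ[ℝ]
      Module.End ℝ (TangentSpace 𝓘(ℝ, E) x) :=
  LinearMap.mk₂ ℝ (fun u v => (g.form x v).smulRight u - (g.form x u).smulRight v)
    (fun u u' v => by ext w; simp; module) (fun c u v => by ext w; simp; module)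
    (fun u v v' => by ext w; simp; module) (fun c u v => by ext w; simp; module)

variable [T2Space M]

/-- A 3-Sasaki metric is Einstein. -/
theorem IsThreeSasaki.ricci_eq (h : IsThreeSasaki g nabla i j k)
    (v w : TangentSpace 𝓘(ℝ, E) x) :
    ricci nabla x v w = ((Module.finrank ℝ E : ℝ) - 1) * g.inner x v w := by
  let W := curvatureHom nabla x - constantCurvature g x
  have hW : ∀ u v w, W u v w =
      curvature nabla x u v w - (g.inner x v w • u - g.inner x u w • v) := fun u v w => rfl
  let ξ : Fin 3 → Π y : M, TangentSpace 𝓘(ℝ, E) y := ![i, j, k]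
  have hξ : ∀ a, IsSasaki g nabla (ξ a) := by
    intro a
    fin_cases a
    exacts [h.sasaki_i, h.sasaki_j, h.sasaki_k]
  have hflat : LinearMap.trace ℝ (TangentSpace 𝓘(ℝ, E) x) ((W.flip v).flip w) = 0 := by
    refine trace_curvature_eq_zero W ?_ ?_ ?_ (fun a => (nabla.D (ξ a) x).toLinearMap)
      (fun a => ξ a x) ?_ ?_ ?_ ?_ ?_ v w
    · intro u v
      ext w
      rw [LinearMap.neg_apply, hW, hW, curvature_swap nabla u v]
      module
    · intro u v w
      have hb := curvature_bianchi nabla u v w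
      rw [hW, hW, hW, g.inner_symm v u, g.inner_symm w u, g.inner_symm w v]
      linear_combination (norm := module) hb
    · intro u v
      refine trace_eq_zero_of_skew (g.form x) (g.innerProduct x).nondegenerate _ fun w z => ?_
      rw [form_apply, form_apply, hW, hW, map_sub, map_sub, _root_.sub_apply,
        h.leviCivita.inner_curvature]
      simp only [map_sub, map_smul, _root_.sub_apply, _root_.smul_apply, smul_eq_mul]
      rw [g.inner_symm w u, g.inner_symm w v]
      ring
    · intro a u v
      rw [hW, (hξ a).curvature_apply, sub_self]
    · intro a u v w
      have hc := (hξ a).curvature_D h.leviCivita u v w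
      change W u v (nabla.D (ξ a) x w) = nabla.D (ξ a) x (W u v w)
      rw [hW, hW, map_sub, map_sub, map_smul, map_smul,
        ← neg_eq_iff_eq_neg.2 ((hξ a).toIsKilling.skew h.leviCivita v w),
        ← neg_eq_iff_eq_neg.2 ((hξ a).toIsKilling.skew h.leviCivita u w)]
      linear_combination (norm := module) hc
    · intro a w
      fin_cases a
      exacts [⟨_, h.D_i_D_j w⟩, ⟨_, h.cyclic.D_i_D_j w⟩, ⟨_, h.cyclic.cyclic.D_i_D_j w⟩]
    · intro a w
      fin_cases a
      exacts [⟨_, h.D_j_D_i w⟩, ⟨_, h.cyclic.D_j_D_i w⟩, ⟨_, h.cyclic.cyclic.D_j_D_i w⟩]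
    · intro a w
      exact ⟨_, (hξ a).D_comp_self h.leviCivita w⟩
  -- The subtracted endomorphism has trace $(N-1)\,g(v,w)$: the identity contributes $N$ and the
  -- rank one term removes 1.
  have hsplit : (W.flip v).flip w = ricciEnd nabla v w
      - (g.inner x v w • LinearMap.id - ((g.form x).flip w).smulRight v) := by
    ext u
    rfl
  rw [hsplit, map_sub, map_sub, map_smul, LinearMap.trace_smulRight, LinearMap.trace_id,
    ← ricci_apply] at hflat
  have hN : Module.finrank ℝ (TangentSpace 𝓘(ℝ, E) x) = Module.finrank ℝ E := rfl
  have hv : (g.form x).flip w v = g.inner x v w := rfl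
  rw [hN, hv, smul_eq_mul] at hflat
  linarith

theorem IsThreeSasaki.schouten_eq (h : IsThreeSasaki g nabla i j k) (hN : 1 < Module.finrank ℝ E)
    (v w : TangentSpace 𝓘(ℝ, E) x) : schouten nabla x v w = g.inner x v w := by
  have h1 : (1 : ℝ) < Module.finrank ℝ E := by exact_mod_cast hN
  have h2 : (Module.finrank ℝ E : ℝ) - 1 ≠ 0 := by linarith
  have h3 : (Module.finrank ℝ E : ℝ) + 1 ≠ 0 := by linarith
  simp only [schouten, LinearMap.smul_apply, LinearMap.add_apply, LinearMap.flip_apply,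
    h.ricci_eq, smul_eq_mul, g.inner_symm w v]
  field_simp

end ThreeSasaki

/-! ### The effect of a projective change of connection. -/

section ProjectiveChange

set_option linter.unusedSectionVars false

variable {E : Type*} [NormedAddCommGroup E] [NormedSpace ℝ E] [FiniteDimensional ℝ E]
variable {M : Type*} [TopologicalSpace M] [ChartedSpace E M] [IsManifold 𝓘(ℝ, E) ∞ M]
variable {nabla nabla' : AffineConnection E M}
variable {Υ : Π x : M, TangentSpace 𝓘(ℝ, E) x →L[ℝ] ℝ}

/-- No linearity of `f` is needed, so the change in `connectionTrace` can be found without showing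
that its integrand is linear. -/
theorem linearize_add {V W : Type*} [AddCommGroup V] [Module ℝ V] [FiniteDimensional ℝ V]
    [AddCommGroup W] [Module ℝ W] (f : V → W) (L : V →ₗ[ℝ] W) :
    (linearize fun v => f v + L v) = linearize f + L := by
  refine (Module.finBasis ℝ V).ext fun i => ?_
  rw [LinearMap.add_apply, linearize, linearize, Module.Basis.constr_basis,
    Module.Basis.constr_basis]

/-- `∇'` is the projective change of `∇` by the 1-form `Υ`. -/
structure IsProjectiveChange (nabla nabla' : AffineConnection E M)
    (Υ : Π x : M, TangentSpace 𝓘(ℝ, E) x →L[ℝ] ℝ) : Prop where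
  smooth : ∀ x, SmoothFormNear Υ x
  D_eq : ∀ (x : M) (Y : Π y : M, TangentSpace 𝓘(ℝ, E) y), DiffFieldAt Y x →
    ∀ v : TangentSpace 𝓘(ℝ, E) x,
      nabla'.D Y x v = nabla.D Y x v + Υ x v • Y x + Υ x (Y x) • v

theorem exists_isProjectiveChange (h : nabla' ∈ projectiveClass nabla) :
    ∃ Υ, IsProjectiveChange nabla nabla' Υ := by
  obtain ⟨Υ, hΥ, hD⟩ := h
  exact ⟨Υ, smoothFormNear_of_contMDiff hΥ, hD⟩

namespace IsProjectiveChange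

variable [T2Space M]
variable {x : M} {W : Π y : M, TangentSpace 𝓘(ℝ, E) y}

theorem secondD_eq (h : IsProjectiveChange nabla nabla' Υ)
    (hW : SmoothFieldNear W x) (u v : TangentSpace 𝓘(ℝ, E) x) :
    secondD nabla' W x u v = secondD nabla W x u v + oneFormD nabla Υ x u v • W x
      + oneFormD nabla Υ x u (W x) • v + Υ x (nabla.D W x u) • v + Υ x (nabla.D W x v) • u
      - (Υ x u * Υ x v) • W x + (Υ x v * Υ x (W x)) • u := by
  have hV := smoothFieldNear_extendField v
  have ha := h.smooth x _ hV
  have hb := h.smooth x _ hW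
  have hDW := nabla.D_smooth hW hV
  have hS := hDW.add ((ha.smul_field hW).add (hb.smul_field hV))
  have h1 : nabla'.D (fun y => nabla'.D W y (extendField v y)) x =
      nabla'.D ((fun y => nabla.D W y (extendField v y)) +
        ((fun y => Υ y (extendField v y)) • W + (fun y => Υ y (W y)) • extendField v)) x := by
    refine nabla'.D_congr (nabla'.D_smooth hW hV).diff hS.diff ?_
    filter_upwards [hW.eventually] with y hy
    rw [h.D_eq y W hy.diff, add_assoc]
    rfl
  rw [oneFormD_eq (h.smooth x) hW, secondD, h1, h.D_eq _ _ hS.diff, h.D_eq _ _ hW.diff,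
    h.D_eq _ _ hV.diff, nabla.D_add hDW.diff ((ha.smul_field hW).add (hb.smul_field hV)).diff,
    nabla.D_add (ha.smul_field hW).diff (hb.smul_field hV).diff, _root_.add_apply,
    _root_.add_apply, nabla.D_smul ha.diff hW.diff, nabla.D_smul hb.diff hV.diff, secondD, oneFormD]
  simp only [Pi.add_apply, Pi.smul_apply', extendField_self, map_add, map_smul, smul_eq_mul]
  module

theorem curvature_eq (h : IsProjectiveChange nabla nabla' Υ) (u v w : TangentSpace 𝓘(ℝ, E) x) :
    curvature nabla' x u v w = curvature nabla x u v w
      + (oneFormD nabla Υ x u v - oneFormD nabla Υ x v u) • w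
      + oneFormD nabla Υ x u w • v - oneFormD nabla Υ x v w • u
      + (Υ x v * Υ x w) • u - (Υ x u * Υ x w) • v := by
  have hW := smoothFieldNear_extendField w
  rw [curvature_eq_extendField, curvature_eq_extendField, h.secondD_eq hW, h.secondD_eq hW]
  simp only [extendField_self]
  module

theorem ricci_eq (h : IsProjectiveChange nabla nabla' Υ) (v w : TangentSpace 𝓘(ℝ, E) x) :
    ricci nabla' x v w = ricci nabla x v w + oneFormD nabla Υ x w v
      - (Module.finrank ℝ E : ℝ) * oneFormD nabla Υ x v w
      + ((Module.finrank ℝ E : ℝ) - 1) * (Υ x v * Υ x w) := by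
  let A := oneFormDHom nabla (h.smooth x)
  -- The change is a sum of rank one endomorphisms and a multiple of the identity, whose traces can
  -- be read off.
  have hsplit : ricciEnd nabla' v w = ricciEnd nabla v w + (A.flip v).smulRight w
      - (A v).smulRight w + (A.flip w).smulRight v + (Υ x v * Υ x w - A v w) • LinearMap.id
      - Υ x w • (Υ x).toLinearMap.smulRight v := by
    refine LinearMap.ext fun u => ?_
    rw [ricciEnd_apply, h.curvature_eq]
    change _ = ricciEnd nabla v w u + oneFormD nabla Υ x u v • w - oneFormD nabla Υ x v u • w
      + oneFormD nabla Υ x u w • v + (Υ x v * Υ x w - oneFormD nabla Υ x v w) • u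
      - Υ x w • Υ x u • v
    rw [ricciEnd_apply]
    module
  have hN : Module.finrank ℝ (TangentSpace 𝓘(ℝ, E) x) = Module.finrank ℝ E := rfl
  have hA : ∀ u v, A u v = oneFormD nabla Υ x u v := fun u v => rfl
  have hA' : ∀ u v, A.flip u v = oneFormD nabla Υ x v u := fun u v => rfl
  have hΥ : (Υ x).toLinearMap v = Υ x v := rfl
  rw [ricci_apply, ricci_apply, hsplit]
  simp only [map_add, map_sub, map_smul, LinearMap.trace_smulRight, LinearMap.trace_id, hN, hA, hA',
    hΥ, smul_eq_mul]
  ring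

/-- The projective change of the Schouten tensor. -/
theorem schouten_eq (h : IsProjectiveChange nabla nabla' Υ)
    (hN : 1 < Module.finrank ℝ E) (v w : TangentSpace 𝓘(ℝ, E) x) :
    schouten nabla' x v w = schouten nabla x v w - oneFormD nabla Υ x v w + Υ x v * Υ x w := by
  have h1 : (1 : ℝ) < Module.finrank ℝ E := by exact_mod_cast hN
  have h2 : (Module.finrank ℝ E : ℝ) - 1 ≠ 0 := by linarith
  have h3 : (Module.finrank ℝ E : ℝ) + 1 ≠ 0 := by linarith
  simp only [schouten, LinearMap.smul_apply, LinearMap.add_apply, LinearMap.flip_apply,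
    h.ricci_eq, smul_eq_mul]
  field_simp
  ring

theorem connectionTrace_eq (h : IsProjectiveChange nabla nabla' Υ)
    (x : M) (v : TangentSpace 𝓘(ℝ, E) x) :
    connectionTrace nabla' x v =
      connectionTrace nabla x v + ((Module.finrank ℝ E : ℝ) + 1) * Υ x v := by
  let L : TangentSpace 𝓘(ℝ, E) x →ₗ[ℝ] TangentSpace 𝓘(ℝ, E) x →ₗ[ℝ] TangentSpace 𝓘(ℝ, E) x :=
    LinearMap.mk₂ ℝ (fun u v => Υ x v • u + Υ x u • v)
      (by intro a b c; simp only [map_add]; module)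
      (by intro a b c; simp only [map_smul, smul_eq_mul]; module)
      (by intro a b c; simp only [map_add]; module)
      (by intro a b c; simp only [map_smul, smul_eq_mul]; module)
  have h1 : (fun u : TangentSpace 𝓘(ℝ, E) x => (nabla'.D (extendField u) x).toLinearMap) =
      fun u => (nabla.D (extendField u) x).toLinearMap + L u := by
    funext u
    refine LinearMap.ext fun v => ?_
    change nabla'.D (extendField u) x v =
      nabla.D (extendField u) x v + (Υ x v • u + Υ x u • v)
    rw [h.D_eq _ _ (smoothFieldNear_extendField u).diff, extendField_self, add_assoc]
  have h2 : L.flip v = Υ x v • LinearMap.id + (Υ x).toLinearMap.smulRight v := by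
    refine LinearMap.ext fun u => ?_
    rfl
  have hN : Module.finrank ℝ (TangentSpace 𝓘(ℝ, E) x) = Module.finrank ℝ E := rfl
  have hΥ : (Υ x).toLinearMap v = Υ x v := rfl
  have h3 : LinearMap.trace ℝ (TangentSpace 𝓘(ℝ, E) x) (L.flip v) =
      ((Module.finrank ℝ E : ℝ) + 1) * Υ x v := by
    rw [h2]
    simp only [map_add, map_smul, LinearMap.trace_smulRight, LinearMap.trace_id, hN, hΥ,
      smul_eq_mul]
    ring
  simp only [connectionTrace, LinearMap.comp_apply]
  rw [h1, linearize_add, ← h3, ← map_add]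
  exact congrArg _ (LinearMap.ext fun u => rfl)

/-- The trace of the connection form changes by $(N+1)\Upsilon$, and weight one divides it by
exactly $N+1$. -/
theorem densityD_eq (h : IsProjectiveChange nabla nabla' Υ)
    (σ : Π y : M, Density E y) (x : M) (v : TangentSpace 𝓘(ℝ, E) x) :
    densityD nabla' σ x v = densityD nabla σ x v + Υ x v • σ x := by
  have h3 : (Module.finrank ℝ E : ℝ) + 1 ≠ 0 := by positivity
  have h4 : (1 / ((Module.finrank ℝ E : ℝ) + 1)) * (((Module.finrank ℝ E : ℝ) + 1) * Υ x v) =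
    Υ x v := by field_simp
  simp only [densityD, LinearMap.add_apply, LinearMap.smul_apply, LinearMap.smulRight_apply,
    h.connectionTrace_eq]
  rw [add_smul, smul_add, smul_smul _ (_ * _), h4, add_assoc]

theorem splitting_eq (h : IsProjectiveChange nabla nabla' Υ) (x : M) (a : Cotractor E x) :
    splitting nabla' x a = ((splitting nabla x a).1 +
      (Υ x).toLinearMap.smulRight (splitting nabla x a).2, (splitting nabla x a).2) := by
  have h3 : (Module.finrank ℝ E : ℝ) + 1 ≠ 0 := by positivity
  refine Prod.ext ?_ rfl
  refine LinearMap.ext fun v => ?_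
  change (jetEquiv E x a).1 v + (1 / ((Module.finrank ℝ E : ℝ) + 1)) •
    (connectionTrace nabla' x v • (jetEquiv E x a).2) = (jetEquiv E x a).1 v +
      (1 / ((Module.finrank ℝ E : ℝ) + 1)) • (connectionTrace nabla x v • (jetEquiv E x a).2)
      + Υ x v • (jetEquiv E x a).2
  have h4 : (1 / ((Module.finrank ℝ E : ℝ) + 1)) * (((Module.finrank ℝ E : ℝ) + 1) * Υ x v) =
    Υ x v := by field_simp
  rw [h.connectionTrace_eq, add_smul, smul_add, smul_smul _ (_ * _), h4, add_assoc]

end IsProjectiveChange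

end ProjectiveChange

/-! ### Derivatives of determinants by dual numbers. -/

section DetDerivative

set_option linter.unusedSectionVars false

variable {E : Type*} [NormedAddCommGroup E] [NormedSpace ℝ E] [FiniteDimensional ℝ E]
variable {M : Type*} [TopologicalSpace M] [ChartedSpace E M] [IsManifold 𝓘(ℝ, E) ∞ M]

variable (E) in
/-- The ring of functions which are differentiable at `x`. -/
def differentiableAtSubring (x : M) : Subring (M → ℝ) where
  carrier := {f | MDifferentiableAt 𝓘(ℝ, E) 𝓘(ℝ, ℝ) f x}
  mul_mem' hf hg := hf.mul hg
  one_mem' := mdifferentiableAt_const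
  add_mem' hf hg := hf.add hg
  zero_mem' := mdifferentiableAt_const
  neg_mem' hf := hf.neg

/-- The value and the derivative along `v` of a function, as a dual number. -/
def dualNumberHom {x : M} (v : TangentSpace 𝓘(ℝ, E) x) :
    differentiableAtSubring E x →+* DualNumber ℝ where
  toFun f := TrivSqZeroExt.inl (f.1 x) + TrivSqZeroExt.inr (mvfderiv 𝓘(ℝ, E) f.1 x v)
  map_one' := by
    have h : mvfderiv 𝓘(ℝ, E) (1 : M → ℝ) x = 0 := mvfderiv_const 1
    ext <;> simp [h]
  map_zero' := by
    have h : mvfderiv 𝓘(ℝ, E) (0 : M → ℝ) x = 0 := mvfderiv_const 0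
    ext <;> simp [h]
  map_add' f g := by
    ext <;> simp [mvfderiv_add f.2 g.2]
  map_mul' f g := by
    ext
    · simp
    · simp [mvfderiv_mul f.2 g.2, mul_comm]

variable {n : Type*} [Fintype n] [DecidableEq n]

/-- If `dG = Γᵀ G + G Γ`, then `d(det G) = 2 (tr Γ) det G`. -/
theorem mvfderiv_det {x : M} {G : M → Matrix n n ℝ}
    (hG : ∀ a b, MDifferentiableAt 𝓘(ℝ, E) 𝓘(ℝ, ℝ) (fun y => G y a b) x)
    (v : TangentSpace 𝓘(ℝ, E) x) (Γ : Matrix n n ℝ)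
    (h : ∀ a b, mvfderiv 𝓘(ℝ, E) (fun y => G y a b) x v = (Γ.transpose * G x + G x * Γ) a b) :
    mvfderiv 𝓘(ℝ, E) (fun y => (G y).det) x v = 2 * Γ.trace * (G x).det := by
  let A : Matrix n n (differentiableAtSubring E x) :=
    Matrix.of fun a b => ⟨fun y => G y a b, hG a b⟩
  let i : ℝ →+* DualNumber ℝ := TrivSqZeroExt.inlHom ℝ ℝ
  let ε : DualNumber ℝ := DualNumber.eps
  have hε : ε * ε = 0 := DualNumber.eps_mul_eps
  -- The hypothesis on `dG` says that to first order `G` is multiplied by $1+\varepsilon\Gamma^T$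
  -- and $1+\varepsilon\Gamma$. Determinants commute with ring homomorphisms, and
  -- $\det(1+\varepsilon B)=1+\varepsilon\,\mathrm{tr}\,B$.
  have hA : (dualNumberHom v).mapMatrix A =
      (1 + ε • i.mapMatrix Γ.transpose) * i.mapMatrix (G x) * (1 + ε • i.mapMatrix Γ) := by
    have h1 : (1 + ε • i.mapMatrix Γ.transpose) * i.mapMatrix (G x) * (1 + ε • i.mapMatrix Γ) =
        i.mapMatrix (G x) + ε • i.mapMatrix (Γ.transpose * G x + G x * Γ) := by
      rw [map_add, map_mul, map_mul]
      simp only [add_mul, mul_add, one_mul, mul_one, smul_mul_assoc, mul_smul_comm, smul_smul, hε,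
        zero_smul, smul_add, add_zero]
      abel
    rw [h1]
    ext a b
    · simp [A, dualNumberHom, i, ε, TrivSqZeroExt.fst_inl]
    · simp [A, dualNumberHom, i, ε, h]
  have hdet : dualNumberHom v A.det = (1 + i (Γ.transpose.trace) * ε) * i (G x).det *
      (1 + i Γ.trace * ε) := by
    have h2 : ∀ B : Matrix n n ℝ, (1 + ε • i.mapMatrix B).det = 1 + i B.trace * ε := by
      intro B
      rw [Matrix.det_one_add_smul, pow_two, hε, mul_zero, add_zero, RingHom.mapMatrix_apply]
      exact congrArg (fun d => 1 + d * ε) (AddMonoidHom.map_trace i.toAddMonoidHom B).symm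
    rw [RingHom.map_det, hA, Matrix.det_mul, Matrix.det_mul, h2, h2, ← RingHom.map_det]
  have hs : (A.det : M → ℝ) = fun y => (G y).det := by
    funext y
    have h3 := RingHom.map_det ((Pi.evalRingHom (fun _ : M => ℝ) y).comp
      (differentiableAtSubring E x).subtype) A
    exact h3
  have h4 := congrArg TrivSqZeroExt.snd hdet
  have h5 : TrivSqZeroExt.snd (dualNumberHom v A.det) =
      mvfderiv 𝓘(ℝ, E) (A.det : M → ℝ) x v := by
    simp [dualNumberHom]
  rw [h5, hs] at h4
  rw [h4]
  simp [i, ε]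
  ring

/-- The behaviour of the Gram determinant of a bilinear form under a change of frame. -/
theorem det_gram_comp {V : Type*} [AddCommGroup V] [Module ℝ V] (b : Module.Basis n ℝ V)
    (F : LinearMap.BilinForm ℝ V) (L A : V →ₗ[ℝ] V) (h : ∀ a, A (L (b a)) = b a) :
    (Matrix.of fun a c => F (b a) (b c)).det =
      LinearMap.det A ^ 2 * (Matrix.of fun a c => F (L (b a)) (L (b c))).det := by
  have h1 : (Matrix.of fun a c => F (L (b a)) (L (b c))) =
      (LinearMap.toMatrix b b L).transpose * (Matrix.of fun a c => F (b a) (b c)) *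
        LinearMap.toMatrix b b L := by
    have h2 := LinearMap.BilinForm.toMatrix_comp b b F L L
    rw [← show LinearMap.BilinForm.toMatrix b F = Matrix.of fun a c => F (b a) (b c) from
      Matrix.ext fun a c => LinearMap.BilinForm.toMatrix_apply b F a c, ← h2]
    exact Matrix.ext fun a c => (LinearMap.BilinForm.toMatrix_apply b (F.comp L L) a c).symm
  have h3 : A ∘ₗ L = LinearMap.id := b.ext h
  have h4 := congrArg LinearMap.det h3
  rw [LinearMap.det_comp, LinearMap.det_id] at h4
  rw [h1, Matrix.det_mul, Matrix.det_mul, Matrix.det_transpose, LinearMap.det_toMatrix]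
  linear_combination (-(LinearMap.det A * LinearMap.det L) - 1) *
    (Matrix.of fun a c => F (b a) (b c)).det * h4

end DetDerivative

/-! ### The parallel density of a metric. -/

section MetricDensity

set_option linter.unusedSectionVars false

variable {E : Type*} [NormedAddCommGroup E] [NormedSpace ℝ E] [FiniteDimensional ℝ E]
variable {M : Type*} [TopologicalSpace M] [ChartedSpace E M] [IsManifold 𝓘(ℝ, E) ∞ M]
variable {r s : ℕ} {g : PseudoRiemannianMetric E M r s} {nabla : AffineConnection E M}
variable {x : M}

/-- The coordinate change from the chart at `y` to the chart at `x` takes the extension of `v` at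
`x` back to `v`. -/
theorem coordChange_extendField (v : E) {y : M} (hy : y ∈ (chartAt E x).source) :
    (tangentBundleCore 𝓘(ℝ, E) M).coordChange (achart E y) (achart E x) y
      (extendField (x := x) v y) = v := by
  have h0 := congrArg Prod.snd
    ((trivializationAt E (TangentSpace 𝓘(ℝ, E) : M → Type _) x).apply_mk_symm (b := y) hy
      (trivializationAt E (TangentSpace 𝓘(ℝ, E) : M → Type _) x ⟨x, v⟩).2)
  have h1 : (tangentBundleCore 𝓘(ℝ, E) M).coordChange (achart E y) (achart E x) y
      (extendField (x := x) v y) =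
      (trivializationAt E (TangentSpace 𝓘(ℝ, E) : M → Type _) x ⟨x, v⟩).2 := h0
  rw [h1]
  exact (tangentBundleCore 𝓘(ℝ, E) M).coordChange_self (achart E x) x (mem_chart_source E x) v

/-- The basis of the tangent space at `x` given by a fixed basis of the model space. -/
def coordFrame (x : M) : Module.Basis (Fin (Module.finrank ℝ E)) ℝ (TangentSpace 𝓘(ℝ, E) x) :=
  Module.finBasis ℝ E

theorem linearize_coordFrame {W : Type*} [AddCommGroup W] [Module ℝ W]
    (f : TangentSpace 𝓘(ℝ, E) x → W) (a : Fin (Module.finrank ℝ E)) :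
    linearize f (coordFrame x a) = f (coordFrame x a) :=
  Module.Basis.constr_basis (Module.finBasis ℝ (TangentSpace 𝓘(ℝ, E) x)) ℝ _ a

variable (g) in
/-- The Gram matrix of the metric at `y` in the coordinate frame of the chart at `x`. -/
def gram (x y : M) : Matrix (Fin (Module.finrank ℝ E)) (Fin (Module.finrank ℝ E)) ℝ :=
  Matrix.of fun a b => g.inner y (extendField (coordFrame x a) y) (extendField (coordFrame x b) y)

theorem gram_det_self_ne_zero (x : M) : (gram g x x).det ≠ 0 := by
  have h : gram g x x = LinearMap.BilinForm.toMatrix (coordFrame x) (g.form x) := by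
    ext a b
    simp [gram, LinearMap.BilinForm.toMatrix_apply]
  rw [h]
  refine (LinearMap.BilinForm.nondegenerate_iff_det_ne_zero _).1 ?_
  exact ⟨fun v hv => g.eq_zero_of_inner v hv,
    fun v hv => g.eq_zero_of_inner v fun w => (g.inner_symm v w).trans (hv w)⟩

theorem gram_det_eq {y : M} (hy : y ∈ (chartAt E x).source) :
    (gram g y y).det = ((tangentBundleCore 𝓘(ℝ, E) M).coordChange
      (achart E y) (achart E x) y).det ^ 2 * (gram g x y).det := by
  let b := Module.finBasis ℝ E
  let L : E →ₗ[ℝ] E := b.constr ℝ (fun a => (extendField (x := x) (b a) y : E))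
  have hL : ∀ a, L (b a) = extendField (x := x) (b a) y :=
    fun a => Module.Basis.constr_basis _ _ _ _
  have h := det_gram_comp b (g.form y) L ((tangentBundleCore 𝓘(ℝ, E) M).coordChange
      (achart E y) (achart E x) y : E →L[ℝ] E).toLinearMap fun a => by
    rw [hL]
    exact coordChange_extendField (x := x) (b a) hy
  have h1 : gram g y y = Matrix.of fun a c => g.form y (b a) (b c) := by
    ext a c
    simp only [gram, Matrix.of_apply, extendField_self]
    rfl
  have h2 : gram g x y = Matrix.of fun a c => g.form y (L (b a)) (L (b c)) := by
    ext a c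
    simp only [gram, Matrix.of_apply, hL]
    rfl
  rw [h1, h2]
  exact h

theorem gram_det_ne_zero {y : M} (hy : y ∈ (chartAt E x).source) : (gram g x y).det ≠ 0 := by
  intro h
  apply gram_det_self_ne_zero (g := g) y
  rw [gram_det_eq hy, h, mul_zero]

variable (g) in
/-- The density of weight one determined by the metric, `|det g|^{-1/(2N+2)}`. -/
def metricDensity (x : M) : Density E x :=
  densityUnit E x (((gram g x x).det ^ 2) ^ (-(1 / (4 * (Module.finrank ℝ E : ℝ) + 4))))

theorem localRep_metricDensity {y : M} (hy : y ∈ (chartAt E x).source) :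
    localRep E x (metricDensity g) y =
      ((gram g x y).det ^ 2) ^ (-(1 / (4 * (Module.finrank ℝ E : ℝ) + 4))) := by
  have h1 : localRep E x (metricDensity g) y = densityFactor E M (achart E y) (achart E x) y *
      ((gram g y y).det ^ 2) ^ (-(1 / (4 * (Module.finrank ℝ E : ℝ) + 4))) := rfl
  have hA := tangent_det_ne_zero E M (achart E y) (achart E x) (mem_chart_source E y) hy
  rw [h1, densityFactor, gram_det_eq hy]
  set d := ((tangentBundleCore 𝓘(ℝ, E) M).coordChange (achart E y) (achart E x) y).det
  have hd : 0 < d ^ 2 := by positivity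
  rw [mul_pow, Real.mul_rpow (by positivity) (by positivity), ← mul_assoc,
    ← Real.rpow_natCast (d ^ 2) 2, ← Real.rpow_mul hd.le, ← Real.rpow_add hd]
  -- A change of chart multiplies the squared Gram determinant by $d^4=(d^2)^2$. The exponent is
  -- chosen so that this cancels the transition factor of $\mathcal E(1)$.
  have h2 : 1 / (2 * (Module.finrank ℝ E : ℝ) + 2) +
      ((2 : ℕ) : ℝ) * -(1 / (4 * (Module.finrank ℝ E : ℝ) + 4)) = 0 := by
    have h3 : (Module.finrank ℝ E : ℝ) + 1 ≠ 0 := by positivity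
    have h4 : 2 * (Module.finrank ℝ E : ℝ) + 2 ≠ 0 := by positivity
    have h5 : 4 * (Module.finrank ℝ E : ℝ) + 4 ≠ 0 := by positivity
    push_cast
    field_simp
    ring
  rw [h2, Real.rpow_zero, one_mul]

theorem metricDensity_ne_zero (x : M) : metricDensity g x ≠ 0 := by
  rw [metricDensity, Ne, LinearEquiv.map_eq_zero_iff]
  have := gram_det_self_ne_zero (g := g) x
  positivity

theorem gram_smooth (x : M) (a b : Fin (Module.finrank ℝ E)) :
    SmoothFunNear E (fun y => gram g x y a b) x :=
  PseudoRiemannianMetric.inner_smooth (smoothFieldNear_extendField _)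
    (smoothFieldNear_extendField _)

theorem gram_det_smooth (x : M) : ContMDiffAt 𝓘(ℝ, E) 𝓘(ℝ, ℝ) ∞ (fun y => (gram g x y).det) x := by
  simp only [Matrix.det_apply']
  refine ContMDiffAt.sum fun σ _ => contMDiffAt_const.mul ?_
  exact contMDiffAt_finsetProd fun i _ => (gram_smooth x _ _).contMDiffAt

theorem rpow_gram_smooth (x : M) : ContMDiffAt 𝓘(ℝ, E) 𝓘(ℝ, ℝ) ∞
    (fun y => ((gram g x y).det ^ 2) ^ (-(1 / (4 * (Module.finrank ℝ E : ℝ) + 4)))) x := by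
  have h3 : ContDiffAt ℝ ∞ (fun d : ℝ => (d ^ 2) ^ (-(1 / (4 * (Module.finrank ℝ E : ℝ) + 4))))
      ((gram g x x).det) :=
    ContDiffAt.rpow_const_of_ne (contDiffAt_id.pow 2) (pow_ne_zero 2 (gram_det_self_ne_zero x))
  exact h3.contMDiffAt.comp x (gram_det_smooth x)

theorem localRep_metricDensity_eventuallyEq (x : M) :
    localRep E x (metricDensity g) =ᶠ[𝓝 x]
      fun y => ((gram g x y).det ^ 2) ^ (-(1 / (4 * (Module.finrank ℝ E : ℝ) + 4))) := by
  filter_upwards [(chartAt E x).open_source.mem_nhds (mem_chart_source E x)] with y hy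
  exact localRep_metricDensity hy

theorem localRep_metricDensity_smooth (x : M) :
    ContMDiffAt 𝓘(ℝ, E) 𝓘(ℝ, ℝ) ∞ (localRep E x (metricDensity g)) x :=
  (rpow_gram_smooth x).congr_of_eventuallyEq (localRep_metricDensity_eventuallyEq x)

variable (g) in
theorem smoothDensityOn_metricDensity (U : Set M) : SmoothDensityOn E (metricDensity g) U := by
  intro x _
  refine ContMDiffAt.contMDiffWithinAt ?_
  rw [contMDiffAt_section]
  exact localRep_metricDensity_smooth x

/-- Metric compatibility in a coordinate frame reads $dG=\Gamma^TG+G\Gamma$, where $\Gamma$ is the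
connection matrix along `v`. -/
theorem mvfderiv_gram_det (hg : IsLeviCivita g nabla) (v : TangentSpace 𝓘(ℝ, E) x) :
    mvfderiv 𝓘(ℝ, E) (fun y => (gram g x y).det) x v =
      2 * connectionTrace nabla x v * (gram g x x).det := by
  let Γ : Matrix (Fin (Module.finrank ℝ E)) (Fin (Module.finrank ℝ E)) ℝ :=
    Matrix.of fun c a => (coordFrame x).repr (nabla.D (extendField (coordFrame x a)) x v) c
  have hΓ : ∀ a, nabla.D (extendField (coordFrame x a)) x v = ∑ c, Γ c a • coordFrame x c :=
    fun a => ((coordFrame x).sum_repr _).symm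
  have ht : connectionTrace nabla x v = Γ.trace := by
    simp only [connectionTrace, LinearMap.comp_apply]
    rw [LinearMap.trace_eq_matrix_trace ℝ (coordFrame x)]
    refine congrArg Matrix.trace (Matrix.ext fun c a => ?_)
    rw [LinearMap.toMatrix_apply, LinearMap.flip_apply, linearize_coordFrame]
    rfl
  rw [ht]
  refine mvfderiv_det (fun a b => (gram_smooth x a b).diff) v Γ fun a b => ?_
  refine (hg.mvfderiv_inner (smoothFieldNear_extendField _)
    (smoothFieldNear_extendField _) v).trans ?_
  rw [hΓ, hΓ, map_sum, map_sum, _root_.sum_apply]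
  simp only [map_smul, _root_.smul_apply, Matrix.add_apply, gram, Matrix.of_apply,
    extendField_self, smul_eq_mul]
  refine congrArg₂ _ rfl (Finset.sum_congr rfl fun c _ => mul_comm _ _)

/-- The density determined by a metric is parallel for its Levi-Civita connection. -/
theorem densityD_metricDensity (hg : IsLeviCivita g nabla) (x : M) :
    densityD nabla (metricDensity g) x = 0 := by
  refine LinearMap.ext fun v => ?_
  set d := (gram g x x).det with hd
  set e : ℝ := -(1 / (4 * (Module.finrank ℝ E : ℝ) + 4)) with he
  have hd0 : d ≠ 0 := gram_det_self_ne_zero x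
  have hF : HasDerivAt (fun z : ℝ => (z ^ 2) ^ e) (e * (d ^ 2) ^ (e - 1) * (2 * d)) d := by
    have h1 := (hasDerivAt_pow 2 d).rpow_const (p := e) (Or.inl (pow_ne_zero 2 hd0))
    convert h1 using 1
    push_cast
    ring
  have hcomp := mvfderiv_comp_apply (I := 𝓘(ℝ, ℝ)) (I' := 𝓘(ℝ, E)) x
    hF.hasFDerivAt.hasMFDerivAt.mdifferentiableAt
    ((gram_det_smooth (g := g) x).mdifferentiableAt (by simp)) v
  have h2 : mvfderiv 𝓘(ℝ, E) (localRep E x (metricDensity g)) x v =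
      e * (d ^ 2) ^ (e - 1) * (2 * d) * (2 * connectionTrace nabla x v * d) := by
    rw [ProjectiveTractor.mvfderiv_congr (localRep_metricDensity_eventuallyEq x),
      ← mvfderiv_gram_det hg v]
    refine hcomp.trans ?_
    have h3 := hF.hasFDerivAt.hasMFDerivAt.mfderiv
    have h4 := congrArg (fun T : ℝ →L[ℝ] ℝ =>
      T (mvfderiv 𝓘(ℝ, E) (fun y => (gram g x y).det) x v)) h3
    refine h4.trans ?_
    rw [ContinuousLinearMap.toSpanSingleton_apply, smul_eq_mul, mul_comm]
  have h3 : metricDensity g x = densityUnit E x ((d ^ 2) ^ e) := rfl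
  change densityUnit E x (mvfderiv 𝓘(ℝ, E) (localRep E x (metricDensity g)) x v) +
    (1 / ((Module.finrank ℝ E : ℝ) + 1)) • connectionTrace nabla x v • metricDensity g x = 0
  rw [h2, h3, ← map_smul, ← map_smul, ← map_add]
  have h4 : (d ^ 2) ^ e = (d ^ 2) ^ (e - 1) * d ^ 2 := by
    rw [← Real.rpow_add_one (pow_ne_zero 2 hd0), sub_add_cancel]
  have h5 : (Module.finrank ℝ E : ℝ) + 1 ≠ 0 := by positivity
  -- The logarithmic derivative of $(\det^2)^e$ is $4e$ times the connection trace, which balances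
  -- the connection form of $\mathcal E(1)$.
  have h6 : 4 * e = -(1 / ((Module.finrank ℝ E : ℝ) + 1)) := by
    have : 4 * (Module.finrank ℝ E : ℝ) + 4 ≠ 0 := by positivity
    rw [he]
    field_simp
  rw [h4, smul_eq_mul, smul_eq_mul]
  convert map_zero (densityUnit E x) using 2
  linear_combination ((d ^ 2) ^ (e - 1) * d ^ 2 * connectionTrace nabla x v) * h6

end MetricDensity

/-! ### Tractors as pairs $(X,\rho)$. -/

section MetricTractors

set_option linter.unusedSectionVars false

variable {E : Type*} [NormedAddCommGroup E] [NormedSpace ℝ E] [FiniteDimensional ℝ E]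
variable {M : Type*} [TopologicalSpace M] [ChartedSpace E M] [IsManifold 𝓘(ℝ, E) ∞ M]
variable {r s : ℕ} {g : PseudoRiemannianMetric E M r s} {nabla : AffineConnection E M}
variable {x : M} {f : M → ℝ}

/-! ### Densities as functions -/

variable (g) in
/-- The coefficient of a density with respect to the density of the metric. -/
def metricCoeff (x : M) : Density E x →ₗ[ℝ] ℝ :=
  ((densityUnit E x).symm (metricDensity g x))⁻¹ • (densityUnit E x).symm.toLinearMap

theorem metricCoeff_metricDensity (x : M) : metricCoeff g x (metricDensity g x) = 1 := by
  have h : (densityUnit E x).symm (metricDensity g x) ≠ 0 :=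
    (densityUnit E x).symm.map_ne_zero_iff.2 (metricDensity_ne_zero x)
  exact inv_mul_cancel₀ h

theorem metricCoeff_smul (σ : Density E x) : metricCoeff g x σ • metricDensity g x = σ := by
  have h : (densityUnit E x).symm (metricDensity g x) ≠ 0 :=
    (densityUnit E x).symm.map_ne_zero_iff.2 (metricDensity_ne_zero x)
  apply (densityUnit E x).symm.injective
  rw [map_smul]
  change (((densityUnit E x).symm (metricDensity g x))⁻¹ * (densityUnit E x).symm σ) *
    (densityUnit E x).symm (metricDensity g x) = _
  field_simp

/-- A density smooth near a point is a smooth function times the density of the metric. -/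
theorem smoothFunNear_metricCoeff {σ : Π y : M, Density E y} (hσ : σ ∈ smoothNear E x) :
    SmoothFunNear E (fun y => metricCoeff g y (σ y)) x := by
  obtain ⟨U, hU, hxU, h⟩ := hσ
  filter_upwards [hU.mem_nhds hxU] with z hz
  have h1 := h.contMDiffAt (hU.mem_nhds hz)
  rw [contMDiffAt_section] at h1
  have h2 := localRep_metricDensity_smooth (g := g) z
  have h0 : ∀ y ∈ (chartAt E z).source, localRep E z (metricDensity g) y ≠ 0 := by
    intro y hy
    rw [localRep_metricDensity hy]
    have := gram_det_ne_zero (g := g) hy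
    positivity
  refine (h1.div₀ h2 (h0 z (mem_chart_source E z))).congr_of_eventuallyEq ?_
  filter_upwards [(chartAt E z).open_source.mem_nhds (mem_chart_source E z)] with y hy
  rw [Pi.div_apply, eq_div_iff (h0 y hy), ← localRep_smul z (fun y => metricCoeff g y (σ y)) _ hy]
  refine congrArg (fun τ => localRep E z τ y) (funext fun w => ?_)
  exact metricCoeff_smul (σ w)

theorem smul_metricDensity_mem_smoothNear (hf : SmoothFunNear E f x) :
    f • metricDensity g ∈ smoothNear E x := by
  obtain ⟨U, hfU, hU, hxU⟩ := eventually_nhds_iff.1 hf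
  exact ⟨U, hU, hxU, ContMDiffOn.smul_section (fun y hy => (hfU y hy).contMDiffWithinAt)
    (smoothDensityOn_metricDensity g U)⟩

theorem smoothDensityOn_smul_metricDensity {V : Set M} (hf : ∀ y ∈ V, SmoothFunNear E f y) :
    SmoothDensityOn E (f • metricDensity g) V :=
  ContMDiffOn.smul_section (fun y hy => (hf y hy).contMDiffAt.contMDiffWithinAt)
    (smoothDensityOn_metricDensity g V)

theorem densityD_smul_metricDensity (hg : IsLeviCivita g nabla)
    (hf : MDifferentiableAt 𝓘(ℝ, E) 𝓘(ℝ, ℝ) f x) :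
    densityD nabla (f • metricDensity g) x =
      (mvfderiv 𝓘(ℝ, E) f x).toLinearMap.smulRight (metricDensity g x) := by
  have h0 := densityD_metricDensity (g := g) hg x
  have h1 : localRep E x (f • metricDensity g) =ᶠ[𝓝 x] f * localRep E x (metricDensity g) := by
    filter_upwards [(chartAt E x).open_source.mem_nhds (mem_chart_source E x)] with y hy
    exact localRep_smul x f _ hy
  have h2 := (localRep_metricDensity_smooth (g := g) x).mdifferentiableAt (by simp)
  refine LinearMap.ext fun v => ?_
  have h3 : densityUnit E x (mvfderiv 𝓘(ℝ, E) (localRep E x (metricDensity g)) x v) +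
    (1 / ((Module.finrank ℝ E : ℝ) + 1)) • connectionTrace nabla x v • metricDensity g x = 0 :=
    congrArg (fun L => L v) h0
  change densityUnit E x (mvfderiv 𝓘(ℝ, E) (localRep E x (f • metricDensity g)) x v) +
    (1 / ((Module.finrank ℝ E : ℝ) + 1)) • connectionTrace nabla x v • f x • metricDensity g x =
      mvfderiv 𝓘(ℝ, E) f x v • metricDensity g x
  have h4 : mvfderiv 𝓘(ℝ, E) (localRep E x (f • metricDensity g)) x v =
      f x • mvfderiv 𝓘(ℝ, E) (localRep E x (metricDensity g)) x v +
        mvfderiv 𝓘(ℝ, E) f x v • localRep E x (metricDensity g) x := by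
    rw [ProjectiveTractor.mvfderiv_congr h1, mvfderiv_mul hf h2]
    simp [mul_comm]
  rw [h4, map_add, map_smul, map_smul, localRep_self]
  linear_combination (norm := module) f x • h3

theorem densityD_congr {σ τ : Π y : M, Density E y} (h : σ =ᶠ[𝓝 x] τ) :
    densityD nabla σ x = densityD nabla τ x := by
  have h1 : localRep E x σ =ᶠ[𝓝 x] localRep E x τ := by
    filter_upwards [h] with y hy
    rw [localRep, localRep, hy]
  rw [densityD, densityD, ProjectiveTractor.mvfderiv_congr h1, h.eq_of_nhds]

theorem splitting_jet_smul_metricDensity (hg : IsLeviCivita g nabla) (hf : SmoothFunNear E f x) :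
    splitting nabla x (jet E (f • metricDensity g) x) =
      ((mvfderiv 𝓘(ℝ, E) f x).toLinearMap.smulRight (metricDensity g x),
        f x • metricDensity g x) := by
  rw [splitting_jet nabla (smul_metricDensity_mem_smoothNear hf),
    densityD_smul_metricDensity hg hf.diff]
  rfl

theorem jet_representative (a : Cotractor E x) :
    representative E a ∈ smoothNear E x ∧ jet E (representative E a) x = a := by
  have h : representative E a ∈ smoothNear E x := Subtype.property _
  refine ⟨h, ?_⟩
  rw [jet, dif_pos h]
  exact Function.surjInv_eq (Submodule.mkQ_surjective (LinearMap.ker (jetCoord E x))) a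

-- Dual connections are tested on representatives of 1-jets; this reduces every such test to a
-- function times the metric density.
variable (g) in
theorem exists_representative_eq (a : Cotractor E x) : ∃ f : M → ℝ, SmoothFunNear E f x ∧
    representative E a = f • metricDensity g ∧ jet E (f • metricDensity g) x = a := by
  obtain ⟨h, hjet⟩ := jet_representative a
  have h1 : representative E a = (fun y => metricCoeff g y (representative E a y)) •
      metricDensity g := funext fun y => (metricCoeff_smul _).symm
  refine ⟨_, smoothFunNear_metricCoeff h, h1, ?_⟩
  rw [← h1, hjet]

/-! ### Tractors as pairs of a tangent vector and a number -/

variable (g nabla) in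
/-- The tractor with components `(X, ρ)` in the splitting determined by the Levi-Civita connection,
trivialising `E(1)` by the density of the metric. -/
def pairTractor (x : M) : TangentSpace 𝓘(ℝ, E) x × ℝ →ₗ[ℝ] Tractor E x :=
  LinearMap.mk₂ ℝ (fun p a => metricCoeff g x ((splitting nabla x a).1 p.1) +
      p.2 * metricCoeff g x (splitting nabla x a).2)
    (by intro p q a; simp only [Prod.fst_add, Prod.snd_add, map_add]; ring)
    (by intro c p a; simp only [Prod.smul_fst, Prod.smul_snd, map_smul, smul_eq_mul]; ring)
    (by intro p a b; simp only [map_add, Prod.fst_add, Prod.snd_add, LinearMap.add_apply]; ring)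
    (by intro c p a; simp only [map_smul, Prod.smul_fst, Prod.smul_snd, LinearMap.smul_apply,
      smul_eq_mul]; ring)

theorem pairTractor_apply (p : TangentSpace 𝓘(ℝ, E) x × ℝ) (a : Cotractor E x) :
    pairTractor g nabla x p a = metricCoeff g x ((splitting nabla x a).1 p.1) +
      p.2 * metricCoeff g x (splitting nabla x a).2 :=
  rfl

/-- As the metric density is parallel, a tractor is a first order operator $f\mapsto Xf+\rho f$.
Smoothness and derivatives of tractors are computed in this form. -/
theorem pairTractor_jet (hg : IsLeviCivita g nabla) (hf : SmoothFunNear E f x)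
    (p : TangentSpace 𝓘(ℝ, E) x × ℝ) :
    pairTractor g nabla x p (jet E (f • metricDensity g) x) =
      mvfderiv 𝓘(ℝ, E) f x p.1 + p.2 * f x := by
  rw [pairTractor_apply, splitting_jet_smul_metricDensity hg hf]
  simp only [LinearMap.smulRight_apply, map_smul, metricCoeff_metricDensity, smul_eq_mul, mul_one]
  rfl

theorem pairTractor_injective (x : M) : Function.Injective (pairTractor g nabla x) := by
  rw [← LinearMap.ker_eq_bot, LinearMap.ker_eq_bot']
  intro p hp
  have h : ∀ q : (TangentSpace 𝓘(ℝ, E) x →ₗ[ℝ] Density E x) × Density E x,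
      metricCoeff g x (q.1 p.1) +
      p.2 * metricCoeff g x q.2 = 0 := by
    intro q
    have := congrArg (fun L => L ((splitting nabla x).symm q)) hp
    rwa [pairTractor_apply, LinearEquiv.apply_symm_apply] at this
  refine Prod.ext ?_ ?_
  · refine (Module.forall_dual_apply_eq_zero_iff ℝ p.1).1 fun α => ?_
    have h1 := h (α.smulRight (metricDensity g x), 0)
    simpa [metricCoeff_metricDensity] using h1
  · have h1 := h (0, metricDensity g x)
    simpa [metricCoeff_metricDensity] using h1

theorem finrank_tractor (x : M) :
    Module.finrank ℝ (TangentSpace 𝓘(ℝ, E) x × ℝ) = Module.finrank ℝ (Tractor E x) := by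
  have h : Module.finrank ℝ (Density E x) = 1 :=
    (densityUnit E x).symm.finrank_eq.trans (Module.finrank_self ℝ)
  rw [Subspace.dual_finrank_eq, (jetEquiv E x).finrank_eq, Module.finrank_prod,
    Module.finrank_prod, Module.finrank_linearMap, h, mul_one, Module.finrank_self]

variable (g nabla) in
/-- The tractor bundle as the sum of the tangent bundle and a trivial line bundle. -/
def tractorEquiv (x : M) : Tractor E x ≃ₗ[ℝ] TangentSpace 𝓘(ℝ, E) x × ℝ :=
  ((pairTractor g nabla x).linearEquivOfInjective (pairTractor_injective x)
    (finrank_tractor x)).symm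

@[simp]
theorem pairTractor_tractorEquiv (t : Tractor E x) :
    pairTractor g nabla x (tractorEquiv g nabla x t) = t :=
  LinearEquiv.apply_symm_apply
    ((pairTractor g nabla x).linearEquivOfInjective (pairTractor_injective x) (finrank_tractor x)) t

@[simp]
theorem tractorEquiv_pairTractor (p : TangentSpace 𝓘(ℝ, E) x × ℝ) :
    tractorEquiv g nabla x (pairTractor g nabla x p) = p :=
  pairTractor_injective (g := g) (nabla := nabla) x (pairTractor_tractorEquiv _)

/-- The tractor field with components `(X, ρ)` is smooth if these are. -/
theorem smoothTractorOn_pairTractor (hg : IsLeviCivita g nabla) {U : Set M}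
    {X : Π y : M, TangentSpace 𝓘(ℝ, E) y} {ρ : M → ℝ} (hX : ∀ y ∈ U, SmoothFieldNear X y)
    (hρ : ∀ y ∈ U, SmoothFunNear E ρ y) :
    SmoothTractorOn E (fun y => pairTractor g nabla y (X y, ρ y)) U := by
  intro V hV hVU σ hσ y hy
  have hf : ∀ z ∈ V, SmoothFunNear E (fun y => metricCoeff g y (σ y)) z := fun z hz =>
    smoothFunNear_metricCoeff ⟨V, hV, hz, hσ⟩
  have hσ' : σ = (fun y => metricCoeff g y (σ y)) • metricDensity g :=
    funext fun y => (metricCoeff_smul _).symm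
  have h1 := (((hf y hy).mvfderiv_apply (hX y (hVU hy))).add
    ((hρ y (hVU hy)).mul (hf y hy))).contMDiffAt
  refine (h1.congr_of_eventuallyEq ?_).contMDiffWithinAt
  filter_upwards [hV.mem_nhds hy] with z hz
  have h2 := pairTractor_jet hg (hf z hz) (X z, ρ z)
  rw [← hσ'] at h2
  exact h2

/-- The derivative of a linear coordinate of a chart, in terms of the trivialisation of the tangent
bundle by this chart. -/
theorem mvfderiv_coordinate (L : E →L[ℝ] ℝ) {y : M} (hy : y ∈ (chartAt E x).source)
    (v : TangentSpace 𝓘(ℝ, E) y) :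
    mvfderiv 𝓘(ℝ, E) (fun z => L (extChartAt 𝓘(ℝ, E) x z)) y v =
      L (trivializationAt E (TangentSpace 𝓘(ℝ, E) : M → Type _) x ⟨y, v⟩).2 := by
  have h1 := mvfderiv_comp_apply (I := 𝓘(ℝ, E)) (I' := 𝓘(ℝ, E)) y
    (L.differentiableAt (x := extChartAt 𝓘(ℝ, E) x y)).mdifferentiableAt
    (mdifferentiableAt_extChartAt (I := 𝓘(ℝ, E)) hy) v
  refine h1.trans ?_
  rw [← TangentBundle.continuousLinearMapAt_trivializationAt hy]
  have h2 : mvfderiv 𝓘(ℝ, E) L (extChartAt 𝓘(ℝ, E) x y) = L := by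
    refine ContinuousLinearMap.ext fun w => ?_
    exact congrArg (fun T : E →L[ℝ] ℝ => T w)
      ((L.hasFDerivAt (x := extChartAt 𝓘(ℝ, E) x y)).hasMFDerivAt.mfderiv)
  rw [h2]
  refine congrArg L ?_
  exact congrFun (Trivialization.coe_linearMapAt_of_mem
    (trivializationAt E (TangentSpace 𝓘(ℝ, E) : M → Type _) x) (R := ℝ) hy) v

/-- The components of a smooth tractor field are smooth. -/
theorem SmoothTractorOn.smooth_components (hg : IsLeviCivita g nabla) {U : Set M} (hU : IsOpen U)
    {t : Π y : M, Tractor E y} (ht : SmoothTractorOn E t U) (hx : x ∈ U) :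
    SmoothFieldNear (fun y => (tractorEquiv g nabla y (t y)).1) x ∧
      SmoothFunNear E (fun y => (tractorEquiv g nabla y (t y)).2) x := by
  set X : Π y : M, TangentSpace 𝓘(ℝ, E) y := fun y => (tractorEquiv g nabla y (t y)).1
  set ρ : M → ℝ := fun y => (tractorEquiv g nabla y (t y)).2
  have hjet : ∀ (f : M → ℝ) (y : M), SmoothFunNear E f y →
      t y (jet E (f • metricDensity g) y) = mvfderiv 𝓘(ℝ, E) f y (X y) + ρ y * f y := by
    intro f y hf
    rw [← pairTractor_jet hg hf (X y, ρ y)]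
    exact congrArg (fun s => s (jet E (f • metricDensity g) y))
      (pairTractor_tractorEquiv (t y)).symm
  -- Applied to the function 1 the operator $f\mapsto Xf+\rho f$ returns $\rho$.
  have hρ : ∀ y ∈ U, ContMDiffAt 𝓘(ℝ, E) 𝓘(ℝ, ℝ) ∞ ρ y := by
    intro y hy
    have h1 : ∀ z, SmoothFunNear E (fun _ : M => (1 : ℝ)) z := fun z => smoothFunNear_const E 1 z
    have h2 := ht U hU subset_rfl _ (smoothDensityOn_smul_metricDensity (g := g) fun z _ => h1 z)
    refine (h2.contMDiffAt (hU.mem_nhds hy)).congr_of_eventuallyEq ?_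
    refine Filter.Eventually.of_forall fun z => ?_
    refine Eq.trans ?_ (hjet _ z (h1 z)).symm
    rw [mvfderiv_const, _root_.zero_apply, zero_add, mul_one]
  refine ⟨?_, Filter.eventually_of_mem (hU.mem_nhds hx) hρ⟩
  refine Filter.eventually_of_mem (hU.mem_nhds hx) fun x₀ hx₀ => ?_
  rw [contMDiffAt_section]
  let b := Module.finBasis ℝ E
  -- Applied to chart coordinates, the operator returns the components of $X$, once the known term
  -- $\rho f$ is subtracted.
  let F : Fin (Module.finrank ℝ E) → M → ℝ := fun a y =>
    (b.coord a).toContinuousLinearMap (extChartAt 𝓘(ℝ, E) x₀ y)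
  let V := U ∩ (chartAt E x₀).source
  have hV : IsOpen V := hU.inter (chartAt E x₀).open_source
  have hxV : x₀ ∈ V := ⟨hx₀, mem_chart_source E x₀⟩
  have hF : ∀ a, ∀ y ∈ V, SmoothFunNear E (F a) y := by
    intro a y hy
    filter_upwards [hV.mem_nhds hy] with z hz
    exact (b.coord a).toContinuousLinearMap.contDiff.contMDiff.contMDiffAt.comp z
      (contMDiffOn_extChartAt.contMDiffAt ((chartAt E x₀).open_source.mem_nhds hz.2))
  have hcoord : ∀ a, ∀ y ∈ V, b.coord a
      (trivializationAt E (TangentSpace 𝓘(ℝ, E) : M → Type _) x₀ ⟨y, X y⟩).2 =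
        t y (jet E (F a • metricDensity g) y) - ρ y * F a y := by
    intro a y hy
    rw [hjet _ y (hF a y hy), add_sub_cancel_right]
    exact (mvfderiv_coordinate (b.coord a).toContinuousLinearMap hy.2 (X y)).symm
  have hsum : ∀ y ∈ V, (trivializationAt E (TangentSpace 𝓘(ℝ, E) : M → Type _) x₀ ⟨y, X y⟩).2 =
      ∑ a, (t y (jet E (F a • metricDensity g) y) - ρ y * F a y) • b a := by
    intro y hy
    rw [← b.sum_repr (trivializationAt E (TangentSpace 𝓘(ℝ, E) : M → Type _) x₀ ⟨y, X y⟩).2]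
    exact Finset.sum_congr rfl fun a _ => congrArg (· • b a) (hcoord a y hy)
  have hc : ∀ a, ContMDiffAt 𝓘(ℝ, E) 𝓘(ℝ, ℝ) ∞
      (fun y => t y (jet E (F a • metricDensity g) y) - ρ y * F a y) x₀ := fun a =>
    ((ht V hV Set.inter_subset_left _
      (smoothDensityOn_smul_metricDensity (g := g) (hF a))).contMDiffAt (hV.mem_nhds hxV)).sub
      ((hρ x₀ hx₀).mul (hF a x₀ hxV).contMDiffAt)
  have hc' : ContMDiffAt 𝓘(ℝ, E) 𝓘(ℝ, E) ∞ (fun y => ∑ a,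
      (t y (jet E (F a • metricDensity g) y) - ρ y * F a y) • b a) x₀ :=
    ContMDiffAt.sum fun a _ => (hc a).smul contMDiffAt_const
  exact hc'.congr_of_eventuallyEq (Filter.eventually_of_mem (hV.mem_nhds hxV) hsum)

end MetricTractors

/-! ### The tractor connection and $L^{\mathcal A}$ from any connection of the class. -/

section MetricTractorCalculus

set_option linter.unusedSectionVars false

variable {E : Type*} [NormedAddCommGroup E] [NormedSpace ℝ E] [FiniteDimensional ℝ E]
variable {M : Type*} [TopologicalSpace M] [T2Space M] [ChartedSpace E M] [IsManifold 𝓘(ℝ, E) ∞ M]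
variable {r s : ℕ} {g : PseudoRiemannianMetric E M r s} {nabla nabla' : AffineConnection E M}
variable {Υ : Π x : M, TangentSpace 𝓘(ℝ, E) x →L[ℝ] ℝ}
variable {x : M} {f : M → ℝ}

/-- The tractor connection on 1-jets, computed from a connection projectively equivalent to the
Levi-Civita connection, in the splitting of the latter. -/
theorem IsProjectiveChange.splitting_cotractorD (h : IsProjectiveChange nabla nabla' Υ)
    (hg : IsLeviCivita g nabla) (hN : 1 < Module.finrank ℝ E) (hf : SmoothFunNear E f x)
    (v : TangentSpace 𝓘(ℝ, E) x) :
    splitting nabla x (cotractorD nabla' (jet E (f • metricDensity g)) x v) =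
      ((oneFormDHom nabla hf.smoothFormNear v + f x • schouten nabla x v).smulRight
        (metricDensity g x), 0) := by
  have hs : ∀ y, SmoothFunNear E f y → splitting nabla' y (jet E (f • metricDensity g) y) =
      ((mvfderiv 𝓘(ℝ, E) f y + f y • Υ y).toLinearMap.smulRight (metricDensity g y),
        f y • metricDensity g y) := by
    intro y hy
    rw [h.splitting_eq, splitting_jet_smul_metricDensity hg hy]
    refine Prod.ext (LinearMap.ext fun u => ?_) rfl
    change mvfderiv 𝓘(ℝ, E) f y u • metricDensity g y + Υ y u • f y • metricDensity g y =
      (mvfderiv 𝓘(ℝ, E) f y u + f y • Υ y u) • metricDensity g y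
    rw [smul_eq_mul]
    module
  have hD : ∀ k : M → ℝ, MDifferentiableAt 𝓘(ℝ, E) 𝓘(ℝ, ℝ) k x →
      densityD nabla' (k • metricDensity g) x v =
        (mvfderiv 𝓘(ℝ, E) k x v + Υ x v * k x) • metricDensity g x := by
    intro k hk
    rw [h.densityD_eq, densityD_smul_metricDensity hg hk]
    change mvfderiv 𝓘(ℝ, E) k x v • metricDensity g x + Υ x v • k x • metricDensity g x = _
    module
  -- For a 1-jet the first slot is the derivative of the second, so this component vanishes.
  have h2 : densityD nabla' (fun y => (splitting nabla' y (jet E (f • metricDensity g) y)).2) x v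
      - (splitting nabla' x (jet E (f • metricDensity g) x)).1 v = 0 := by
    have h3 : (fun y => (splitting nabla' y (jet E (f • metricDensity g) y)).2) =ᶠ[𝓝 x]
        f • metricDensity g := by
      filter_upwards [hf.eventually] with y hy
      rw [hs y hy]
      rfl
    rw [densityD_congr h3, hD f hf.diff, hs x hf]
    change _ - (mvfderiv 𝓘(ℝ, E) f x v + f x • Υ x v) • metricDensity g x = 0
    rw [smul_eq_mul]
    module
  have h1 : (linearize fun u : TangentSpace 𝓘(ℝ, E) x =>
        densityD nabla' (fun y => (splitting nabla' y (jet E (f • metricDensity g) y)).1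
          (extendField u y)) x v
          - (splitting nabla' x (jet E (f • metricDensity g) x)).1 (nabla'.D (extendField u) x v))
      + (schouten nabla' x v).smulRight (splitting nabla' x (jet E (f • metricDensity g) x)).2 =
      (oneFormDHom nabla hf.smoothFormNear v + f x • schouten nabla x v).smulRight
        (metricDensity g x) := by
    have h3 : ∀ u : TangentSpace 𝓘(ℝ, E) x,
        densityD nabla' (fun y => (splitting nabla' y (jet E (f • metricDensity g) y)).1
          (extendField u y)) x v
          - (splitting nabla' x (jet E (f • metricDensity g) x)).1 (nabla'.D (extendField u) x v) =
        (oneFormDHom nabla hf.smoothFormNear v + f x • (oneFormDHom nabla (h.smooth x) v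
          - Υ x v • (Υ x).toLinearMap)).smulRight (metricDensity g x) u := by
      intro u
      have hu := smoothFieldNear_extendField u
      have h4 : (fun y => (splitting nabla' y (jet E (f • metricDensity g) y)).1
          (extendField u y)) =ᶠ[𝓝 x] ((fun y => mvfderiv 𝓘(ℝ, E) f y (extendField u y)) +
            f * fun y => Υ y (extendField u y)) • metricDensity g := by
        filter_upwards [hf.eventually] with y hy
        rw [hs y hy]
        rfl
      have h5 := (hf.mvfderiv_apply hu).diff
      have h6 := (h.smooth x _ hu).diff
      rw [densityD_congr h4, hD _ (h5.add (hf.diff.mul h6)), mvfderiv_add h5 (hf.diff.mul h6),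
        mvfderiv_mul hf.diff h6, hs x hf, h.D_eq _ _ hu.diff]
      change (mvfderiv 𝓘(ℝ, E) (fun y => mvfderiv 𝓘(ℝ, E) f y (extendField u y)) x v +
        (f x * mvfderiv 𝓘(ℝ, E) (fun y => Υ y (extendField u y)) x v +
          Υ x (extendField u x) * mvfderiv 𝓘(ℝ, E) f x v) +
        Υ x v * (mvfderiv 𝓘(ℝ, E) f x (extendField u x) + f x * Υ x (extendField u x))) •
          metricDensity g x -
        (mvfderiv 𝓘(ℝ, E) f x (nabla.D (extendField u) x v + Υ x v • extendField u x
          + Υ x (extendField u x) • v) + f x • Υ x (nabla.D (extendField u) x v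
          + Υ x v • extendField u x + Υ x (extendField u x) • v)) • metricDensity g x =
        (oneFormD nabla (fun y => mvfderiv 𝓘(ℝ, E) f y) x v u +
          f x * (oneFormD nabla Υ x v u - Υ x v * Υ x u)) • metricDensity g x
      rw [oneFormD, oneFormD, ← sub_smul]
      simp only [map_add, map_smul, smul_eq_mul, extendField_self]
      congr 1
      ring
    rw [linearize_eq _ _ h3, hs x hf]
    refine LinearMap.ext fun u => ?_
    change (oneFormD nabla (fun y => mvfderiv 𝓘(ℝ, E) f y) x v u +
          f x * (oneFormD nabla Υ x v u - Υ x v * Υ x u)) • metricDensity g x +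
          schouten nabla' x v u • f x • metricDensity g x =
        (oneFormD nabla (fun y => mvfderiv 𝓘(ℝ, E) f y) x v u + f x * schouten nabla x v u) •
          metricDensity g x
    -- The change $-\nabla\Upsilon+\Upsilon\otimes\Upsilon$ of the Schouten tensor cancels the
    -- remaining terms in $\Upsilon$.
    rw [h.schouten_eq hN]
    module
  have h7 : splitting nabla' x (cotractorD nabla' (jet E (f • metricDensity g)) x v) =
      ((oneFormDHom nabla hf.smoothFormNear v + f x • schouten nabla x v).smulRight
        (metricDensity g x), 0) := by
    rw [cotractorD, LinearEquiv.apply_symm_apply, h1, h2]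
  rw [h.splitting_eq] at h7
  have h8 := congrArg Prod.snd h7
  have h9 := congrArg Prod.fst h7
  simp only at h8 h9
  -- With zero second slot, the two splittings agree on this cotractor.
  rw [h8] at h9
  refine Prod.ext ?_ h8
  rw [← h9]
  refine LinearMap.ext fun u => ?_
  simp

/-- The tractor connection in terms of components, computed from any connection projectively
equivalent to the Levi-Civita connection. -/
theorem IsProjectiveChange.tractorD_pairTractor (h : IsProjectiveChange nabla nabla' Υ)
    (hg : IsLeviCivita g nabla) (hN : 1 < Module.finrank ℝ E)
    {X : Π y : M, TangentSpace 𝓘(ℝ, E) y} {ρ : M → ℝ} (hX : SmoothFieldNear X x)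
    (hρ : SmoothFunNear E ρ x) (v : TangentSpace 𝓘(ℝ, E) x) :
    tractorD nabla' (fun y => pairTractor g nabla y (X y, ρ y)) x v =
      pairTractor g nabla x (nabla.D X x v + ρ x • v,
        mvfderiv 𝓘(ℝ, E) ρ x v - schouten nabla x v (X x)) := by
  refine linearize_eq _ _ fun a => ?_
  obtain ⟨f, hf, ha, hja⟩ := exists_representative_eq g a
  rw [ha, ← hja]
  have h1 : (fun y => pairTractor g nabla y (X y, ρ y) (jet E (f • metricDensity g) y)) =ᶠ[𝓝 x]
      (fun y => mvfderiv 𝓘(ℝ, E) f y (X y)) + ρ * f := by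
    filter_upwards [hf.eventually] with y hy
    exact pairTractor_jet hg hy _
  have h2 := (hf.mvfderiv_apply hX).diff
  have h3 := oneFormD_eq (nabla := nabla) hf.smoothFormNear hX v
  rw [ProjectiveTractor.mvfderiv_congr h1, mvfderiv_add h2 (hρ.diff.mul hf.diff),
    mvfderiv_mul hρ.diff hf.diff, pairTractor_jet hg hf, pairTractor_apply,
    h.splitting_cotractorD hg hN hf]
  simp only [LinearMap.smulRight_apply, map_smul, metricCoeff_metricDensity, map_zero, smul_eq_mul,
    LinearMap.add_apply, LinearMap.smul_apply, oneFormDHom_apply, h3, _root_.add_apply,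
    _root_.smul_apply, map_add]
  ring

/-- The splitting operator on a divergence free vector field, computed from any connection
projectively equivalent to the Levi-Civita connection. -/
theorem IsProjectiveChange.splittingOperator_pairTractor (h : IsProjectiveChange nabla nabla' Υ)
    (hN : 1 < Module.finrank ℝ E) {ξ : Π y : M, TangentSpace 𝓘(ℝ, E) y} (hξ : SmoothField ξ)
    (hdiv : ∀ y, divergence nabla ξ y = 0) (p : TangentSpace 𝓘(ℝ, E) x × ℝ) :
    splittingOperator nabla' ξ x (pairTractor g nabla x p) =
      pairTractor g nabla x (nabla.D ξ x p.1 + p.2 • ξ x, -schouten nabla x p.1 (ξ x)) := by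
  have h3 : (Module.finrank ℝ E : ℝ) + 1 ≠ 0 := by positivity
  have hdiv' : divergence nabla' ξ = fun y => ((Module.finrank ℝ E : ℝ) + 1) * Υ y (ξ y) := by
    funext y
    -- The two extra terms have traces $\Upsilon(\xi)$ and $N\Upsilon(\xi)$, so the divergence
    -- becomes $(N+1)\Upsilon(\xi)$.
    have h4 : (nabla'.D ξ y).toLinearMap = (nabla.D ξ y).toLinearMap +
        (Υ y).toLinearMap.smulRight (ξ y) + Υ y (ξ y) • LinearMap.id := by
      refine LinearMap.ext fun v => ?_
      exact h.D_eq y ξ (hξ.near y).diff v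
    have hN' : Module.finrank ℝ (TangentSpace 𝓘(ℝ, E) y) = Module.finrank ℝ E := rfl
    have h5 := hdiv y
    rw [divergence] at h5 ⊢
    rw [h4]
    simp only [map_add, map_smul, LinearMap.trace_smulRight, LinearMap.trace_id, hN', h5,
      smul_eq_mul]
    change 0 + Υ y (ξ y) + _ = _
    ring
  have hΥξ := (h.smooth x ξ (hξ.near x)).diff
  have hd : (1 / ((Module.finrank ℝ E : ℝ) + 1)) * divergence nabla' ξ x = Υ x (ξ x) := by
    rw [hdiv']
    field_simp
  have hd' : (1 / ((Module.finrank ℝ E : ℝ) + 1)) •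
      (mvfderiv 𝓘(ℝ, E) (divergence nabla' ξ) x).toLinearMap =
        (mvfderiv 𝓘(ℝ, E) (fun y => Υ y (ξ y)) x).toLinearMap := by
    have h4 := mvfderiv_mul (I := 𝓘(ℝ, E)) (x := x) (f := fun _ => (Module.finrank ℝ E : ℝ) + 1)
      mdifferentiableAt_const hΥξ
    rw [mvfderiv_const] at h4
    refine LinearMap.ext fun v => ?_
    have h5 : mvfderiv 𝓘(ℝ, E) (divergence nabla' ξ) x v =
        ((Module.finrank ℝ E : ℝ) + 1) * mvfderiv 𝓘(ℝ, E) (fun y => Υ y (ξ y)) x v := by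
      rw [hdiv']
      refine (congrArg (fun L : TangentSpace 𝓘(ℝ, E) x →L[ℝ] ℝ => L v) h4).trans ?_
      simp only [_root_.smul_apply, smul_zero, add_zero, smul_eq_mul]
    refine (congrArg (fun z => (1 / ((Module.finrank ℝ E : ℝ) + 1)) * z) h5).trans ?_
    rw [← mul_assoc, one_div_mul_cancel h3, one_mul]
    rfl
  refine LinearMap.ext fun a => ?_
  -- The operator is a transpose, so it is evaluated by moving it onto the cotractor `a`; `c` is the
  -- image of `a`.
  obtain ⟨c, hc, hc'⟩ : ∃ c, splittingOperator nabla' ξ x (pairTractor g nabla x p) a =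
      pairTractor g nabla x p c ∧ splitting nabla' x c =
        ((splitting nabla' x a).1 ∘ₗ ((nabla'.D ξ x).toLinearMap -
            ((1 / ((Module.finrank ℝ E : ℝ) + 1)) * divergence nabla' ξ x) • LinearMap.id) +
          (-((1 / ((Module.finrank ℝ E : ℝ) + 1)) •
            (mvfderiv 𝓘(ℝ, E) (divergence nabla' ξ) x).toLinearMap)
              - (schouten nabla' x).flip (ξ x)).smulRight (splitting nabla' x a).2,
          (splitting nabla' x a).1 (ξ x) +
            (-((1 / ((Module.finrank ℝ E : ℝ) + 1)) * divergence nabla' ξ x)) •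
              (splitting nabla' x a).2) :=
    ⟨(splitting nabla' x).symm _, rfl, LinearEquiv.apply_symm_apply _ _⟩
  rw [hd, hd', h.splitting_eq x a, h.splitting_eq x c] at hc'
  rw [hc, pairTractor_apply, pairTractor_apply]
  generalize hm : (splitting nabla x a).1 = μ at hc' ⊢
  generalize hσ : (splitting nabla x a).2 = σ at hc' ⊢
  generalize hm' : (splitting nabla x c).1 = μ' at hc' ⊢
  generalize hσ' : (splitting nabla x c).2 = σ' at hc' ⊢
  have h2 : σ' = μ (ξ x) := by
    have h4 : σ' = μ (ξ x) + Υ x (ξ x) • σ + (-Υ x (ξ x)) • σ := congrArg Prod.snd hc'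
    rw [h4]
    module
  have h1 : μ' p.1 = μ (nabla.D ξ x p.1) - schouten nabla x p.1 (ξ x) • σ := by
    have h4 : μ' p.1 + Υ x p.1 • σ' =
        μ (nabla'.D ξ x p.1 - Υ x (ξ x) • p.1) +
          Υ x (nabla'.D ξ x p.1 - Υ x (ξ x) • p.1) • σ +
          (-mvfderiv 𝓘(ℝ, E) (fun y => Υ y (ξ y)) x p.1 - schouten nabla' x p.1 (ξ x)) • σ :=
      congrArg (fun L => L p.1) (congrArg Prod.fst hc')
    rw [h2, h.D_eq x ξ (hξ.near x).diff, h.schouten_eq hN,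
      oneFormD_eq (h.smooth x) (hξ.near x)] at h4
    simp only [map_add, map_sub, map_smul, smul_eq_mul] at h4
    linear_combination (norm := module) h4
  rw [h1, h2]
  simp only [map_add, map_sub, map_smul, smul_eq_mul]
  ring

end MetricTractorCalculus

/-! ### The tractor metric and the three complex structures. -/

section Hyperkaehler

set_option linter.unusedSectionVars false

variable {E : Type*} [NormedAddCommGroup E] [NormedSpace ℝ E] [FiniteDimensional ℝ E]
variable {M : Type*} [TopologicalSpace M] [T2Space M] [ChartedSpace E M] [IsManifold 𝓘(ℝ, E) ∞ M]
variable {r s : ℕ} {g : PseudoRiemannianMetric E M r s} {nabla nabla' : AffineConnection E M}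
variable {x : M} {ξ i j k : Π y : M, TangentSpace 𝓘(ℝ, E) y}

theorem exists_pairTractor_eq (g : PseudoRiemannianMetric E M r s) (nabla : AffineConnection E M)
    (t : Tractor E x) : ∃ p, pairTractor g nabla x p = t :=
  ⟨_, pairTractor_tractorEquiv t⟩

variable (g nabla) in
/-- The tractor metric `h((X, ρ), (Y, κ)) = g(X, Y) + ρ κ`. -/
def tractorMetric (x : M) : LinearMap.BilinForm ℝ (Tractor E x) :=
  (g.form x).compl₁₂ (LinearMap.fst ℝ _ ℝ ∘ₗ (tractorEquiv g nabla x).toLinearMap)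
      (LinearMap.fst ℝ _ ℝ ∘ₗ (tractorEquiv g nabla x).toLinearMap) +
    (LinearMap.mul ℝ ℝ).compl₁₂ (LinearMap.snd ℝ _ ℝ ∘ₗ (tractorEquiv g nabla x).toLinearMap)
      (LinearMap.snd ℝ _ ℝ ∘ₗ (tractorEquiv g nabla x).toLinearMap)

theorem tractorMetric_apply (t t' : Tractor E x) : tractorMetric g nabla x t t' =
    g.inner x (tractorEquiv g nabla x t).1 (tractorEquiv g nabla x t').1 +
      (tractorEquiv g nabla x t).2 * (tractorEquiv g nabla x t').2 :=
  rfl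

/-- The Schouten tensor of `∇` is the metric `g`. -/
def HasSchoutenMetric (g : PseudoRiemannianMetric E M r s) (nabla : AffineConnection E M) : Prop :=
  ∀ (x : M) (v w : TangentSpace 𝓘(ℝ, E) x), schouten nabla x v w = g.inner x v w

/-- If the Levi-Civita connection has Schouten tensor `g`, the metric on tractors is parallel. -/
theorem isParallelTractorMetric_tractorMetric (hg : IsLeviCivita g nabla)
    (hN : ∀ _ : M, 1 < Module.finrank ℝ E) (hP : HasSchoutenMetric g nabla) :
    IsParallelTractorMetric (projectiveClass nabla) (tractorMetric g nabla) (r + 1) s where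
  innerProduct x := (g.innerProduct x).prod_line (tractorEquiv g nabla x) _ tractorMetric_apply
  smooth U hU t t' ht ht' y hy := by
    obtain ⟨h1, h2⟩ := ht.smooth_components hg hU hy
    obtain ⟨h3, h4⟩ := ht'.smooth_components hg hU hy
    exact ((PseudoRiemannianMetric.inner_smooth h1 h3).add
      (h2.mul h4)).contMDiffAt.contMDiffWithinAt
  parallel nabla' hn U hU t t' ht ht' x hx v := by
    obtain ⟨Υ, h⟩ := exists_isProjectiveChange hn
    obtain ⟨h1, h2⟩ := ht.smooth_components hg hU hx
    obtain ⟨h3, h4⟩ := ht'.smooth_components hg hU hx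
    have h5 := h.tractorD_pairTractor hg (hN x) h1 h2 v
    have h6 := h.tractorD_pairTractor hg (hN x) h3 h4 v
    simp only [Prod.mk.eta, pairTractor_tractorEquiv] at h5 h6
    have h7 := mvfderiv_add (PseudoRiemannianMetric.inner_smooth (g := g) h1 h3).diff
      (h2.mul h4).diff
    rw [mvfderiv_mul h2.diff h4.diff] at h7
    refine (congrArg (fun L : TangentSpace 𝓘(ℝ, E) x →L[ℝ] ℝ => L v) h7).trans ?_
    have h8 := hg.mvfderiv_inner h1 h3 v
    simp only [_root_.add_apply, _root_.smul_apply, h8]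
    -- The terms $\rho\,g(v,Y)$ and $-P(v,Y)\rho$ cancel because $P=g$, as do those with the two
    -- tractors exchanged.
    rw [h5, h6, tractorMetric_apply, tractorMetric_apply]
    simp only [tractorEquiv_pairTractor, hP x, map_add, map_smul, _root_.add_apply,
      _root_.smul_apply, smul_eq_mul]
    rw [g.inner_symm v (tractorEquiv g nabla x (t' x)).1,
      g.inner_symm (tractorEquiv g nabla x (t x)).1 v,
      g.inner_symm (tractorEquiv g nabla x (t' x)).1 v]
    ring

theorem IsSasaki.splittingOperator_pairTractor (hξ : IsSasaki g nabla ξ) (hg : IsLeviCivita g nabla)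
    (hN : 1 < Module.finrank ℝ E) (hP : HasSchoutenMetric g nabla)
    (hn : nabla' ∈ projectiveClass nabla) (p : TangentSpace 𝓘(ℝ, E) x × ℝ) :
    splittingOperator nabla' ξ x (pairTractor g nabla x p) =
      pairTractor g nabla x (nabla.D ξ x p.1 + p.2 • ξ x, -g.inner x (ξ x) p.1) := by
  obtain ⟨Υ, h⟩ := exists_isProjectiveChange hn
  rw [h.splittingOperator_pairTractor hN hξ.smooth
    fun y => hξ.toIsKilling.divergence_eq_zero hg y, hP, g.inner_symm]

theorem self_mem_projectiveClass (nabla : AffineConnection E M) :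
    nabla ∈ projectiveClass nabla := by
  refine ⟨fun _ => 0, ?_, fun x Y _ v => by simp⟩
  exact contMDiff_zeroSection ℝ _

/-- The splitting operator on a Sasaki field may be computed from any connection of the projective
class. -/
theorem IsSasaki.splittingOperator_eq (hξ : IsSasaki g nabla ξ) (hg : IsLeviCivita g nabla)
    (hN : 1 < Module.finrank ℝ E) (hP : HasSchoutenMetric g nabla)
    (hn : nabla' ∈ projectiveClass nabla) :
    splittingOperator nabla' ξ x = splittingOperator nabla ξ x := by
  refine LinearMap.ext fun t => ?_
  obtain ⟨p, rfl⟩ := exists_pairTractor_eq g nabla t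
  rw [hξ.splittingOperator_pairTractor hg hN hP hn,
    hξ.splittingOperator_pairTractor hg hN hP (self_mem_projectiveClass nabla)]

/-- The endomorphism of the tractor bundle given by a Sasaki structure is a parallel complex
structure, if the Schouten tensor is the metric. -/
theorem IsSasaki.isParallelTractorComplexStructure (hξ : IsSasaki g nabla ξ)
    (hg : IsLeviCivita g nabla) (hN : ∀ _ : M, 1 < Module.finrank ℝ E)
    (hP : HasSchoutenMetric g nabla) :
    IsParallelTractorComplexStructure (projectiveClass nabla) (splittingOperator nabla ξ) := by
  have hn := self_mem_projectiveClass nabla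
  have hcomp : ∀ (t : Π y : M, Tractor E y), (fun y => splittingOperator nabla ξ y (t y)) =
      fun y => pairTractor g nabla y (nabla.D ξ y (tractorEquiv g nabla y (t y)).1 +
        (tractorEquiv g nabla y (t y)).2 • ξ y,
          -g.inner y (ξ y) (tractorEquiv g nabla y (t y)).1) := by
    intro t
    funext y
    rw [← hξ.splittingOperator_pairTractor hg (hN y) hP hn, pairTractor_tractorEquiv]
  refine ⟨fun x => ?_, fun U hU t ht => ?_, fun nabla' hn' U hU t ht x hx v => ?_⟩
  · refine LinearMap.ext fun t => ?_
    obtain ⟨p, rfl⟩ := exists_pairTractor_eq g nabla t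
    change splittingOperator nabla ξ x (splittingOperator nabla ξ x _) = -(pairTractor g nabla x p)
    rw [hξ.splittingOperator_pairTractor hg (hN x) hP hn,
      hξ.splittingOperator_pairTractor hg (hN x) hP hn]
    refine (congrArg _ (Prod.ext ?_ ?_)).trans (map_neg (pairTractor g nabla x) p)
    · change nabla.D ξ x (nabla.D ξ x p.1 + p.2 • ξ x) + (-g.inner x (ξ x) p.1) • ξ x = -p.1
      rw [map_add, map_smul, hξ.D_comp_self hg, hξ.D_self hg]
      module
    · change -g.inner x (ξ x) (nabla.D ξ x p.1 + p.2 • ξ x) = -p.2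
      rw [map_add, map_smul, hξ.inner_D hg, hξ.unit, zero_add, smul_eq_mul, mul_one]
  · rw [hcomp t]
    have h := fun y (hy : y ∈ U) => ht.smooth_components hg hU hy
    refine smoothTractorOn_pairTractor hg (fun y hy => ?_) fun y hy => ?_
    · exact (nabla.D_smooth (hξ.near y) (h y hy).1).add ((h y hy).2.smul_field (hξ.near y))
    · have h1 := (smoothFunNear_const E (-1) y).mul
        (PseudoRiemannianMetric.inner_smooth (g := g) (hξ.near y) (h y hy).1)
      refine h1.congr (Filter.Eventually.of_forall fun z => ?_)
      exact (neg_one_mul _).symm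
  · rw [hcomp t]
    obtain ⟨Υ, h⟩ := exists_isProjectiveChange hn'
    obtain ⟨h1, h2⟩ := ht.smooth_components hg hU hx
    have h3 := h.tractorD_pairTractor hg (hN x) h1 h2 v
    simp only [Prod.mk.eta, pairTractor_tractorEquiv] at h3
    have hφ := nabla.D_smooth (hξ.near x) h1
    have h4 := hφ.add (h2.smul_field (hξ.near x))
    have h5 := PseudoRiemannianMetric.inner_smooth (g := g) (hξ.near x) h1
    have h6 : SmoothFunNear E (fun y => -g.inner y (ξ y) (tractorEquiv g nabla y (t y)).1) x := by
      refine ((smoothFunNear_const E (-1) x).mul h5).congr (Filter.Eventually.of_forall fun z => ?_)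
      exact (neg_one_mul _).symm
    have h7 := h.tractorD_pairTractor hg (hN x) h4 h6 v
    refine h7.trans ?_
    rw [h3, hξ.splittingOperator_pairTractor hg (hN x) hP hn]
    have h8 : mvfderiv 𝓘(ℝ, E) (fun y => -g.inner y (ξ y) (tractorEquiv g nabla y (t y)).1) x v =
        -(g.inner x (nabla.D ξ x v) (tractorEquiv g nabla x (t x)).1 + g.inner x (ξ x)
          (nabla.D (fun y => (tractorEquiv g nabla y (t y)).1) x v)) := by
      rw [← hg.mvfderiv_inner (hξ.near x) h1 v]
      exact congrArg (fun L : TangentSpace 𝓘(ℝ, E) x →L[ℝ] ℝ => L v) mvfderiv_neg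
    refine congrArg _ (Prod.ext ?_ ?_)
    -- The tangent component is the Sasaki equation; the scalar component below is the skewness of
    -- $\nabla\xi$.
    · rw [nabla.D_add hφ.diff (h2.smul_field (hξ.near x)).diff, _root_.add_apply,
        nabla.D_smul h2.diff (hξ.near x).diff, hξ.D_D_apply h1]
      simp only [hP x, map_add, map_smul]
      module
    · simp only [h8, hP x, Pi.add_apply, Pi.smul_apply', map_add, map_smul, smul_eq_mul]
      rw [hξ.toIsKilling.skew hg v, g.inner_symm v (ξ x)]
      ring

theorem IsSasaki.isHermitian (hξ : IsSasaki g nabla ξ) (hg : IsLeviCivita g nabla)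
    (hN : ∀ _ : M, 1 < Module.finrank ℝ E) (hP : HasSchoutenMetric g nabla) :
    IsHermitian (tractorMetric g nabla) (splittingOperator nabla ξ) := by
  intro x t t'
  obtain ⟨p, rfl⟩ := exists_pairTractor_eq g nabla t
  obtain ⟨p', rfl⟩ := exists_pairTractor_eq g nabla t'
  have hn := self_mem_projectiveClass nabla
  rw [hξ.splittingOperator_pairTractor hg (hN x) hP hn,
    hξ.splittingOperator_pairTractor hg (hN x) hP hn, tractorMetric_apply, tractorMetric_apply]
  simp only [tractorEquiv_pairTractor, map_add, map_smul, _root_.add_apply, _root_.smul_apply,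
    hξ.inner_D hg, hξ.unit, smul_eq_mul]
  -- Skewness turns $g(\nabla_X\xi,\nabla_Y\xi)$ into $g(X,Y)-g(\xi,X)g(\xi,Y)$; the scalar
  -- components restore the missing product.
  rw [g.inner_symm _ (ξ x), hξ.inner_D hg, hξ.toIsKilling.skew hg, hξ.D_comp_self hg]
  simp only [map_add, map_neg, map_smul, smul_eq_mul, g.inner_symm p.1 (ξ x)]
  ring

/-- The quaternion relation. -/
theorem IsThreeSasaki.splittingOperator_mul (h : IsThreeSasaki g nabla i j k)
    (hN : 1 < Module.finrank ℝ E) (hP : HasSchoutenMetric g nabla) :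
    splittingOperator nabla i x * splittingOperator nabla j x = splittingOperator nabla k x := by
  have hn := self_mem_projectiveClass nabla
  have hg := h.leviCivita
  refine LinearMap.ext fun t => ?_
  obtain ⟨p, rfl⟩ := exists_pairTractor_eq g nabla t
  change splittingOperator nabla i x (splittingOperator nabla j x _) = _
  rw [h.sasaki_j.splittingOperator_pairTractor hg hN hP hn,
    h.sasaki_i.splittingOperator_pairTractor hg hN hP hn,
    h.sasaki_k.splittingOperator_pairTractor hg hN hP hn]
  refine congrArg _ (Prod.ext ?_ ?_)
  · change nabla.D i x (nabla.D j x p.1 + p.2 • j x) + (-g.inner x (j x) p.1) • i x = _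
    rw [map_add, map_smul, h.D_i_D_j, h.D_i_j]
    module
  · change -g.inner x (i x) (nabla.D j x p.1 + p.2 • j x) = -g.inner x (k x) p.1
    -- Skewness moves $\nabla j$ onto `i`, and $\nabla_i j=-k$.
    rw [map_add, map_smul, h.orthogonal_ij, g.inner_symm, h.sasaki_j.toIsKilling.skew hg, h.D_j_i,
      map_neg, g.inner_symm]
    simp

end Hyperkaehler

end ProjectiveTractor

end

theorem theorem3p1
    {E : Type*} [NormedAddCommGroup E] [NormedSpace ℝ E] [FiniteDimensional ℝ E]
    {M : Type*} [TopologicalSpace M] [T2Space M] [ChartedSpace E M] [IsManifold 𝓘(ℝ, E) ∞ M]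
    (p q : ℕ) (hp : 1 ≤ p)
    (g : PseudoRiemannianMetric E M (4 * p - 1) (4 * q))
    (nabla : AffineConnection E M)
    (i j k : Π x : M, TangentSpace 𝓘(ℝ, E) x)
    (h3 : IsThreeSasaki g nabla i j k) :
    ∃ (h : Π x : M, LinearMap.BilinForm ℝ (Tractor E x))
      (𝕀 𝕁 𝕂 : Π x : M, Module.End ℝ (Tractor E x)),
      IsParallelTractorMetric (projectiveClass nabla) h (4 * p) (4 * q) ∧
      IsParallelTractorComplexStructure (projectiveClass nabla) 𝕀 ∧
      IsParallelTractorComplexStructure (projectiveClass nabla) 𝕁 ∧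
      IsParallelTractorComplexStructure (projectiveClass nabla) 𝕂 ∧
      IsHermitian h 𝕀 ∧ IsHermitian h 𝕁 ∧ IsHermitian h 𝕂 ∧
      (∀ x, 𝕀 x * 𝕁 x * 𝕂 x = -1) ∧
      ∀ nabla' ∈ projectiveClass nabla, ∀ x,
        𝕀 x = splittingOperator nabla' i x ∧
        𝕁 x = splittingOperator nabla' j x ∧
        𝕂 x = splittingOperator nabla' k x := by
  -- The dimension is read off from the signature at a point, so a point is required. As $p\ge1$ it
  -- is at least 3, and the denominator of the Schouten tensor is nonzero.
  have hN : ∀ _ : M, 1 < Module.finrank ℝ E := by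
    intro x
    have h1 : 4 * p - 1 + 4 * q = Module.finrank ℝ E := (g.innerProduct x).add_eq_finrank
    omega
  have hP : HasSchoutenMetric g nabla := fun x => h3.schouten_eq (hN x)
  have hg := h3.leviCivita
  have hp' : 4 * p - 1 + 1 = 4 * p := by omega
  have hh := isParallelTractorMetric_tractorMetric hg hN hP
  rw [hp'] at hh
  refine ⟨tractorMetric g nabla, splittingOperator nabla i, splittingOperator nabla j,
    splittingOperator nabla k, hh, h3.sasaki_i.isParallelTractorComplexStructure hg hN hP,
    h3.sasaki_j.isParallelTractorComplexStructure hg hN hP,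
    h3.sasaki_k.isParallelTractorComplexStructure hg hN hP, h3.sasaki_i.isHermitian hg hN hP,
    h3.sasaki_j.isHermitian hg hN hP, h3.sasaki_k.isHermitian hg hN hP, fun x => ?_,
    fun nabla' hn x => ⟨?_, ?_, ?_⟩⟩
  -- $\mathbb I\mathbb J=\mathbb K$ reduces the triple product to $\mathbb K^2=-1$.
  · rw [h3.splittingOperator_mul (hN x) hP]
    exact (h3.sasaki_k.isParallelTractorComplexStructure hg hN hP).sq x
  · exact (h3.sasaki_i.splittingOperator_eq hg (hN x) hP hn).symm
  · exact (h3.sasaki_j.splittingOperator_eq hg (hN x) hP hn).symm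
  · exact (h3.sasaki_k.splittingOperator_eq hg (hN x) hP hn).symm
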